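/- Let $G$ be a compact semisimple Lie group of positive dimension, with Lie algebra $\mathfrak g$ and Killing form $B$. Identify left-invariant Riemannian metrics on $G$ with inner products on $\mathfrak g$, let $S$ assign to such a metric its scalar curvature, and let $(\cdot,\cdot)=-B$ be the standard metric. Let $\mathcal M_1$ be the set of all inner products on $\mathfrak g$ that have the same volume as $(\cdot,\cdot)$, that is, the same Gram determinant in a fixed basis of $\mathfrak g$. Local extrema are understood for the restriction of $S$ to $\mathcal M_1$, and a saddle point is a critical point of this restriction that is neither a local minimum point nor a local maximum point. Then $(\cdot,\cdot)$ is indeed an inner product on $\mathfrak g$, and the following assertions hold. (1) If $G$ is locally isomorphic to $SU(2)$, then $(\cdot,\cdot)$ is a strict local maximum point of $S$ on $\mathcal M_1$. (2) For every such $G$, the metric $(\cdot,\cdot)$ is not a local minimum point of $S$ on $\mathcal M_1$. (3) If $G$ is not simple (that is, $\mathfrak g$ is not a simple Lie algebra), then $(\cdot,\cdot)$ is a saddle point of $S$ on $\mathcal M_1$. (4) If $G$ is locally isomorphic to $Sp(n)$ for some $n\ge 2$ (the group of unitary quaternionic $n\times n$ matrices) or to $SU(n)$ for some $n\ge 3$,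 then $(\cdot,\cdot)$ is a saddle point of $S$ on $\mathcal M_1$. -/

import Mathlib

open scoped Manifold ContDiff Topology

noncomputable section

namespace LeftInvariant

/-- A smooth Lie group has the differentiability that the bracket on its Lie algebra needs. -/
instance lieGroup_minSmoothness {d : ℕ} {G : Type*} [TopologicalSpace G]
    [ChartedSpace (EuclideanSpace ℝ (Fin d)) G] [Group G] [LieGroup (𝓡 d) ∞ G] :
    LieGroup (𝓡 d) (minSmoothness ℝ 3) G :=
  LieGroup.of_le (n := ∞) (by
    rw [minSmoothness_of_isRCLikeNormedField]
    exact ENat.LEInfty.out)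

section Geometry

/- Throughout, `G` is a real (smooth) Lie group of dimension `d`, with Lie algebra
`GroupLieAlgebra (𝓡 d) G`, the tangent space at `1` with the bracket of left-invariant fields. -/
variable {d : ℕ} {G : Type*} [TopologicalSpace G] [ChartedSpace (EuclideanSpace ℝ (Fin d)) G]
  [Group G]

variable (d G) in
/-- Continuous bilinear forms on the Lie algebra of `G`, with their usual (vector space)
topology. -/
abbrev BilinearForm : Type :=
  GroupLieAlgebra (𝓡 d) G →L[ℝ] GroupLieAlgebra (𝓡 d) G →L[ℝ] ℝ

variable (d G) in
/-- Vector fields on `G`. -/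
abbrev VField : Type _ := (x : G) → TangentSpace (𝓡 d) x

/-- `Q` is an inner product on the Lie algebra; such `Q` correspond to the left-invariant
Riemannian metrics on `G`. -/
def IsInnerProduct (Q : BilinearForm d G) : Prop :=
  (∀ v w, Q v w = Q w v) ∧ ∀ v, v ≠ 0 → 0 < Q v v

/-- The left-invariant metric tensor on `G` whose value at the identity is `Q`:
`⟨u, v⟩ₓ = Q (dL u) (dL v)`, with `L` the left translation by `x⁻¹`. -/
def metric (Q : BilinearForm d G) (x : G) (u v : TangentSpace (𝓡 d) x) : ℝ :=
  Q (mfderiv (𝓡 d) (𝓡 d) (fun y : G => x⁻¹ * y) x u)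
    (mfderiv (𝓡 d) (𝓡 d) (fun y : G => x⁻¹ * y) x v)

/-- The function `x ↦ ⟨X, Y⟩ₓ`. -/
def pairing (Q : BilinearForm d G) (X Y : VField d G) (x : G) : ℝ := metric Q x (X x) (Y x)

/-- The derivative of the function `f` in the direction of the vector field `X`, at `x`. -/
def dirDeriv (X : VField d G) (f : G → ℝ) (x : G) : ℝ := mfderiv (𝓡 d) 𝓘(ℝ, ℝ) f x (X x)

/-- The right-hand side of the Koszul formula for `⟨∇_X Y, Z⟩`. -/
def koszul (Q : BilinearForm d G) (X Y Z : VField d G) (x : G) : ℝ :=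
  (dirDeriv X (pairing Q Y Z) x + dirDeriv Y (pairing Q Z X) x - dirDeriv Z (pairing Q X Y) x
    + pairing Q (VectorField.mlieBracket (𝓡 d) X Y) Z x
    - pairing Q (VectorField.mlieBracket (𝓡 d) Y Z) X x
    + pairing Q (VectorField.mlieBracket (𝓡 d) Z X) Y x) / 2

variable (d G) in
/-- A fixed basis of the Lie algebra. -/
def frame : Module.Basis (Fin (Module.finrank ℝ (GroupLieAlgebra (𝓡 d) G))) ℝ
    (GroupLieAlgebra (𝓡 d) G) :=
  haveI : FiniteDimensional ℝ (GroupLieAlgebra (𝓡 d) G) :=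
    inferInstanceAs (FiniteDimensional ℝ (EuclideanSpace ℝ (Fin d)))
  Module.finBasis ℝ (GroupLieAlgebra (𝓡 d) G)

/-- The left-invariant vector field extending the `i`-th basis vector. -/
def frameField (i : Fin (Module.finrank ℝ (GroupLieAlgebra (𝓡 d) G))) : VField d G :=
  mulInvariantVectorField (frame d G i)

/-- The Gram matrix of `Q` in the fixed basis; equivalently (by left-invariance), the matrix of
the metric tensor in the corresponding left-invariant frame, at any point of `G`. -/
def gram (Q : BilinearForm d G) :
    Matrix (Fin (Module.finrank ℝ (GroupLieAlgebra (𝓡 d) G)))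
      (Fin (Module.finrank ℝ (GroupLieAlgebra (𝓡 d) G))) ℝ :=
  Matrix.of fun i j => Q (frame d G i) (frame d G j)

/-- The Levi-Civita connection `∇_X Y` of the left-invariant metric given by `Q`: the vector
field whose inner products with the left-invariant frame are given by the Koszul formula. -/
def leviCivita (Q : BilinearForm d G) (X Y : VField d G) : VField d G := fun x =>
  ∑ i, ∑ j, ((gram Q)⁻¹ i j * koszul Q X Y (frameField i) x) • frameField j x

/-- The Riemann curvature `R(X, Y) Z = ∇_X ∇_Y Z - ∇_Y ∇_X Z - ∇_[X,Y] Z`. -/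
def curvature (Q : BilinearForm d G) (X Y Z : VField d G) : VField d G :=
  leviCivita Q X (leviCivita Q Y Z) - leviCivita Q Y (leviCivita Q X Z)
    - leviCivita Q (VectorField.mlieBracket (𝓡 d) X Y) Z

/-- The scalar curvature at `x`: the double trace
`∑ gⁱʲ gᵏˡ ⟨R(Xᵢ, Xₖ) Xₗ, Xⱼ⟩` in the left-invariant frame. -/
def scalarCurvatureAt (Q : BilinearForm d G) (x : G) : ℝ :=
  ∑ i, ∑ j, ∑ k, ∑ l, (gram Q)⁻¹ i j * (gram Q)⁻¹ k l *
    pairing Q (curvature Q (frameField i) (frameField k) (frameField l)) (frameField j) x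

/-- The scalar curvature functional `S`: the scalar curvature of the left-invariant metric given
by `Q`, taken at the identity (it is the same at all points, by homogeneity). -/
def scalarCurvature (Q : BilinearForm d G) : ℝ := scalarCurvatureAt Q 1

/-- The volume of (a fundamental parallelepiped for) the inner product `Q`. Up to a factor that
does not depend on `Q` it is the Riemannian volume of `G`. -/
def volume (Q : BilinearForm d G) : ℝ := Real.sqrt (gram Q).det

/-- The inner products that have the same volume as `Q₀`. -/
def metricsOfVolume (Q₀ : BilinearForm d G) : Set (BilinearForm d G) :=
  {Q | IsInnerProduct Q ∧ volume Q = volume Q₀}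

/-- `a` is a critical point of `S` restricted to `M`: the derivative of `S` vanishes along every
curve in `M` that passes through `a` at time `0` and is differentiable there. -/
def IsCriticalPointOn (S : BilinearForm d G → ℝ) (M : Set (BilinearForm d G))
    (a : BilinearForm d G) : Prop :=
  ∀ (γ : ℝ → BilinearForm d G) (γ' : BilinearForm d G), γ 0 = a → (∀ t, γ t ∈ M) →
    (∀ v w, HasDerivAt (fun t => γ t v w) (γ' v w) 0) → HasDerivAt (fun t => S (γ t)) 0 0

/-- `a` is a strict local maximum point of `S` restricted to `M`. -/
def IsStrictLocalMaxOn (S : BilinearForm d G → ℝ) (M : Set (BilinearForm d G))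
    (a : BilinearForm d G) : Prop :=
  a ∈ M ∧ ∀ᶠ Q in 𝓝[M \ {a}] a, S Q < S a

/-- `a` is a saddle point of `S` restricted to `M`: a critical point that is neither a local
minimum point nor a local maximum point. -/
def IsSaddlePointOn (S : BilinearForm d G → ℝ) (M : Set (BilinearForm d G))
    (a : BilinearForm d G) : Prop :=
  a ∈ M ∧ IsCriticalPointOn S M a ∧ ¬ IsLocalMinOn S M a ∧ ¬ IsLocalMaxOn S M a

variable (d G) in
/-- The standard metric: minus the Killing form of the Lie algebra of `G`. -/
def standardMetric [LieGroup (𝓡 d) ∞ G] : BilinearForm d G :=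
  haveI : FiniteDimensional ℝ (GroupLieAlgebra (𝓡 d) G) :=
    inferInstanceAs (FiniteDimensional ℝ (EuclideanSpace ℝ (Fin d)))
  haveI : T2Space (GroupLieAlgebra (𝓡 d) G) :=
    inferInstanceAs (T2Space (EuclideanSpace ℝ (Fin d)))
  (-(killingForm ℝ (GroupLieAlgebra (𝓡 d) G))).toContinuousBilinearMap

end Geometry

section LocalIsomorphism

variable (d : ℕ) (G : Type*) [TopologicalSpace G] [ChartedSpace (EuclideanSpace ℝ (Fin d)) G]
  [Group G]

/-- The Lie group `G` is locally isomorphic to the closed matrix group `K` (contained in the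
finite-dimensional algebra `A`, whose submanifold it is): there is a multiplicative
diffeomorphism `f` from a neighbourhood `U` of `1` in `G` onto a neighbourhood `W ∩ K` of `1`
in `K`. That the inverse of `f` is smooth on the submanifold `W ∩ K` is expressed by a smooth
extension `h` of it to `W`. -/
def IsLocallyIsomorphicTo {A : Type*} [NormedRing A] [NormedAlgebra ℝ A] (K : Submonoid A) :
    Prop :=
  ∃ (f : G → A) (h : A → G) (U : Set G) (W : Set A),
    IsOpen U ∧ (1 : G) ∈ U ∧ IsOpen W ∧ (1 : A) ∈ W ∧
    ContMDiffOn (𝓡 d) 𝓘(ℝ, A) ∞ f U ∧ ContMDiffOn 𝓘(ℝ, A) (𝓡 d) ∞ h W ∧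
    f '' U = W ∩ (K : Set A) ∧ (∀ x ∈ U, h (f x) = x) ∧
    ∀ x ∈ U, ∀ y ∈ U, x * y ∈ U → f (x * y) = f x * f y

open scoped Matrix.Norms.Operator in
/-- `G` is locally isomorphic to the special unitary group `SU(n)`. -/
def IsLocallySU (n : ℕ) : Prop :=
  IsLocallyIsomorphicTo d G (Matrix.specialUnitaryGroup (Fin n) ℂ)

open scoped Matrix.Norms.Operator Quaternion in
/-- `G` is locally isomorphic to the compact symplectic group `Sp(n)`, the group of unitary
quaternionic `n × n` matrices. -/
def IsLocallySp (n : ℕ) : Prop :=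
  IsLocallyIsomorphicTo d G (unitary (Matrix (Fin n) (Fin n) ℍ[ℝ]))

end LocalIsomorphism

end LeftInvariant

end

/-! Left-invariant fields have constant pairings, so Koszul's formula, the connection and the
curvature become algebra on the Lie algebra (`scalarCurvature_eq`). For a `Q`-orthonormal basis `f`
of a unimodular algebra this gives `S(Q) = -1/2 ∑ B(f i, f i) - 1/4 ∑ Q([f i, f j], f k)²`
(`IsOrthon.lieScalarCurvature_eq`). Compactness enters by averaging: a Haar average is Ad-invariant,
hence ad-invariant after differentiation, and with trivial centre this forces `-B` to be positive
definite (`isPosSymm_neg_killingForm`).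

In a `-B`-orthonormal basis the structure constants `c` are totally antisymmetric and `∑ j k, c i j
k ^ 2 = 1`. Along metrics with eigenvalues `exp (a i * t)`, where `∑ a i = 0`, `S` is the sum of
exponentials `diagonalScalar`. Its first derivative at `0` vanishes and its second is `-1/4 ∑ a i ^
2 + 1/2 ∑ c i j k ^ 2 * a i * a j`. Stretching one basis vector against another makes this negative,
so there is never a local minimum. Weights constant on a proper ideal and on its complement make it
`1/4 ∑ a i ^ 2 > 0`, so there is no local maximum if the algebra is not simple. Criticality along
arbitrary curves (`isCriticalPointOn_standardMetric`) reduces to the trace of the velocity of the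
metric, which vanishes by the AM-GM inequality.

For `SU(p + 1)` and `Sp(q + 1)` the algebra splits as `su(p) + u(1) + ℂ^p` and `sp(q) + sp(1) +
ℍ^q`: two commuting subalgebras and a subspace whose brackets lie in them. Dimensions and one
further number determine `S` along rescalings of the blocks (`IsOrthon.diagonalScalar_blocks`). For
`sp(q + 1)` the chosen direction has positive second variation. For `su(p + 1)` the second variation
vanishes along the chosen direction, but the derivative is minus a perfect square, so `S` decreases
strictly through the standard metric. The hypothesis on `G` is a local isomorphism of groups; its
differential identifies the Lie algebra with skew-adjoint matrices
(`IsLocallyIsomorphicTo.exists_linearMap`).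

In dimension three every competing metric is diagonal in some `-B`-orthonormal basis, and `4 S =
2(xy + yz + zx) - (x² + y² + z²)` with `xyz = 1`. Schur's inequality bounds this by `3`, with
equality only at `x = y = z = 1`. -/

noncomputable section

namespace LeftInvariant

/-! ### Group multiplication in the chart at the identity, and the Lie bracket. -/

section Chart

variable (d : ℕ) (G : Type*) [TopologicalSpace G] [ChartedSpace (EuclideanSpace ℝ (Fin d)) G]
  [Group G]

/-- The coordinates of the identity. -/
def chartOne : EuclideanSpace ℝ (Fin d) := extChartAt (𝓡 d) (1 : G) 1

/-- The group multiplication in the chart at the identity. -/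
def chartMul (q : EuclideanSpace ℝ (Fin d) × EuclideanSpace ℝ (Fin d)) : EuclideanSpace ℝ (Fin d) :=
  extChartAt (𝓡 d) (1 : G)
    ((extChartAt (𝓡 d) (1 : G)).symm q.1 * (extChartAt (𝓡 d) (1 : G)).symm q.2)

lemma chartSymm_one : (extChartAt (𝓡 d) (1 : G)).symm (chartOne d G) = 1 :=
  extChartAt_to_inv (I := 𝓡 d) (1 : G)

lemma target_mem_nhds : (extChartAt (𝓡 d) (1 : G)).target ∈ 𝓝 (chartOne d G) :=
  extChartAt_target_mem_nhds (I := 𝓡 d) (1 : G)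

lemma source_mem_nhds : (extChartAt (𝓡 d) (1 : G)).source ∈ 𝓝 (1 : G) :=
  extChartAt_source_mem_nhds (I := 𝓡 d) (1 : G)

lemma chartMul_one_right {x : EuclideanSpace ℝ (Fin d)}
    (hx : x ∈ (extChartAt (𝓡 d) (1 : G)).target) : chartMul d G (x, chartOne d G) = x := by
  simp only [chartMul, chartSymm_one, mul_one]
  exact (extChartAt (𝓡 d) (1 : G)).right_inv hx

lemma chartMul_one_left {x : EuclideanSpace ℝ (Fin d)}
    (hx : x ∈ (extChartAt (𝓡 d) (1 : G)).target) : chartMul d G (chartOne d G, x) = x := by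
  simp only [chartMul, chartSymm_one, one_mul]
  exact (extChartAt (𝓡 d) (1 : G)).right_inv hx

variable [LieGroup (𝓡 d) ∞ G]

lemma contMDiffAt_chartSymm {x : EuclideanSpace ℝ (Fin d)}
    (hx : x ∈ (extChartAt (𝓡 d) (1 : G)).target) :
    ContMDiffAt 𝓘(ℝ, EuclideanSpace ℝ (Fin d)) (𝓡 d) ∞ (extChartAt (𝓡 d) (1 : G)).symm x :=
  (contMDiffOn_extChartAt_symm (1 : G)).contMDiffAt
    ((isOpen_extChartAt_target (1 : G)).mem_nhds hx)

lemma contDiffAt_chartMul {x y : EuclideanSpace ℝ (Fin d)}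
    (hx : x ∈ (extChartAt (𝓡 d) (1 : G)).target) (hy : y ∈ (extChartAt (𝓡 d) (1 : G)).target)
    (hxy : (extChartAt (𝓡 d) (1 : G)).symm x * (extChartAt (𝓡 d) (1 : G)).symm y ∈
      (extChartAt (𝓡 d) (1 : G)).source) :
    ContDiffAt ℝ ∞ (chartMul d G) (x, y) := by
  rw [← contMDiffAt_iff_contDiffAt]
  have h1 : ContMDiffAt 𝓘(ℝ, EuclideanSpace ℝ (Fin d) × EuclideanSpace ℝ (Fin d)) (𝓡 d) ∞
      (fun q : EuclideanSpace ℝ (Fin d) × EuclideanSpace ℝ (Fin d) =>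
        (extChartAt (𝓡 d) (1 : G)).symm q.1) (x, y) :=
    ContMDiffAt.comp (x, y) (contMDiffAt_chartSymm d G hx)
      (contDiffAt_fst.contMDiffAt)
  have h2 : ContMDiffAt 𝓘(ℝ, EuclideanSpace ℝ (Fin d) × EuclideanSpace ℝ (Fin d)) (𝓡 d) ∞
      (fun q : EuclideanSpace ℝ (Fin d) × EuclideanSpace ℝ (Fin d) =>
        (extChartAt (𝓡 d) (1 : G)).symm q.2) (x, y) :=
    ContMDiffAt.comp (x, y) (contMDiffAt_chartSymm d G hy)
      (contDiffAt_snd.contMDiffAt)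
  exact ContMDiffAt.comp (x, y) (contMDiffAt_extChartAt' (by simpa using hxy)) (h1.mul h2)

lemma contDiffAt_chartMul_one_right {x : EuclideanSpace ℝ (Fin d)}
    (hx : x ∈ (extChartAt (𝓡 d) (1 : G)).target) :
    ContDiffAt ℝ ∞ (chartMul d G) (x, chartOne d G) := by
  refine contDiffAt_chartMul d G hx (mem_of_mem_nhds (target_mem_nhds d G)) ?_
  rw [chartSymm_one, mul_one]
  exact (extChartAt (𝓡 d) (1 : G)).map_target hx

/-- Left-invariant vector fields in the chart at the identity. -/
lemma mpullback_chartSymm_mulInvariantVectorField (u : GroupLieAlgebra (𝓡 d) G)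
    {x : EuclideanSpace ℝ (Fin d)} (hx : x ∈ (extChartAt (𝓡 d) (1 : G)).target) :
    VectorField.mpullbackWithin 𝓘(ℝ, EuclideanSpace ℝ (Fin d)) (𝓡 d)
      (extChartAt (𝓡 d) (1 : G)).symm (mulInvariantVectorField u) (Set.range (𝓡 d)) x =
    fderiv ℝ (chartMul d G) (x, chartOne d G) (0, u) := by
  set φ := extChartAt (𝓡 d) (1 : G) with hφ
  have hinv := isInvertible_mfderivWithin_extChartAt_symm (I := 𝓡 d) hx
  rw [VectorField.mpullbackWithin_apply]
  suffices h : mulInvariantVectorField u (φ.symm x) =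
      mfderivWithin 𝓘(ℝ, EuclideanSpace ℝ (Fin d)) (𝓡 d) φ.symm (Set.range (𝓡 d)) x (fderiv ℝ (chartMul d G) (x, chartOne d G) (0, u)) by
    rw [h]
    exact hinv.inverse_apply_eq.2 rfl
  have h1 : HasMFDerivAt (𝓡 d) 𝓘(ℝ, EuclideanSpace ℝ (Fin d)) φ (1 : G)
      (ContinuousLinearMap.id ℝ (EuclideanSpace ℝ (Fin d))) := by
    have := (mdifferentiableAt_extChartAt (I := 𝓡 d) (mem_chart_source _ (1 : G))).hasMFDerivAt
    rwa [mfderiv_extChartAt_self] at this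
  have h2 : HasFDerivAt (fun y => chartMul d G (x, y))
      ((fderiv ℝ (chartMul d G) (x, chartOne d G)).comp (ContinuousLinearMap.inr ℝ _ _))
      (chartOne d G) :=
    HasFDerivAt.comp (chartOne d G)
      ((contDiffAt_chartMul_one_right d G hx).differentiableAt (by simp)).hasFDerivAt
      (hasFDerivAt_prodMk_right x (chartOne d G))
  have h3 : HasMFDerivAt 𝓘(ℝ, EuclideanSpace ℝ (Fin d)) (𝓡 d) φ.symm x
      (mfderivWithin 𝓘(ℝ, EuclideanSpace ℝ (Fin d)) (𝓡 d) φ.symm (Set.range (𝓡 d)) x) := by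
    have := ((contMDiffAt_chartSymm d G hx).mdifferentiableAt (by simp)).hasMFDerivAt
    rw [show Set.range (𝓡 d) = Set.univ from (𝓡 d).range_eq_univ, mfderivWithin_univ]
    exact this
  have h3' : HasMFDerivAt 𝓘(ℝ, EuclideanSpace ℝ (Fin d)) (𝓡 d) φ.symm
      (chartMul d G (x, φ 1)) (mfderivWithin 𝓘(ℝ, EuclideanSpace ℝ (Fin d)) (𝓡 d) φ.symm (Set.range (𝓡 d)) x) := by
    have := chartMul_one_right d G hx
    rw [chartOne] at this
    rw [this]; exact h3
  -- Near `1`, left translation by `φ.symm x` is `φ.symm ∘ chartMul (x, ·) ∘ φ`; the chain rule at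
  -- `1` computes the left-invariant field.
  have h4 := HasMFDerivAt.comp (1 : G) h3' (HasMFDerivAt.comp (1 : G) h2.hasMFDerivAt h1)
  have h5 : HasMFDerivAt (𝓡 d) (𝓡 d) (fun y => φ.symm x * y) (1 : G) _ :=
    h4.congr_of_eventuallyEq (by
      have e1 : ∀ᶠ y : G in 𝓝 1, y ∈ φ.source := source_mem_nhds d G
      have e2 : ∀ᶠ y : G in 𝓝 1, φ.symm x * y ∈ φ.source := by
        have := topologicalGroup_of_lieGroup (𝓡 d) ∞ (G := G)
        have hc : ContinuousAt (fun y : G => φ.symm x * y) 1 := by fun_prop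
        refine hc.preimage_mem_nhds ((isOpen_extChartAt_source (1 : G)).mem_nhds ?_)
        rw [mul_one]
        exact φ.map_target hx
      filter_upwards [e1, e2] with y hy1 hy2
      simp only [Function.comp, chartMul, ← hφ]
      rw [φ.left_inv hy1, φ.left_inv hy2])
  have h6 := congrArg (fun A => A u) h5.mfderiv
  exact h6

lemma fderiv_chartMul_one_inr (u : EuclideanSpace ℝ (Fin d)) :
    fderiv ℝ (chartMul d G) (chartOne d G, chartOne d G) (0, u) = u := by
  have h1 := ((contDiffAt_chartMul_one_right d G
    (mem_of_mem_nhds (target_mem_nhds d G))).differentiableAt (by simp)).hasFDerivAt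
  have h2 := HasFDerivAt.comp (f := fun x => (chartOne d G, x)) (chartOne d G) h1
    (hasFDerivAt_prodMk_right (chartOne d G) (chartOne d G))
  have h3 : HasFDerivAt (chartMul d G ∘ fun x => (chartOne d G, x))
      (ContinuousLinearMap.id ℝ (EuclideanSpace ℝ (Fin d))) (chartOne d G) := by
    refine (hasFDerivAt_id _).congr_of_eventuallyEq ?_
    filter_upwards [target_mem_nhds d G] with x hx using chartMul_one_left d G hx
  exact congrArg (fun A => A u) (h2.unique h3)

lemma fderiv_chartMul_one_inl (u : EuclideanSpace ℝ (Fin d)) :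
    fderiv ℝ (chartMul d G) (chartOne d G, chartOne d G) (u, 0) = u := by
  have h1 := ((contDiffAt_chartMul_one_right d G
    (mem_of_mem_nhds (target_mem_nhds d G))).differentiableAt (by simp)).hasFDerivAt
  have h2 := HasFDerivAt.comp (f := fun x => (x, chartOne d G)) (chartOne d G) h1
    (hasFDerivAt_prodMk_left (chartOne d G) (chartOne d G))
  have h3 : HasFDerivAt (chartMul d G ∘ fun x => (x, chartOne d G))
      (ContinuousLinearMap.id ℝ (EuclideanSpace ℝ (Fin d))) (chartOne d G) := by
    refine (hasFDerivAt_id _).congr_of_eventuallyEq ?_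
    filter_upwards [target_mem_nhds d G] with x hx using chartMul_one_right d G hx
  exact congrArg (fun A => A u) (h2.unique h3)

/-- The bracket of the Lie algebra in the chart at the identity. -/
lemma bracket_eq_chart (v w : GroupLieAlgebra (𝓡 d) G) :
    ⁅v, w⁆ = fderiv ℝ (fderiv ℝ (chartMul d G)) (chartOne d G, chartOne d G) (v, 0) (0, w) -
      fderiv ℝ (fderiv ℝ (chartMul d G)) (chartOne d G, chartOne d G) (w, 0) (0, v) := by
  have key : ∀ u : GroupLieAlgebra (𝓡 d) G,
      VectorField.mpullbackWithin 𝓘(ℝ, EuclideanSpace ℝ (Fin d)) (𝓡 d)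
      (extChartAt (𝓡 d) (1 : G)).symm (mulInvariantVectorField u) (Set.range (𝓡 d))
      =ᶠ[𝓝 (chartOne d G)] fun x => fderiv ℝ (chartMul d G) (x, chartOne d G) (0, u) := by
    intro u
    filter_upwards [target_mem_nhds d G] with x hx
    exact mpullback_chartSymm_mulInvariantVectorField d G u hx
  have hd : ∀ u : EuclideanSpace ℝ (Fin d), HasFDerivAt
      (fun x => fderiv ℝ (chartMul d G) (x, chartOne d G) (0, u))
      (((ContinuousLinearMap.apply ℝ _ ((0, u) : EuclideanSpace ℝ (Fin d) × _)).comp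
        (fderiv ℝ (fderiv ℝ (chartMul d G)) (chartOne d G, chartOne d G))).comp
          (ContinuousLinearMap.inl ℝ _ _)) (chartOne d G) := by
    intro u
    have h1 : HasFDerivAt (fderiv ℝ (chartMul d G))
        (fderiv ℝ (fderiv ℝ (chartMul d G)) (chartOne d G, chartOne d G))
        (chartOne d G, chartOne d G) := by
      have := contDiffAt_chartMul_one_right d G (mem_of_mem_nhds (target_mem_nhds d G))
      exact ((this.fderiv_right (m := 1) (by norm_cast)).differentiableAt (by simp)).hasFDerivAt
    have h2 := ((ContinuousLinearMap.apply ℝ (EuclideanSpace ℝ (Fin d))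
      ((0, u) : EuclideanSpace ℝ (Fin d) × _)).hasFDerivAt.comp _ h1)
    exact HasFDerivAt.comp (f := fun x => (x, chartOne d G)) (chartOne d G) h2
      (hasFDerivAt_prodMk_left (chartOne d G) (chartOne d G))
  rw [GroupLieAlgebra.bracket_def, ← VectorField.mlieBracketWithin_univ,
    VectorField.mlieBracketWithin_apply, mfderiv_extChartAt_self]
  change (ContinuousLinearMap.id ℝ (EuclideanSpace ℝ (Fin d))).inverse _ = _
  rw [ContinuousLinearMap.inverse_id, show Set.range (𝓡 d) = Set.univ from (𝓡 d).range_eq_univ]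
  simp only [Set.preimage_univ, Set.inter_univ]
  rw [show Set.range (𝓡 d) = Set.univ from (𝓡 d).range_eq_univ] at key
  refine (congrFun (VectorField.lieBracketWithin_univ (𝕜 := ℝ)) (chartOne d G)).trans ?_
  rw [Filter.EventuallyEq.lieBracket_vectorField_eq (key v) (key w)]
  have main : ∀ v w : EuclideanSpace ℝ (Fin d), VectorField.lieBracket ℝ
      (fun x => fderiv ℝ (chartMul d G) (x, chartOne d G) (0, v))
      (fun x => fderiv ℝ (chartMul d G) (x, chartOne d G) (0, w)) (chartOne d G) =
      fderiv ℝ (fderiv ℝ (chartMul d G)) (chartOne d G, chartOne d G) (v, 0) (0, w) -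
      fderiv ℝ (fderiv ℝ (chartMul d G)) (chartOne d G, chartOne d G) (w, 0) (0, v) := by
    intro v w
    rw [VectorField.lieBracket, (hd w).fderiv, (hd v).fderiv, fderiv_chartMul_one_inr,
      fderiv_chartMul_one_inr]
    rfl
  exact main v w

end Chart

/-! ### The adjoint representation and its derivative. -/

section Adjoint

variable (d : ℕ) (G : Type*) [TopologicalSpace G] [ChartedSpace (EuclideanSpace ℝ (Fin d)) G]
  [Group G]

/-- Conjugation by `g`, in the chart at the identity. -/
def chartConj (g : G) (y : EuclideanSpace ℝ (Fin d)) : EuclideanSpace ℝ (Fin d) :=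
  extChartAt (𝓡 d) (1 : G) (g * (extChartAt (𝓡 d) (1 : G)).symm y * g⁻¹)

/-- The adjoint representation, computed in the chart at the identity. -/
def chartAd (g : G) : EuclideanSpace ℝ (Fin d) →L[ℝ] EuclideanSpace ℝ (Fin d) :=
  fderiv ℝ (chartConj d G g) (chartOne d G)

/-- Conjugation as a function of both variables, in the chart at the identity. -/
def chartConj₂ (q : EuclideanSpace ℝ (Fin d) × EuclideanSpace ℝ (Fin d)) :
    EuclideanSpace ℝ (Fin d) :=
  chartConj d G ((extChartAt (𝓡 d) (1 : G)).symm q.1) q.2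

lemma chartConj_chartOne (g : G) : chartConj d G g (chartOne d G) = chartOne d G := by
  simp only [chartConj, chartSymm_one, mul_one, mul_inv_cancel]
  rfl

lemma chartAd_one : chartAd d G 1 = ContinuousLinearMap.id ℝ _ := by
  have h3 : HasFDerivAt (chartConj d G 1)
      (ContinuousLinearMap.id ℝ (EuclideanSpace ℝ (Fin d))) (chartOne d G) := by
    refine (hasFDerivAt_id _).congr_of_eventuallyEq ?_
    filter_upwards [target_mem_nhds d G] with x hx
    simpa [chartConj] using (extChartAt (𝓡 d) (1 : G)).right_inv hx
  exact h3.fderiv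

variable [LieGroup (𝓡 d) ∞ G]

lemma contDiffAt_chartConj (g : G) : ContDiffAt ℝ ∞ (chartConj d G g) (chartOne d G) := by
  rw [← contMDiffAt_iff_contDiffAt]
  have h2 := contMDiffAt_chartSymm d G (mem_of_mem_nhds (target_mem_nhds d G))
  refine ContMDiffAt.comp (chartOne d G) (contMDiffAt_extChartAt' ?_)
    ((contMDiffAt_const.mul h2).mul contMDiffAt_const)
  simp only [chartSymm_one, mul_one, mul_inv_cancel]
  exact mem_chart_source _ (1 : G)

/-- The identity holds only where the inner conjugate stays in the chart domain, which is enough for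
derivatives at the identity. -/
lemma chartConj_mul (g h : G) :
    chartConj d G (g * h) =ᶠ[𝓝 (chartOne d G)] chartConj d G g ∘ chartConj d G h := by
  have := topologicalGroup_of_lieGroup (𝓡 d) ∞ (G := G)
  have hc : ContinuousAt (fun y => h * (extChartAt (𝓡 d) (1 : G)).symm y * h⁻¹) (chartOne d G) := by
    have := (contMDiffAt_chartSymm d G (mem_of_mem_nhds (target_mem_nhds d G))).continuousAt
    fun_prop
  have h1 := hc.preimage_mem_nhds (t := (extChartAt (𝓡 d) (1 : G)).source) (by
    simpa only [chartSymm_one, mul_one, mul_inv_cancel] using source_mem_nhds d G)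
  filter_upwards [h1] with y hy
  simp only [Function.comp, chartConj]
  rw [(extChartAt (𝓡 d) (1 : G)).left_inv hy]
  congr 1
  group

lemma chartAd_mul (g h : G) : chartAd d G (g * h) = (chartAd d G g).comp (chartAd d G h) := by
  have h1 := ((contDiffAt_chartConj d G h).differentiableAt (by simp)).hasFDerivAt
  have h2 : HasFDerivAt (chartConj d G g) (chartAd d G g)
    (chartConj d G h (chartOne d G)) := by
    rw [chartConj_chartOne]
    exact ((contDiffAt_chartConj d G g).differentiableAt (by simp)).hasFDerivAt
  exact ((h2.comp _ h1).congr_of_eventuallyEq (chartConj_mul d G g h)).fderiv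

lemma contDiffAt_chartConj₂ {x : EuclideanSpace ℝ (Fin d)}
    (hx : x ∈ (extChartAt (𝓡 d) (1 : G)).target) :
    ContDiffAt ℝ ∞ (chartConj₂ d G) (x, chartOne d G) := by
  rw [← contMDiffAt_iff_contDiffAt]
  have h1 : ContMDiffAt 𝓘(ℝ, EuclideanSpace ℝ (Fin d) × EuclideanSpace ℝ (Fin d)) (𝓡 d) ∞
      (fun q : EuclideanSpace ℝ (Fin d) × EuclideanSpace ℝ (Fin d) =>
        (extChartAt (𝓡 d) (1 : G)).symm q.1) (x, chartOne d G) :=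
    ContMDiffAt.comp (x, chartOne d G) (contMDiffAt_chartSymm d G hx)
      (contDiffAt_fst.contMDiffAt)
  have h2 : ContMDiffAt 𝓘(ℝ, EuclideanSpace ℝ (Fin d) × EuclideanSpace ℝ (Fin d)) (𝓡 d) ∞
      (fun q : EuclideanSpace ℝ (Fin d) × EuclideanSpace ℝ (Fin d) =>
        (extChartAt (𝓡 d) (1 : G)).symm q.2) (x, chartOne d G) :=
    ContMDiffAt.comp (x, chartOne d G)
      (contMDiffAt_chartSymm d G (mem_of_mem_nhds (target_mem_nhds d G)))
      (contDiffAt_snd.contMDiffAt)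
  refine ContMDiffAt.comp (x, chartOne d G) (contMDiffAt_extChartAt' ?_) ((h1.mul h2).mul h1.inv)
  simp only [chartSymm_one, mul_one, mul_inv_cancel]
  exact mem_chart_source _ (1 : G)

lemma chartAd_chartSymm {x : EuclideanSpace ℝ (Fin d)}
    (hx : x ∈ (extChartAt (𝓡 d) (1 : G)).target) (u : EuclideanSpace ℝ (Fin d)) :
    chartAd d G ((extChartAt (𝓡 d) (1 : G)).symm x) u =
      fderiv ℝ (chartConj₂ d G) (x, chartOne d G) (0, u) := by
  have h1 := ((contDiffAt_chartConj₂ d G hx).differentiableAt (by simp)).hasFDerivAt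
  have h2 := HasFDerivAt.comp (f := fun y => (x, y)) (chartOne d G) h1
    (hasFDerivAt_prodMk_right x (chartOne d G))
  exact congrArg (fun A => A u) h2.fderiv

/-- This is `(g h g⁻¹) g = g h`: conjugation becomes an implicit function of the multiplication, so
no derivative of inversion has to be computed. -/
lemma chartMul_chartConj₂ : ∀ᶠ q in 𝓝 (chartOne d G, chartOne d G),
    chartMul d G (chartConj₂ d G q, q.1) = chartMul d G q := by
  have := topologicalGroup_of_lieGroup (𝓡 d) ∞ (G := G)
  have hs := (contMDiffAt_chartSymm d G (mem_of_mem_nhds (target_mem_nhds d G))).continuousAt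
  have hc : ContinuousAt (fun q : EuclideanSpace ℝ (Fin d) × EuclideanSpace ℝ (Fin d) =>
      (extChartAt (𝓡 d) (1 : G)).symm q.1 * (extChartAt (𝓡 d) (1 : G)).symm q.2 *
        ((extChartAt (𝓡 d) (1 : G)).symm q.1)⁻¹) (chartOne d G, chartOne d G) := by
    have h1 : ContinuousAt (fun q : EuclideanSpace ℝ (Fin d) × EuclideanSpace ℝ (Fin d) =>
      (extChartAt (𝓡 d) (1 : G)).symm q.1) (chartOne d G, chartOne d G) :=
      ContinuousAt.comp (x := (chartOne d G, chartOne d G)) hs continuousAt_fst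
    have h2 : ContinuousAt (fun q : EuclideanSpace ℝ (Fin d) × EuclideanSpace ℝ (Fin d) =>
      (extChartAt (𝓡 d) (1 : G)).symm q.2) (chartOne d G, chartOne d G) :=
      ContinuousAt.comp (x := (chartOne d G, chartOne d G)) hs continuousAt_snd
    exact (h1.mul h2).mul h1.inv
  have h1 := hc.preimage_mem_nhds (t := (extChartAt (𝓡 d) (1 : G)).source) (by
    simpa only [chartSymm_one, mul_one, mul_inv_cancel] using source_mem_nhds d G)
  filter_upwards [h1] with q hq
  simp only [chartMul, chartConj₂, chartConj]
  rw [(extChartAt (𝓡 d) (1 : G)).left_inv hq]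
  congr 1
  group

/-- Obtained by differentiating `chartMul_chartConj₂` in its second variable at the identity. It is
kept for all nearby `x` so that it can be differentiated once more in `x`. -/
lemma fderiv_chartConj₂_eventually (u : EuclideanSpace ℝ (Fin d)) :
    ∀ᶠ x in 𝓝 (chartOne d G), fderiv ℝ (chartMul d G) (chartOne d G, x)
      (fderiv ℝ (chartConj₂ d G) (x, chartOne d G) (0, u), 0) =
      fderiv ℝ (chartMul d G) (x, chartOne d G) (0, u) := by
  have h0 := (chartMul_chartConj₂ d G).eventually_nhds
  have hi : ContinuousAt (fun x => (x, chartOne d G)) (chartOne d G) := by fun_prop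
  have hp := mem_of_mem_nhds (target_mem_nhds d G)
  filter_upwards [hi.eventually h0, target_mem_nhds d G] with x hx hxt
  have h1 := ((contDiffAt_chartConj₂ d G hxt).differentiableAt (by simp)).hasFDerivAt
  have h2 := HasFDerivAt.comp (f := fun y => (x, y)) (chartOne d G) h1
    (hasFDerivAt_prodMk_right x (chartOne d G))
  have h3 := h2.prodMk (hasFDerivAt_const x (chartOne d G))
  have h4 : HasFDerivAt (chartMul d G) (fderiv ℝ (chartMul d G) (chartOne d G, x))
      (chartConj₂ d G (x, chartOne d G), x) := by
    rw [show chartConj₂ d G (x, chartOne d G) = chartOne d G from chartConj_chartOne d G _]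
    refine ((contDiffAt_chartMul d G hp hxt ?_).differentiableAt (by simp)).hasFDerivAt
    rw [chartSymm_one, one_mul]
    exact (extChartAt (𝓡 d) (1 : G)).map_target hxt
  have h5 := HasFDerivAt.comp (f := fun y => (chartConj₂ d G (x, y), x)) (chartOne d G) h4 h3
  have h6 := HasFDerivAt.comp (f := fun y => (x, y)) (chartOne d G)
    ((contDiffAt_chartMul_one_right d G hxt).differentiableAt (by simp)).hasFDerivAt
    (hasFDerivAt_prodMk_right x (chartOne d G))
  have hi2 : ContinuousAt (fun y => (x, y)) (chartOne d G) := by fun_prop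
  have h7 : HasFDerivAt (chartMul d G ∘ fun y => (x, y)) _ (chartOne d G) :=
    h5.congr_of_eventuallyEq (by
      filter_upwards [hi2.eventually hx] with y hy using hy.symm)
  exact congrArg (fun A => A u) (h7.unique h6)

/-- The derivative of the adjoint representation of the group is the adjoint representation of the
Lie algebra. -/
lemma hasFDerivAt_chartAd (u : EuclideanSpace ℝ (Fin d)) :
    ∃ A : EuclideanSpace ℝ (Fin d) →L[ℝ] EuclideanSpace ℝ (Fin d),
      (∀ w : EuclideanSpace ℝ (Fin d),
        A w = @Bracket.bracket (GroupLieAlgebra (𝓡 d) G) (GroupLieAlgebra (𝓡 d) G) _ w u) ∧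
      HasFDerivAt (fun x => chartAd d G ((extChartAt (𝓡 d) (1 : G)).symm x) u) A
        (chartOne d G) := by
  have hp := mem_of_mem_nhds (target_mem_nhds d G)
  have hΨ : DifferentiableAt ℝ (fun x => fderiv ℝ (chartConj₂ d G) (x, chartOne d G) (0, u))
      (chartOne d G) := by
    have h1 := (((contDiffAt_chartConj₂ d G hp).fderiv_right (m := 1)
      (by norm_cast)).differentiableAt (by simp))
    have h2 : DifferentiableAt ℝ (fun x => (x, chartOne d G)) (chartOne d G) := by fun_prop
    exact (DifferentiableAt.comp (chartOne d G) (f := fun x => (x, chartOne d G)) h1 h2).clm_apply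
      (differentiableAt_const _)
  have hm : HasFDerivAt (fderiv ℝ (chartMul d G))
        (fderiv ℝ (fderiv ℝ (chartMul d G)) (chartOne d G, chartOne d G))
        (chartOne d G, chartOne d G) := by
    have := contDiffAt_chartMul_one_right d G hp
    exact ((this.fderiv_right (m := 1) (by norm_cast)).differentiableAt (by simp)).hasFDerivAt
  refine ⟨fderiv ℝ (fun x => fderiv ℝ (chartConj₂ d G) (x, chartOne d G) (0, u)) (chartOne d G),
    ?_, hΨ.hasFDerivAt.congr_of_eventuallyEq ?_⟩
  -- Differentiating the identity along `w` gives `m''(0, w)(u, 0) + A w = m''(w, 0)(0, u)`, with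
  -- `m` the multiplication in the chart. Symmetry of `m''` turns the difference into the bracket.
  · intro w
    have h1 := (HasFDerivAt.comp (chartOne d G) hm
      (hasFDerivAt_prodMk_right (chartOne d G) (chartOne d G))).clm_apply
        (hΨ.hasFDerivAt.prodMk (hasFDerivAt_const (0 : EuclideanSpace ℝ (Fin d)) (chartOne d G)))
    have h2 := (HasFDerivAt.comp (f := fun x => (x, chartOne d G)) (chartOne d G) hm
      (hasFDerivAt_prodMk_left (chartOne d G) (chartOne d G))).clm_apply
        (hasFDerivAt_const ((0 : EuclideanSpace ℝ (Fin d)), u) (chartOne d G))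
    have h3 := congrArg (fun A => A w)
      ((h1.congr_of_eventuallyEq (Filter.EventuallyEq.symm
        (fderiv_chartConj₂_eventually d G u))).unique h2)
    have hu : fderiv ℝ (chartConj₂ d G) (chartOne d G, chartOne d G) (0, u) = u := by
      rw [← chartAd_chartSymm d G hp, chartSymm_one, chartAd_one]; rfl
    simp [fderiv_chartMul_one_inl, hu] at h3
    have hsym := (contDiffAt_chartMul_one_right d G hp).isSymmSndFDerivAt (by
      rw [minSmoothness_of_isRCLikeNormedField]
      exact ENat.LEInfty.out)
    have h4 := hsym.eq (0, w) (u, 0)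
    refine Eq.trans ?_ (bracket_eq_chart d G w u).symm
    rw [eq_sub_iff_add_eq, ← h3, h4]
  · filter_upwards [target_mem_nhds d G] with x hx using chartAd_chartSymm d G hx u

/-- At `1` this follows from differentiability; multiplicativity of `chartAd` transports it to every
`g`. -/
lemma continuous_chartAd (u : EuclideanSpace ℝ (Fin d)) :
    Continuous fun g : G => chartAd d G g u := by
  have := topologicalGroup_of_lieGroup (𝓡 d) ∞ (G := G)
  have h1 : ∀ u, ContinuousAt (fun g : G => chartAd d G g u) 1 := by
    intro u
    obtain ⟨A, -, hA⟩ := hasFDerivAt_chartAd d G u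
    have h2 := ContinuousAt.comp (f := extChartAt (𝓡 d) (1 : G)) (x := 1) hA.continuousAt
      (continuousAt_extChartAt (1 : G))
    refine h2.congr ?_
    filter_upwards [source_mem_nhds d G] with g hg
    simp only [Function.comp]
    rw [(extChartAt (𝓡 d) (1 : G)).left_inv hg]
  rw [continuous_iff_continuousAt]
  intro g
  have h3 : ContinuousAt (fun h : G => chartAd d G (g⁻¹ * h) u) g :=
    ContinuousAt.comp (g := fun k => chartAd d G k u) (f := fun h => g⁻¹ * h) (x := g)
      (by simpa using h1 u) (by fun_prop)
  refine ((chartAd d G g).continuous.continuousAt.comp h3).congr (.of_forall fun h => ?_)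
  simp only [Function.comp]
  rw [← ContinuousLinearMap.comp_apply, ← chartAd_mul, mul_inv_cancel_left]

end Adjoint

/-! ### Positive definite forms and orthonormal bases. -/

section InnerProducts

variable {V : Type*} [AddCommGroup V] [Module ℝ V]

/-- A symmetric positive definite bilinear form. -/
def IsPosSymm (Q : LinearMap.BilinForm ℝ V) : Prop :=
  (∀ v w, Q v w = Q w v) ∧ ∀ v, v ≠ 0 → 0 < Q v v

/-- The family `f` is orthonormal for the bilinear form `Q`. -/
def IsOrthon {ι : Type*} [DecidableEq ι] (Q : LinearMap.BilinForm ℝ V) (f : ι → V) : Prop :=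
  ∀ i j, Q (f i) (f j) = if i = j then 1 else 0

lemma IsPosSymm.nonneg {Q : LinearMap.BilinForm ℝ V} (hQ : IsPosSymm Q) (v : V) : 0 ≤ Q v v := by
  rcases eq_or_ne v 0 with rfl | hv
  · simp
  · exact (hQ.2 v hv).le

lemma IsPosSymm.eq_zero {Q : LinearMap.BilinForm ℝ V} (hQ : IsPosSymm Q) {v : V}
    (hv : Q v v = 0) : v = 0 := by
  by_contra h
  exact (hQ.2 v h).ne' hv

/-- A self-adjoint operator has an orthonormal basis of eigenvectors. -/
lemma IsPosSymm.exists_eigenbasis [FiniteDimensional ℝ V] {Q : LinearMap.BilinForm ℝ V}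
    (hQ : IsPosSymm Q) (T : V →ₗ[ℝ] V) (hT : ∀ v w, Q (T v) w = Q v (T w)) :
    ∃ (f : Module.Basis (Fin (Module.finrank ℝ V)) ℝ V) (μ : Fin (Module.finrank ℝ V) → ℝ),
      IsOrthon Q f ∧ ∀ i, T (f i) = μ i • f i := by
  let core : InnerProductSpace.Core ℝ V :=
    { inner := fun v w => Q v w
      conj_inner_symm := fun v w => by simp [hQ.1 v w]
      re_inner_nonneg := fun v => by simpa using hQ.nonneg v
      add_left := fun u v w => by simp
      smul_left := fun u v r => by simp
      definite := fun v hv => hQ.eq_zero hv }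
  let _ : NormedAddCommGroup V := core.toNormedAddCommGroup
  let _ : InnerProductSpace ℝ V := InnerProductSpace.ofCore core.toCore
  have hs : T.IsSymmetric := hT
  refine ⟨(hs.eigenvectorBasis rfl).toBasis, hs.eigenvalues rfl, fun i j => ?_, fun i => ?_⟩
  · have := orthonormal_iff_ite.1 (hs.eigenvectorBasis rfl).orthonormal i j
    simp only [OrthonormalBasis.coe_toBasis]
    exact this
  · simp

variable {ι : Type*} [Fintype ι] [DecidableEq ι] {Q : LinearMap.BilinForm ℝ V}
  {f : Module.Basis ι ℝ V}

lemma IsOrthon.repr (hf : IsOrthon Q f) (v : V) (i : ι) : f.repr v i = Q v (f i) := by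
  conv_rhs => rw [← f.sum_repr v]
  have h : ∀ j, Q (f j) (f i) = if j = i then 1 else 0 := fun j => hf j i
  rw [map_sum, LinearMap.sum_apply]
  simp [h]

lemma IsOrthon.repr' (hf : IsOrthon Q f) (v : V) (i : ι) : f.repr v i = Q (f i) v := by
  conv_rhs => rw [← f.sum_repr v]
  have h : ∀ j, Q (f i) (f j) = if i = j then 1 else 0 := fun j => hf i j
  rw [map_sum]
  simp [h]

lemma IsOrthon.symm (hf : IsOrthon Q f) (v w : V) : Q v w = Q w v := by
  have h : ∀ i, Q v (f i) = Q (f i) v := fun i => by rw [← hf.repr, hf.repr']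
  conv_lhs => rw [← f.sum_repr w]
  conv_rhs => rw [← f.sum_repr w]
  rw [map_sum, map_sum, LinearMap.sum_apply]
  simp [h]

lemma IsOrthon.sum_smul (hf : IsOrthon Q f) (v : V) : ∑ i, Q v (f i) • f i = v := by
  conv_rhs => rw [← f.sum_repr v]
  simp [hf.repr]

lemma IsOrthon.sum_mul (hf : IsOrthon Q f) (v w : V) :
    ∑ i, Q v (f i) * Q (f i) w = Q v w := by
  conv_rhs => rw [← hf.sum_smul v, map_sum, LinearMap.sum_apply]
  simp

lemma IsOrthon.trace (hf : IsOrthon Q f) (A : V →ₗ[ℝ] V) :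
    LinearMap.trace ℝ V A = ∑ i, Q (A (f i)) (f i) := by
  rw [LinearMap.trace_eq_matrix_trace ℝ f, Matrix.trace]
  simp [LinearMap.toMatrix_apply, hf.repr]

end InnerProducts

/-! ### Definiteness of the Killing form. -/

section Killing

variable {L : Type*} [LieRing L] [LieAlgebra ℝ L]

lemma IsOrthon.killingForm_apply {ι : Type*} [Fintype ι] [DecidableEq ι]
    {Q : LinearMap.BilinForm ℝ L} {f : Module.Basis ι ℝ L} (hf : IsOrthon Q f) (u v : L) :
    killingForm ℝ L u v = ∑ i, Q ⁅u, ⁅v, f i⁆⁆ (f i) := by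
  rw [killingForm_apply_apply, hf.trace]
  simp

/-- The Killing form is negative definite if there is an invariant inner product and the center is
trivial. -/
lemma IsPosSymm.neg_killingForm [FiniteDimensional ℝ L] {Q : LinearMap.BilinForm ℝ L} (hQ : IsPosSymm Q)
    (hinv : ∀ w u v : L, Q ⁅w, u⁆ v = - Q u ⁅w, v⁆) (hc : LieAlgebra.center ℝ L = ⊥) :
    IsPosSymm (-killingForm ℝ L) := by
  obtain ⟨f, -, hf, -⟩ := hQ.exists_eigenbasis 0 (by simp)
  refine ⟨fun v w => ?_, fun v hv => ?_⟩
  · simp only [LinearMap.neg_apply, LieModule.traceForm_comm ℝ L L v w]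
  -- Since `ad v` is skew for `Q`, `-tr (ad v)²` is a sum of squared lengths; if it vanishes then
  -- `ad v = 0` and `v` is central.
  · have h1 : (-killingForm ℝ L) v v = ∑ i, Q ⁅v, f i⁆ ⁅v, f i⁆ := by
      simp only [LinearMap.neg_apply, hf.killingForm_apply, ← Finset.sum_neg_distrib]
      exact Finset.sum_congr rfl fun i _ => by rw [hinv, neg_neg]
    rw [h1]
    refine lt_of_le_of_ne (Finset.sum_nonneg fun i _ => hQ.nonneg _) fun h0 => hv ?_
    have h2 := (Finset.sum_eq_zero_iff_of_nonneg (fun i _ => hQ.nonneg (⁅v, f i⁆ : L))).1 h0.symm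
    have h3 : LieAlgebra.ad ℝ L v = 0 := f.ext fun i => by
      simpa using hQ.eq_zero (h2 i (Finset.mem_univ i))
    have h4 : v ∈ LieAlgebra.center ℝ L := by
      rw [LieModule.mem_maxTrivSubmodule]
      intro x
      rw [← lie_skew, ← LieAlgebra.ad_apply (R := ℝ), h3]
      simp
    rwa [hc, LieSubmodule.mem_bot] at h4

end Killing

/-! ### Averaging over the compact group. -/

section Averaging

open MeasureTheory

variable (d : ℕ) (G : Type*) [TopologicalSpace G] [ChartedSpace (EuclideanSpace ℝ (Fin d)) G]
  [Group G] [LieGroup (𝓡 d) ∞ G]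

instance : FiniteDimensional ℝ (GroupLieAlgebra (𝓡 d) G) :=
  inferInstanceAs (FiniteDimensional ℝ (EuclideanSpace ℝ (Fin d)))

variable [CompactSpace G] [T2Space G]

/-- Haar average of the Euclidean inner product. The inverse `g⁻¹` in the integrand makes left
invariance of the measure the invariance that is needed. -/
lemma exists_chartAd_invariant :
    ∃ Q : LinearMap.BilinForm ℝ (EuclideanSpace ℝ (Fin d)), IsPosSymm Q ∧
      ∀ (g : G) u v, Q (chartAd d G g u) (chartAd d G g v) = Q u v := by
  have := topologicalGroup_of_lieGroup (𝓡 d) ∞ (G := G)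
  let _ : MeasurableSpace G := borel G
  have : BorelSpace G := ⟨rfl⟩
  let μ : Measure G := Measure.haar
  have hcont : ∀ u v : EuclideanSpace ℝ (Fin d), Continuous fun g : G =>
      inner ℝ (chartAd d G g⁻¹ u) (chartAd d G g⁻¹ v) := fun u v =>
    ((continuous_chartAd d G u).comp continuous_inv).inner
      ((continuous_chartAd d G v).comp continuous_inv)
  have hint : ∀ u v : EuclideanSpace ℝ (Fin d), Integrable (fun g : G =>
      inner ℝ (chartAd d G g⁻¹ u) (chartAd d G g⁻¹ v)) μ := fun u v =>
    (hcont u v).integrable_of_hasCompactSupport (HasCompactSupport.of_compactSpace _)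
  let Q : LinearMap.BilinForm ℝ (EuclideanSpace ℝ (Fin d)) :=
    LinearMap.mk₂ ℝ (fun u v => ∫ g : G, inner ℝ (chartAd d G g⁻¹ u) (chartAd d G g⁻¹ v) ∂μ)
      (fun u u' v => by
        simp only [map_add, inner_add_left]
        exact integral_add (hint u v) (hint u' v))
      (fun c u v => by
        simp only [map_smul, real_inner_smul_left, integral_const_mul, smul_eq_mul])
      (fun u v v' => by
        simp only [map_add, inner_add_right]
        exact integral_add (hint u v) (hint u v'))
      (fun c u v => by
        simp only [map_smul, real_inner_smul_right, integral_const_mul, smul_eq_mul])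
  have hQ : ∀ u v, Q u v = ∫ g : G, inner ℝ (chartAd d G g⁻¹ u) (chartAd d G g⁻¹ v) ∂μ :=
    fun u v => rfl
  refine ⟨Q, ⟨fun u v => ?_, fun v hv => ?_⟩, fun h u v => ?_⟩
  · simp only [hQ, real_inner_comm]
  · rw [hQ]
    refine (hcont v v).integral_pos_of_hasCompactSupport_nonneg_nonzero (x := 1)
      (HasCompactSupport.of_compactSpace _) (fun g => real_inner_self_nonneg) ?_
    simpa [chartAd_one] using hv
  · simp only [hQ]
    rw [← integral_mul_left_eq_self (fun g : G =>
      inner ℝ (chartAd d G g⁻¹ u) (chartAd d G g⁻¹ v)) h⁻¹]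
    simp [chartAd_mul]

/-- The Lie algebra of a compact group has an invariant inner product. -/
lemma exists_invariant_form :
    ∃ Q : LinearMap.BilinForm ℝ (GroupLieAlgebra (𝓡 d) G), IsPosSymm Q ∧
      ∀ w u v : GroupLieAlgebra (𝓡 d) G, Q ⁅w, u⁆ v = - Q u ⁅w, v⁆ := by
  obtain ⟨Q, hQ, hinv⟩ := exists_chartAd_invariant d G
  refine ⟨Q, hQ, fun w u v => ?_⟩
  obtain ⟨A, hA, hA'⟩ := hasFDerivAt_chartAd d G u
  obtain ⟨B, hB, hB'⟩ := hasFDerivAt_chartAd d G v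
  -- The pairing of the two moving vectors is constant, so its derivative at the identity, computed
  -- by the product rule, is zero.
  have h1 := (Q.toContinuousBilinearMap).hasFDerivAt_of_bilinear hA' hB'
  have h2 : HasFDerivAt (fun x => Q.toContinuousBilinearMap
      (chartAd d G ((extChartAt (𝓡 d) (1 : G)).symm x) u)
      (chartAd d G ((extChartAt (𝓡 d) (1 : G)).symm x) v))
      (0 : EuclideanSpace ℝ (Fin d) →L[ℝ] ℝ) (chartOne d G) := by
    refine (hasFDerivAt_const (Q u v) _).congr_of_eventuallyEq (.of_forall fun x => ?_)
    exact hinv _ u v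
  have h3 : Q (chartAd d G ((extChartAt (𝓡 d) (1 : G)).symm (chartOne d G)) u) (B w) +
      Q (A w) (chartAd d G ((extChartAt (𝓡 d) (1 : G)).symm (chartOne d G)) v) = 0 :=
    congrArg (fun F => F w) (h1.unique h2)
  rw [chartSymm_one, chartAd_one] at h3
  have h4 : Q u (B w) + Q (A w) v = 0 := h3
  exact (congrArg (fun z => Q z v) (hA w)).symm.trans
    ((eq_neg_of_add_eq_zero_right h4).trans (congrArg (fun z => - Q u z) (hB w)))

variable [LieAlgebra.IsSemisimple ℝ (GroupLieAlgebra (𝓡 d) G)]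

/-- Semisimplicity enters only through the trivial centre. -/
lemma isPosSymm_neg_killingForm :
    IsPosSymm (-killingForm ℝ (GroupLieAlgebra (𝓡 d) G)) := by
  obtain ⟨Q, hQ, hinv⟩ := exists_invariant_form d G
  exact hQ.neg_killingForm hinv (LieAlgebra.center_eq_bot ℝ _)
end Averaging
-- Scalar curvature as algebra on a Lie algebra.
section AlgebraicCurvature

variable {L : Type*} [LieRing L] [LieAlgebra ℝ L]
  {κ ι : Type*} [Fintype κ] [DecidableEq κ] [Fintype ι] [DecidableEq ι]

/-- The Gram matrix of `Q` in the basis `b`. -/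
def gramMatrix (Q : LinearMap.BilinForm ℝ L) (b : Module.Basis κ ℝ L) : Matrix κ κ ℝ :=
  Matrix.of fun i j => Q (b i) (b j)

/-- The Koszul formula for elements of a Lie algebra. -/
def lieKoszul (Q : LinearMap.BilinForm ℝ L) (u v w : L) : ℝ :=
  (Q ⁅u, v⁆ w - Q ⁅v, w⁆ u + Q ⁅w, u⁆ v) / 2

/-- The Levi-Civita connection of `Q` as a product on the Lie algebra. -/
def lieConnection (Q : LinearMap.BilinForm ℝ L) (b : Module.Basis κ ℝ L) : L →ₗ[ℝ] L →ₗ[ℝ] L :=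
  LinearMap.mk₂ ℝ
    (fun u v => ∑ i, ∑ j, ((gramMatrix Q b)⁻¹ i j * lieKoszul Q u v (b i)) • b j)
    (fun u u' v => by
      simp only [← Finset.sum_add_distrib, ← add_smul, lieKoszul, add_lie, lie_add, map_add,
        LinearMap.add_apply]
      refine Finset.sum_congr rfl fun i _ => Finset.sum_congr rfl fun j _ => ?_
      congr 1; ring)
    (fun c u v => by
      simp only [Finset.smul_sum, smul_smul, lieKoszul, smul_lie, lie_smul, map_smul,
        LinearMap.smul_apply, smul_eq_mul]
      refine Finset.sum_congr rfl fun i _ => Finset.sum_congr rfl fun j _ => ?_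
      congr 1; ring)
    (fun u v v' => by
      simp only [← Finset.sum_add_distrib, ← add_smul, lieKoszul, add_lie, lie_add, map_add,
        LinearMap.add_apply]
      refine Finset.sum_congr rfl fun i _ => Finset.sum_congr rfl fun j _ => ?_
      congr 1; ring)
    (fun c u v => by
      simp only [Finset.smul_sum, smul_smul, lieKoszul, smul_lie, lie_smul, map_smul,
        LinearMap.smul_apply, smul_eq_mul]
      refine Finset.sum_congr rfl fun i _ => Finset.sum_congr rfl fun j _ => ?_
      congr 1; ring)

lemma lieConnection_apply (Q : LinearMap.BilinForm ℝ L) (b : Module.Basis κ ℝ L) (u v : L) :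
    lieConnection Q b u v =
      ∑ i, ∑ j, ((gramMatrix Q b)⁻¹ i j * lieKoszul Q u v (b i)) • b j := rfl

/-- The curvature of `Q` as an operation on the Lie algebra. -/
def lieCurvature (Q : LinearMap.BilinForm ℝ L) (b : Module.Basis κ ℝ L) (u v w : L) : L :=
  lieConnection Q b u (lieConnection Q b v w) - lieConnection Q b v (lieConnection Q b u w)
    - lieConnection Q b ⁅u, v⁆ w

/-- The scalar curvature of `Q` in terms of the Lie algebra. -/
def lieScalarCurvature (Q : LinearMap.BilinForm ℝ L) (b : Module.Basis κ ℝ L) : ℝ :=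
  ∑ i, ∑ j, ∑ k, ∑ l, (gramMatrix Q b)⁻¹ i j * (gramMatrix Q b)⁻¹ k l *
    Q (lieCurvature Q b (b i) (b k) (b l)) (b j)

variable {Q : LinearMap.BilinForm ℝ L} {b : Module.Basis κ ℝ L} {f : Module.Basis ι ℝ L}

/-- The inverse metric is `∑ f a ⊗ f a` for any orthonormal `f`; here it is written in the
coordinates of `b`. -/
lemma IsOrthon.gramMatrix_inv (hf : IsOrthon Q f) :
    (gramMatrix Q b)⁻¹ = (Matrix.of fun i j => ∑ a, b.repr (f a) i * b.repr (f a) j) := by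
  refine Matrix.inv_eq_right_inv ?_
  ext i j
  have h1 : ∀ a, ∑ k, Q (b i) (b k) * b.repr (f a) k = Q (b i) (f a) := fun a => by
    conv_rhs => rw [← b.sum_repr (f a), map_sum]
    exact Finset.sum_congr rfl fun k _ => by rw [map_smul, smul_eq_mul, mul_comm]
  have h2 : ∑ a, Q (b i) (f a) * b.repr (f a) j = b.repr (b i) j := by
    conv_rhs => rw [← hf.sum_smul (b i), map_sum, Finsupp.finsetSum_apply]
    simp
  simp only [Matrix.mul_apply, gramMatrix, Matrix.of_apply, Finset.mul_sum]
  rw [Finset.sum_comm]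
  simp only [← mul_assoc, ← Finset.sum_mul, h1, h2]
  simp [Matrix.one_apply, Finsupp.single_apply]

/-- Contraction with the inverse metric does not depend on the basis. This replaces the fixed frame
of the definitions by an orthonormal basis suited to the metric. -/
lemma IsOrthon.sum_gramMatrix_inv (hf : IsOrthon Q f) (β : L → L → ℝ)
    (h1 : ∀ y, IsLinearMap ℝ fun x => β x y) (h2 : ∀ x, IsLinearMap ℝ (β x)) :
    ∑ i, ∑ j, (gramMatrix Q b)⁻¹ i j * β (b i) (b j) = ∑ a, β (f a) (f a) := by
  have h3 : ∀ a, β (f a) (f a) =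
      ∑ i, ∑ j, (b.repr (f a) i * b.repr (f a) j) * β (b i) (b j) := fun a => by
    have e1 : ∀ y, β (f a) y = ∑ i, b.repr (f a) i * β (b i) y := fun y => by
      conv_lhs => rw [← b.sum_repr (f a)]
      have := map_sum ((h1 y).mk' _) (fun i => b.repr (f a) i • b i) Finset.univ
      simp only [map_smul, IsLinearMap.mk'_apply, smul_eq_mul] at this
      exact this
    have e2 : ∀ x, β x (f a) = ∑ i, b.repr (f a) i * β x (b i) := fun x => by
      conv_lhs => rw [← b.sum_repr (f a)]
      have := map_sum ((h2 x).mk' _) (fun i => b.repr (f a) i • b i) Finset.univ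
      simp only [map_smul, IsLinearMap.mk'_apply, smul_eq_mul] at this
      exact this
    rw [e1]
    simp only [e2, Finset.mul_sum, mul_assoc]
  simp only [h3, hf.gramMatrix_inv, Matrix.of_apply, Finset.sum_mul]
  conv_rhs => rw [Finset.sum_comm]
  refine Finset.sum_congr rfl fun i _ => ?_
  rw [Finset.sum_comm]

lemma IsOrthon.lieConnection_right (hf : IsOrthon Q f) (u v w : L) :
    Q (lieConnection Q b u v) w = lieKoszul Q u v w := by
  have h := hf.sum_gramMatrix_inv (b := b) (fun x y => lieKoszul Q u v x * Q y w)
    (fun y => ⟨fun x x' => by simp [lieKoszul]; ring, fun c x => by simp [lieKoszul]; ring⟩)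
    (fun y => ⟨fun x x' => by simp; ring, fun c x => by simp; ring⟩)
  rw [lieConnection_apply, map_sum, LinearMap.sum_apply]
  simp only [map_sum, LinearMap.sum_apply, map_smul, LinearMap.smul_apply, smul_eq_mul, mul_assoc]
  rw [h]
  have hK : IsLinearMap ℝ (lieKoszul Q u v) :=
    ⟨fun x x' => by simp [lieKoszul]; ring, fun c x => by simp [lieKoszul]; ring⟩
  have h2 := map_sum (hK.mk' _) (fun i => f.repr w i • f i) Finset.univ
  rw [f.sum_repr] at h2
  simp only [map_smul, IsLinearMap.mk'_apply, smul_eq_mul] at h2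
  rw [h2]
  exact Finset.sum_congr rfl fun a _ => by rw [hf.repr', mul_comm]

lemma IsOrthon.lieScalarCurvature_eq_sum (hf : IsOrthon Q f) :
    lieScalarCurvature Q b = ∑ a, ∑ c, Q (lieCurvature Q b (f a) (f c) (f c)) (f a) := by
  have h1 : ∀ x y, ∑ k, ∑ l, (gramMatrix Q b)⁻¹ k l * Q (lieCurvature Q b x (b k) (b l)) y =
      ∑ c, Q (lieCurvature Q b x (f c) (f c)) y := fun x y =>
    hf.sum_gramMatrix_inv (b := b) (fun v w => Q (lieCurvature Q b x v w) y)
    (fun y => ⟨fun x x' => by simp [lieCurvature]; ring, fun c x => by simp [lieCurvature]; ring⟩)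
    (fun y => ⟨fun x x' => by simp [lieCurvature]; ring, fun c x => by simp [lieCurvature]; ring⟩)
  have h2 := hf.sum_gramMatrix_inv (b := b)
    (fun x y => ∑ c, Q (lieCurvature Q b x (f c) (f c)) y)
    (fun y => ⟨fun x x' => by
      rw [← Finset.sum_add_distrib]
      exact Finset.sum_congr rfl fun c _ => by simp [lieCurvature]; ring, fun c x => by
      rw [Finset.smul_sum]
      exact Finset.sum_congr rfl fun c _ => by simp [lieCurvature]; ring⟩)
    (fun y => ⟨fun x x' => by
      rw [← Finset.sum_add_distrib]
      exact Finset.sum_congr rfl fun c _ => by simp, fun c x => by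
      rw [Finset.smul_sum]
      exact Finset.sum_congr rfl fun c _ => by simp⟩)
  rw [← h2, lieScalarCurvature]
  simp only [← h1, Finset.mul_sum, mul_assoc]

omit [Fintype κ] [DecidableEq κ] [DecidableEq ι] in
lemma sum_rotate (F : ι → ι → ι → ℝ) :
    ∑ i, ∑ j, ∑ k, F i j k = ∑ i, ∑ j, ∑ k, F j k i := by
  conv_rhs => rw [Finset.sum_comm]
  conv_rhs =>
    enter [2, i]
    rw [Finset.sum_comm]

/-- The scalar curvature of an inner product on a unimodular Lie algebra. -/
lemma IsOrthon.lieScalarCurvature_eq (hf : IsOrthon Q f)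
    (huni : ∀ w : L, ∑ i, Q ⁅w, f i⁆ (f i) = 0) :
    lieScalarCurvature Q b = -(1 / 2) * ∑ i, killingForm ℝ L (f i) (f i) -
      1 / 4 * ∑ i, ∑ j, ∑ k, Q ⁅f i, f j⁆ (f k) ^ 2 := by
  have hsymm := hf.symm
  -- Metric compatibility: each `∇_u` is skew for `Q`. It moves the outer connection of the
  -- curvature to the other argument.
  have hK : ∀ u v w : L, Q (lieConnection Q b u v) w = - Q v (lieConnection Q b u w) := by
    intro u v w
    rw [hsymm v, hf.lieConnection_right, hf.lieConnection_right, lieKoszul, lieKoszul,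
      ← lie_skew u w, ← lie_skew w v, ← lie_skew v u]
    simp only [map_neg, LinearMap.neg_apply]
    ring
  -- Unimodularity is used here; it removes the term `Q (∇_c c) (∇_a a)` from the double trace.
  have hzero : ∑ c, lieConnection Q b (f c) (f c) = 0 := by
    have : ∀ i, f.repr (∑ c, lieConnection Q b (f c) (f c)) i = 0 := by
      intro i
      rw [hf.repr, map_sum, LinearMap.sum_apply, ← huni (f i)]
      refine Finset.sum_congr rfl fun c _ => ?_
      rw [hf.lieConnection_right, lieKoszul, lie_self, ← lie_skew (f i) (f c)]
      simp only [map_neg, map_zero, LinearMap.neg_apply, LinearMap.zero_apply]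
      ring
    exact f.repr.map_eq_zero_iff.1 (Finsupp.ext this)
  have hB : ∀ i, killingForm ℝ L (f i) (f i) = ∑ j, Q ⁅f i, ⁅f i, f j⁆⁆ (f j) := fun i =>
    hf.killingForm_apply _ _
  have hB' : ∀ i j, Q ⁅f i, ⁅f i, f j⁆⁆ (f j) =
      ∑ k, Q ⁅f i, f j⁆ (f k) * Q ⁅f i, f k⁆ (f j) := fun i j => by
    conv_lhs => rw [← hf.sum_smul ⁅f i, f j⁆, lie_sum, map_sum, LinearMap.sum_apply]
    simp
  have hT : ∀ a c, Q ⁅f a, f c⁆ ⁅f a, f c⁆ = ∑ k, Q ⁅f a, f c⁆ (f k) ^ 2 := fun a c => by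
    rw [← hf.sum_mul]
    exact Finset.sum_congr rfl fun k _ => by rw [hsymm (f k), sq]
  have hterm : ∀ a c, Q (lieCurvature Q b (f a) (f c) (f c)) (f a) =
      - Q (lieConnection Q b (f c) (f c)) (lieConnection Q b (f a) (f a)) +
      ∑ k, (Q (lieConnection Q b (f a) (f c)) (f k) * Q (lieConnection Q b (f c) (f a)) (f k)) +
      (- Q ⁅f c, ⁅f c, f a⁆⁆ (f a) - Q ⁅f a, ⁅f a, f c⁆⁆ (f c) - Q ⁅f a, f c⁆ ⁅f a, f c⁆) / 2 := by
    intro a c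
    have e1 : ∑ k, (Q (lieConnection Q b (f a) (f c)) (f k) *
        Q (lieConnection Q b (f c) (f a)) (f k)) =
        Q (lieConnection Q b (f a) (f c)) (lieConnection Q b (f c) (f a)) := by
      rw [← hf.sum_mul]
      exact Finset.sum_congr rfl fun k _ => by rw [hsymm (f k)]
    have e2 : Q (lieConnection Q b ⁅f a, f c⁆ (f c)) (f a) =
        (Q ⁅f c, ⁅f c, f a⁆⁆ (f a) + Q ⁅f a, ⁅f a, f c⁆⁆ (f c) + Q ⁅f a, f c⁆ ⁅f a, f c⁆) / 2 := by
      rw [hf.lieConnection_right, lieKoszul, ← lie_skew ⁅f a, f c⁆ (f c), ← lie_skew (f a) (f c)]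
      simp only [map_neg, LinearMap.neg_apply, lie_neg]
      ring
    rw [lieCurvature, map_sub, map_sub, LinearMap.sub_apply, LinearMap.sub_apply,
      hK (f a) (lieConnection Q b (f c) (f c)), hK (f c) (lieConnection Q b (f a) (f c)), e1, e2]
    ring
  have hfirst : ∑ a, ∑ c, Q (lieConnection Q b (f c) (f c)) (lieConnection Q b (f a) (f a)) = 0 := by
    refine Finset.sum_eq_zero fun a _ => ?_
    rw [← LinearMap.sum_apply, ← map_sum, hzero]
    simp
  set c : ι → ι → ι → ℝ := fun i j k => Q ⁅f i, f j⁆ (f k) with hc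
  have hanti : ∀ i j k, Q ⁅f j, f i⁆ (f k) = - c i j k := fun i j k => by
    simp only [hc]; rw [← lie_skew (f j) (f i), map_neg, LinearMap.neg_apply]
  have hG : ∀ i j k, Q (lieConnection Q b (f i) (f j)) (f k) =
      (c i j k - c j k i + c k i j) / 2 := fun i j k => by
    rw [hf.lieConnection_right, lieKoszul]
  have hsum : ∀ a j, Q (lieCurvature Q b (f a) (f j) (f j)) (f a) =
      - Q (lieConnection Q b (f j) (f j)) (lieConnection Q b (f a) (f a)) +
      ∑ k, (1 / 4 * c k a j ^ 2 + 1 / 4 * c j k a ^ 2 - 3 / 4 * c a j k ^ 2 -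
        1 / 2 * (c j k a * c k a j) + 1 / 2 * (c a j k * c j k a) +
        1 / 2 * (c a j k * c k a j)) := by
    intro a j
    rw [hterm, hB', hB', hT, add_assoc, ← Finset.sum_neg_distrib, ← Finset.sum_sub_distrib,
      ← Finset.sum_sub_distrib, Finset.sum_div, ← Finset.sum_add_distrib]
    congr 1
    refine Finset.sum_congr rfl fun k _ => ?_
    rw [hG, hG, hanti a j k, hanti k a j]
    have e1 : c j a k = - c a j k := hanti a j k
    have e2 : c a k j = - c k a j := hanti k a j
    have e3 : c k j a = - c j k a := hanti j k a
    rw [e1, e2, e3]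
    simp only [hc]
    ring
  -- After summation, cyclic relabelling leaves only `∑ c²` and `∑ c a j k * c j k a`; the latter is
  -- minus the trace of the Killing form.
  have r1 : ∑ a, ∑ j, ∑ k, c j k a ^ 2 = ∑ a, ∑ j, ∑ k, c a j k ^ 2 :=
    (sum_rotate fun a j k => c a j k ^ 2).symm
  have r2 : ∑ a, ∑ j, ∑ k, c k a j ^ 2 = ∑ a, ∑ j, ∑ k, c a j k ^ 2 :=
    sum_rotate fun a j k => c k a j ^ 2
  have r3 : ∑ a, ∑ j, ∑ k, c j k a * c k a j = ∑ a, ∑ j, ∑ k, c a j k * c j k a :=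
    (sum_rotate fun a j k => c a j k * c j k a).symm
  have r4 : ∑ a, ∑ j, ∑ k, c a j k * c k a j = ∑ a, ∑ j, ∑ k, c j k a * c a j k :=
    sum_rotate fun a j k => c a j k * c k a j
  have hBsum : ∑ a, killingForm ℝ L (f a) (f a) = - ∑ a, ∑ j, ∑ k, c a j k * c k a j := by
    simp only [hB, hB', ← Finset.sum_neg_distrib]
    refine Finset.sum_congr rfl fun a _ => Finset.sum_congr rfl fun j _ =>
      Finset.sum_congr rfl fun k _ => ?_
    rw [hanti k a j]; simp only [hc]; ring
  rw [hf.lieScalarCurvature_eq_sum]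
  simp only [hsum, Finset.sum_add_distrib, Finset.sum_sub_distrib, Finset.sum_neg_distrib,
    ← Finset.mul_sum]
  have r5 : ∑ a, ∑ j, ∑ k, c j k a * c a j k = ∑ a, ∑ j, ∑ k, c a j k * c j k a := by
    simp only [mul_comm]
  have r6 : ∑ a, ∑ j, ∑ k, Q ⁅f a, f j⁆ (f k) ^ 2 = ∑ a, ∑ j, ∑ k, c a j k ^ 2 := rfl
  rw [hfirst, r1, r2, hBsum, r4, r3, r5, r6]
  ring

end AlgebraicCurvature
-- From vector fields on the group to the Lie algebra.
section LeftInvariantFields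

variable {d : ℕ} {G : Type*} [TopologicalSpace G] [ChartedSpace (EuclideanSpace ℝ (Fin d)) G]
  [Group G]

/-- A continuous bilinear form on the Lie algebra, as a bilinear form. -/
def toForm (Q : BilinearForm d G) : LinearMap.BilinForm ℝ (GroupLieAlgebra (𝓡 d) G) :=
  LinearMap.mk₂ ℝ (fun u v => Q u v) (by simp) (by simp) (by simp) (by simp)

@[simp] lemma toForm_apply (Q : BilinearForm d G) (u v : GroupLieAlgebra (𝓡 d) G) :
    toForm Q u v = Q u v := rfl

variable [LieGroup (𝓡 d) ∞ G]

lemma gramMatrix_toForm (Q : BilinearForm d G) : gramMatrix (toForm Q) (frame d G) = gram Q := rfl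

/-- Differentiate the fact that left translation by `x⁻¹` undoes left translation by `x`. -/
lemma mfderiv_inv_mul_mulInvariantVectorField (x : G) (u : GroupLieAlgebra (𝓡 d) G) :
    (mfderiv (𝓡 d) (𝓡 d) (fun y : G => x⁻¹ * y) x (mulInvariantVectorField u x) :
      EuclideanSpace ℝ (Fin d)) = u := by
  have h1 : MDifferentiableAt (𝓡 d) (𝓡 d) (fun y : G => x⁻¹ * y) (x * 1) :=
    (contMDiff_mul_left (I := 𝓡 d) (n := ∞)).contMDiffAt.mdifferentiableAt (by simp)
  have h2 : MDifferentiableAt (𝓡 d) (𝓡 d) (fun y : G => x * y) 1 :=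
    (contMDiff_mul_left (I := 𝓡 d) (n := ∞)).contMDiffAt.mdifferentiableAt (by simp)
  have h3 := mfderiv_comp (1 : G) h1 h2
  have h4 : (fun y : G => x⁻¹ * y) ∘ (fun y => x * y) = id := by ext; simp
  rw [h4, mfderiv_id] at h3
  have h5 : ∀ z, z = x → (mfderiv (𝓡 d) (𝓡 d) (fun y : G => x⁻¹ * y) z :
      EuclideanSpace ℝ (Fin d) →L[ℝ] EuclideanSpace ℝ (Fin d)) =
      mfderiv (𝓡 d) (𝓡 d) (fun y : G => x⁻¹ * y) x := by
    rintro z rfl; rfl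
  exact (congrArg (fun A : EuclideanSpace ℝ (Fin d) →L[ℝ] EuclideanSpace ℝ (Fin d) =>
    A (mulInvariantVectorField u x)) (h5 (x * 1) (mul_one x))).symm.trans
    (congrArg (fun A => A u) h3).symm

lemma metric_mulInvariantVectorField (Q : BilinearForm d G) (u v : GroupLieAlgebra (𝓡 d) G)
    (x : G) : metric Q x (mulInvariantVectorField u x) (mulInvariantVectorField v x) = Q u v :=
  congrArg₂ (fun a b => Q a b) (mfderiv_inv_mul_mulInvariantVectorField x u)
    (mfderiv_inv_mul_mulInvariantVectorField x v)

lemma pairing_mulInvariantVectorField (Q : BilinearForm d G) (u v : GroupLieAlgebra (𝓡 d) G) :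
    pairing Q (mulInvariantVectorField u) (mulInvariantVectorField v) = fun _ => Q u v :=
  funext fun x => metric_mulInvariantVectorField Q u v x

lemma dirDeriv_pairing_mulInvariantVectorField (Q : BilinearForm d G)
    (u v : GroupLieAlgebra (𝓡 d) G) (X : VField d G) (x : G) :
    dirDeriv X (pairing Q (mulInvariantVectorField u) (mulInvariantVectorField v)) x = 0 := by
  rw [dirDeriv, pairing_mulInvariantVectorField, mfderiv_const]
  rfl

lemma mlieBracket_mulInvariantVectorField (u v : GroupLieAlgebra (𝓡 d) G) :
    VectorField.mlieBracket (𝓡 d) (mulInvariantVectorField u) (mulInvariantVectorField v) =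
      (mulInvariantVectorField ⁅u, v⁆ : VField d G) := by
  rw [GroupLieAlgebra.bracket_def, mulInvariantVector_mlieBracket]

lemma koszul_mulInvariantVectorField (Q : BilinearForm d G) (u v w : GroupLieAlgebra (𝓡 d) G)
    (x : G) : koszul Q (mulInvariantVectorField u) (mulInvariantVectorField v)
      (mulInvariantVectorField w) x = lieKoszul (toForm Q) u v w := by
  rw [koszul, dirDeriv_pairing_mulInvariantVectorField, dirDeriv_pairing_mulInvariantVectorField,
    dirDeriv_pairing_mulInvariantVectorField]
  simp only [mlieBracket_mulInvariantVectorField, lieKoszul, toForm_apply,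
    pairing_mulInvariantVectorField, add_zero, sub_zero, zero_add]

lemma leviCivita_mulInvariantVectorField (Q : BilinearForm d G)
    (u v : GroupLieAlgebra (𝓡 d) G) :
    leviCivita Q (mulInvariantVectorField u) (mulInvariantVectorField v) =
      mulInvariantVectorField (lieConnection (toForm Q) (frame d G) u v) := by
  funext x
  simp only [leviCivita, frameField, koszul_mulInvariantVectorField, lieConnection_apply,
    gramMatrix_toForm, mulInvariantVectorField, map_sum, map_smul]
  rfl

lemma curvature_mulInvariantVectorField (Q : BilinearForm d G)
    (u v w : GroupLieAlgebra (𝓡 d) G) :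
    curvature Q (mulInvariantVectorField u) (mulInvariantVectorField v)
      (mulInvariantVectorField w) =
      mulInvariantVectorField (lieCurvature (toForm Q) (frame d G) u v w) := by
  simp only [curvature, leviCivita_mulInvariantVectorField, mlieBracket_mulInvariantVectorField]
  funext x
  simp only [lieCurvature, mulInvariantVectorField, Pi.sub_apply, map_sub]
  rfl

lemma scalarCurvature_eq (Q : BilinearForm d G) :
    scalarCurvature Q = lieScalarCurvature (toForm Q) (frame d G) := by
  simp only [scalarCurvature, scalarCurvatureAt, frameField, curvature_mulInvariantVectorField,
    pairing_mulInvariantVectorField, lieScalarCurvature, gramMatrix_toForm, toForm_apply]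

end LeftInvariantFields
-- Structure constants in an orthonormal basis for minus the Killing form.
section StructureConstants

variable {L : Type*} [LieRing L] [LieAlgebra ℝ L]
  {κ ι : Type*} [Fintype κ] [DecidableEq κ] [Fintype ι] [DecidableEq ι]
  {b : Module.Basis κ ℝ L} {f : Module.Basis ι ℝ L}

variable (f) in
/-- The structure constants of the basis `f`, with the last index lowered by `-B`. -/
def structConst (i j k : ι) : ℝ := (-killingForm ℝ L) ⁅f i, f j⁆ (f k)

omit [Fintype ι] [DecidableEq ι] in
lemma neg_killingForm_lie (u v w : L) :
    (-killingForm ℝ L) ⁅u, v⁆ w = (-killingForm ℝ L) u ⁅v, w⁆ := by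
  simp only [LinearMap.neg_apply, LieModule.traceForm_apply_lie_apply]

lemma neg_killingForm_comm (u v : L) :
    (-killingForm ℝ L) u v = (-killingForm ℝ L) v u := by
  simp only [LinearMap.neg_apply, LieModule.traceForm_comm ℝ L L u v]

omit [Fintype ι] [DecidableEq ι] in
lemma structConst_swap (i j k : ι) : structConst f j i k = - structConst f i j k := by
  rw [structConst, structConst, ← lie_skew (f j) (f i), map_neg, LinearMap.neg_apply]

omit [Fintype ι] [DecidableEq ι] in
lemma structConst_rotate (i j k : ι) : structConst f j k i = structConst f i j k := by
  rw [structConst, structConst, neg_killingForm_comm, neg_killingForm_lie (f i)]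

omit [Fintype ι] [DecidableEq ι] in
lemma structConst_self (i k : ι) : structConst f i i k = 0 := by
  rw [structConst, lie_self, map_zero, LinearMap.zero_apply]

variable (hf : IsOrthon (-killingForm ℝ L) f)
include hf

/-- Invariance moves one bracket across, and the sum becomes the trace that defines the Killing
form. This normalizes the structure constants. -/
lemma IsOrthon.sum_lie_lie (u v : L) :
    ∑ j, (-killingForm ℝ L) ⁅u, f j⁆ ⁅v, f j⁆ = (-killingForm ℝ L) u v := by
  rw [neg_killingForm_comm]
  conv_rhs => rw [LinearMap.neg_apply, LinearMap.neg_apply, hf.killingForm_apply]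
  rw [← Finset.sum_neg_distrib]
  refine Finset.sum_congr rfl fun j _ => ?_
  rw [← lie_skew v ⁅u, f j⁆, ← neg_killingForm_lie ⁅u, f j⁆ v (f j)]
  generalize (-killingForm ℝ L) = q
  simp

lemma IsOrthon.sum_structConst_mul (i i' : ι) :
    ∑ j, ∑ k, structConst f i j k * structConst f i' j k = if i = i' then 1 else 0 := by
  rw [← hf i i', ← hf.sum_lie_lie]
  refine Finset.sum_congr rfl fun j _ => ?_
  rw [← hf.sum_mul]
  refine Finset.sum_congr rfl fun k _ => ?_
  rw [neg_killingForm_comm (f k)]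
  rfl

lemma IsOrthon.sum_structConst_sq (i : ι) : ∑ j, ∑ k, structConst f i j k ^ 2 = 1 := by
  simpa [sq] using hf.sum_structConst_mul i i

/-- Unimodularity: `ad w` is skew for `-B`. -/
lemma IsOrthon.trace_ad (w : L) : LinearMap.trace ℝ L (LieAlgebra.ad ℝ L w) = 0 := by
  rw [hf.trace]
  refine Finset.sum_eq_zero fun i _ => ?_
  rw [LieAlgebra.ad_apply, neg_killingForm_lie, lie_self, map_zero]

/-- The scalar curvature of a metric that is diagonal in a `-B`-orthonormal basis. -/
lemma IsOrthon.lieScalarCurvature_diagonal {q : LinearMap.BilinForm ℝ L} {l : ι → ℝ}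
    (hl : ∀ i, 0 < l i) (hq : ∀ i j, q (f i) (f j) = if i = j then l i else 0) :
    lieScalarCurvature q b = 1 / 2 * ∑ i, (l i)⁻¹ -
      1 / 4 * ∑ i, ∑ j, ∑ k, structConst f i j k ^ 2 * (l k / (l i * l j)) := by
  have hs : ∀ i, 0 < √(l i) := fun i => Real.sqrt_pos.2 (hl i)
  have hs2 : ∀ i, √(l i) ^ 2 = l i := fun i => Real.sq_sqrt (hl i).le
  -- Dividing `f i` by `√(l i)` makes the basis `q`-orthonormal, so the general formula applies to
  -- it.
  let e : Module.Basis ι ℝ L := f.isUnitSMul (w := fun i => (√(l i))⁻¹)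
    fun i => (inv_ne_zero (hs i).ne').isUnit
  have he : ∀ i, e i = (√(l i))⁻¹ • f i := fun i => f.isUnitSMul_apply _ i
  have hon : IsOrthon q e := by
    intro i j
    rw [he, he, map_smul, map_smul, LinearMap.smul_apply, hq]
    split_ifs with h
    · subst h
      have := (hs i).ne'
      rw [smul_eq_mul, smul_eq_mul, ← hs2 i, Real.sqrt_sq (hs i).le]
      field_simp
    · simp
  have hqc : ∀ v k, q v (f k) = l k * (-killingForm ℝ L) v (f k) := by
    intro v k
    conv_lhs => rw [← f.sum_repr v, map_sum, LinearMap.sum_apply]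
    simp only [map_smul, LinearMap.smul_apply, hq, smul_eq_mul]
    rw [← hf.repr]
    simp [mul_comm]
  have huni : ∀ w : L, ∑ i, q ⁅w, e i⁆ (e i) = 0 := fun w => by
    have := hon.trace (LieAlgebra.ad ℝ L w)
    rw [hf.trace_ad] at this
    exact this.symm
  rw [hon.lieScalarCurvature_eq huni]
  congr 1
  · rw [neg_mul, ← mul_neg, ← Finset.sum_neg_distrib]
    congr 1
    refine Finset.sum_congr rfl fun i _ => ?_
    have h1 : (-killingForm ℝ L) (f i) (f i) = 1 := by simpa using hf i i
    rw [LinearMap.neg_apply, LinearMap.neg_apply] at h1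
    rw [he, map_smul, map_smul, LinearMap.smul_apply, smul_eq_mul, smul_eq_mul, ← hs2 i]
    have := (hs i).ne'
    rw [Real.sqrt_sq (hs i).le]
    field_simp
    linarith
  · congr 1
    refine Finset.sum_congr rfl fun i _ => Finset.sum_congr rfl fun j _ =>
      Finset.sum_congr rfl fun k _ => ?_
    rw [he, he, he, smul_lie, lie_smul, map_smul, map_smul, map_smul, LinearMap.smul_apply,
      LinearMap.smul_apply, hqc]
    rw [← structConst]
    have := (hs i).ne'
    have := (hs j).ne'
    have := (hs k).ne'
    simp only [smul_eq_mul, mul_pow, inv_pow, hs2]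
    have := (hl i).ne'
    have := (hl j).ne'
    have := (hl k).ne'
    field_simp

/-- The scalar curvature of a metric in terms of its Gram matrix in a `-B`-orthonormal basis. -/
lemma IsOrthon.lieScalarCurvature_gramMatrix [FiniteDimensional ℝ L] {q : LinearMap.BilinForm ℝ L}
    (hq : IsPosSymm q) : lieScalarCurvature q b = 1 / 2 * ∑ i, (gramMatrix q f)⁻¹ i i -
      1 / 4 * ∑ i, ∑ j, ∑ k, ∑ l, (gramMatrix q f)⁻¹ i j * ((gramMatrix q f)⁻¹ k l *
        q ⁅f i, f k⁆ ⁅f j, f l⁆) := by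
  obtain ⟨e, -, he, -⟩ := hq.exists_eigenbasis 0 (by simp)
  have huni : ∀ w : L, ∑ i, q ⁅w, e i⁆ (e i) = 0 := fun w => by
    have := he.trace (LieAlgebra.ad ℝ L w)
    rw [hf.trace_ad] at this
    exact this.symm
  rw [he.lieScalarCurvature_eq huni]
  congr 1
  · rw [← he.sum_gramMatrix_inv (b := f) (fun x y => killingForm ℝ L x y)
      (fun y => ⟨fun x x' => by simp, fun c x => by simp⟩)
      (fun y => ⟨fun x x' => by simp, fun c x => by simp⟩), neg_mul, ← mul_neg,
      ← Finset.sum_neg_distrib]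
    congr 1
    refine Finset.sum_congr rfl fun i _ => ?_
    have h1 : ∀ j, killingForm ℝ L (f i) (f j) = - if i = j then 1 else 0 := fun j => by
      rw [← hf i j]; simp
    simp [h1]
  · congr 1
    have h1 : ∀ x y : L, ∑ k, ∑ l, (gramMatrix q f)⁻¹ k l * q ⁅x, f k⁆ ⁅y, f l⁆ =
        ∑ c, q ⁅x, e c⁆ ⁅y, e c⁆ := fun x y =>
      he.sum_gramMatrix_inv (b := f) (fun v w => q ⁅x, v⁆ ⁅y, w⁆)
        (fun z => ⟨fun x x' => by simp, fun c x => by simp⟩)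
        (fun z => ⟨fun x x' => by simp, fun c x => by simp⟩)
    have h2 := he.sum_gramMatrix_inv (b := f) (fun x y => ∑ c, q ⁅x, e c⁆ ⁅y, e c⁆)
        (fun z => ⟨fun x x' => by simp [Finset.sum_add_distrib],
          fun c x => by simp [Finset.mul_sum]⟩)
        (fun z => ⟨fun x x' => by simp [Finset.sum_add_distrib],
          fun c x => by simp [Finset.mul_sum]⟩)
    simp only [← Finset.mul_sum, h1]
    rw [h2]
    refine Finset.sum_congr rfl fun i _ => Finset.sum_congr rfl fun j _ => ?_
    rw [← he.sum_mul]
    exact Finset.sum_congr rfl fun k _ => by rw [hq.1 (e k), sq]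

end StructureConstants
-- First and second variation along diagonal metrics.
section Variation

variable {L : Type*} [LieRing L] [LieAlgebra ℝ L]
  {κ ι : Type*} [Fintype κ] [DecidableEq κ] [Fintype ι] [DecidableEq ι]
  {b : Module.Basis κ ℝ L} {f : Module.Basis ι ℝ L}

/-- The scalar curvature along the diagonal curve with eigenvalues `exp (a i * t)`. -/
def diagonalScalar (f : Module.Basis ι ℝ L) (a : ι → ℝ) (t : ℝ) : ℝ :=
  1 / 2 * ∑ i, Real.exp (-a i * t) -
    1 / 4 * ∑ i, ∑ j, ∑ k, structConst f i j k ^ 2 * Real.exp ((a k - a i - a j) * t)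

omit [DecidableEq ι] in
lemma hasDerivAt_diagonalScalar (a : ι → ℝ) (t : ℝ) : HasDerivAt (diagonalScalar f a)
    (1 / 2 * ∑ i, -a i * Real.exp (-a i * t) - 1 / 4 * ∑ i, ∑ j, ∑ k,
      structConst f i j k ^ 2 * ((a k - a i - a j) * Real.exp ((a k - a i - a j) * t))) t := by
  have h : ∀ c : ℝ, HasDerivAt (fun t => Real.exp (c * t)) (c * Real.exp (c * t)) t := fun c => by
    have := ((hasDerivAt_id t).const_mul c).exp
    simpa [mul_comm] using this
  refine HasDerivAt.sub (HasDerivAt.const_mul _ (HasDerivAt.fun_sum fun i _ => h _))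
    (HasDerivAt.const_mul _ (HasDerivAt.fun_sum fun i _ => HasDerivAt.fun_sum fun j _ =>
      HasDerivAt.fun_sum fun k _ => (h _).const_mul _))

omit [DecidableEq ι] in
lemma hasDerivAt_deriv_diagonalScalar (a : ι → ℝ) (t : ℝ) :
    HasDerivAt (deriv (diagonalScalar f a))
    (1 / 2 * ∑ i, -a i * (-a i * Real.exp (-a i * t)) - 1 / 4 * ∑ i, ∑ j, ∑ k,
      structConst f i j k ^ 2 * ((a k - a i - a j) *
        ((a k - a i - a j) * Real.exp ((a k - a i - a j) * t)))) t := by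
  have h : ∀ c : ℝ, HasDerivAt (fun t => Real.exp (c * t)) (c * Real.exp (c * t)) t := fun c => by
    have := ((hasDerivAt_id t).const_mul c).exp
    simpa [mul_comm] using this
  rw [show deriv (diagonalScalar f a) = _ from funext fun t => (hasDerivAt_diagonalScalar a t).deriv]
  refine HasDerivAt.sub (HasDerivAt.const_mul _ (HasDerivAt.fun_sum fun i _ =>
    (h _).const_mul _)) (HasDerivAt.const_mul _ (HasDerivAt.fun_sum fun i _ =>
      HasDerivAt.fun_sum fun j _ => HasDerivAt.fun_sum fun k _ => ((h _).const_mul _).const_mul _))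

section Sums

variable (hf : IsOrthon (-killingForm ℝ L) f)
include hf

lemma IsOrthon.sum_structConst_left (w : ι → ℝ) :
    ∑ i, ∑ j, ∑ k, structConst f i j k ^ 2 * w i = ∑ i, w i := by
  refine Finset.sum_congr rfl fun i _ => ?_
  simp only [← Finset.sum_mul, hf.sum_structConst_sq, one_mul]

lemma IsOrthon.sum_structConst_mid (w : ι → ℝ) :
    ∑ i, ∑ j, ∑ k, structConst f i j k ^ 2 * w j = ∑ i, w i := by
  rw [← hf.sum_structConst_left w, sum_rotate fun i j k => structConst f i j k ^ 2 * w i]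
  simp only [structConst_rotate]

lemma IsOrthon.sum_structConst_right (w : ι → ℝ) :
    ∑ i, ∑ j, ∑ k, structConst f i j k ^ 2 * w k = ∑ i, w i := by
  rw [← hf.sum_structConst_mid w, sum_rotate fun i j k => structConst f i j k ^ 2 * w j]
  simp only [structConst_rotate]

lemma IsOrthon.deriv_diagonalScalar_zero {a : ι → ℝ} (ha : ∑ i, a i = 0) :
    deriv (diagonalScalar f a) 0 = 0 := by
  rw [(hasDerivAt_diagonalScalar a 0).deriv]
  simp only [mul_zero, Real.exp_zero, mul_one, mul_sub, Finset.sum_sub_distrib,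
    hf.sum_structConst_left, hf.sum_structConst_mid, hf.sum_structConst_right,
    Finset.sum_neg_distrib, ha]
  simp

/-- In the square of `a k - a i - a j` each pure square contributes `∑ a i ^ 2` by normalization.
The three mixed sums agree by cyclic symmetry and occur with factors `-2`, `-2`, `2`. -/
lemma IsOrthon.deriv_deriv_diagonalScalar_zero (a : ι → ℝ) :
    deriv (deriv (diagonalScalar f a)) 0 = -(1 / 4) * ∑ i, a i ^ 2 +
      1 / 2 * ∑ i, ∑ j, ∑ k, structConst f i j k ^ 2 * (a i * a j) := by
  rw [(hasDerivAt_deriv_diagonalScalar a 0).deriv]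
  have h1 : ∀ i j k, structConst f i j k ^ 2 * ((a k - a i - a j) *
      ((a k - a i - a j) * Real.exp ((a k - a i - a j) * 0))) =
      structConst f i j k ^ 2 * a i ^ 2 + structConst f i j k ^ 2 * a j ^ 2 +
      structConst f i j k ^ 2 * a k ^ 2 - 2 * (structConst f i j k ^ 2 * (a k * a i)) -
      2 * (structConst f i j k ^ 2 * (a j * a k)) + 2 * (structConst f i j k ^ 2 * (a i * a j)) := by
    intro i j k
    rw [mul_zero, Real.exp_zero]; ring
  have h2 : ∑ i, ∑ j, ∑ k, structConst f i j k ^ 2 * (a j * a k) =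
      ∑ i, ∑ j, ∑ k, structConst f i j k ^ 2 * (a i * a j) := by
    rw [sum_rotate fun i j k => structConst f i j k ^ 2 * (a i * a j)]
    simp only [structConst_rotate]
  have h3 : ∑ i, ∑ j, ∑ k, structConst f i j k ^ 2 * (a k * a i) =
      ∑ i, ∑ j, ∑ k, structConst f i j k ^ 2 * (a i * a j) := by
    rw [← h2, sum_rotate fun i j k => structConst f i j k ^ 2 * (a j * a k)]
    simp only [structConst_rotate]
  simp only [h1, Finset.sum_add_distrib, Finset.sum_sub_distrib, ← Finset.mul_sum, h2, h3]
  rw [hf.sum_structConst_left (fun i => a i ^ 2), hf.sum_structConst_mid (fun i => a i ^ 2),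
    hf.sum_structConst_right (fun i => a i ^ 2)]
  have h4 : ∑ i, -a i * (-a i * Real.exp (-a i * 0)) = ∑ i, a i ^ 2 :=
    Finset.sum_congr rfl fun i _ => by rw [mul_zero, Real.exp_zero]; ring
  rw [h4]
  ring

end Sums

/-- The second derivative test gives a local maximum; a point that is also a local minimum would
make `F` locally constant. -/
lemma not_isLocalMin_of_deriv_deriv_neg {F : ℝ → ℝ} {x : ℝ} (h0 : deriv F x = 0)
    (h2 : deriv (deriv F) x < 0) (hc : ContinuousAt F x) : ¬ IsLocalMin F x := by
  intro h
  have hmax := isLocalMax_of_deriv_deriv_neg h2 h0 hc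
  have hconst : F =ᶠ[𝓝 x] fun _ => F x := by
    filter_upwards [h, hmax] with y h1 h2 using le_antisymm h2 h1
  have : deriv (deriv F) x = 0 := by
    rw [hconst.deriv.deriv_eq]
    simp
  exact h2.ne this

lemma not_isLocalMax_of_deriv_deriv_pos {F : ℝ → ℝ} {x : ℝ} (h0 : deriv F x = 0)
    (h2 : 0 < deriv (deriv F) x) (hc : ContinuousAt F x) : ¬ IsLocalMax F x := by
  intro h
  have hmin := isLocalMin_of_deriv_deriv_pos h2 h0 hc
  have hconst : F =ᶠ[𝓝 x] fun _ => F x := by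
    filter_upwards [h, hmin] with y h1 h2 using le_antisymm h1 h2
  have : deriv (deriv F) x = 0 := by
    rw [hconst.deriv.deriv_eq]
    simp
  exact h2.ne' this

/-- The scalar curvature decreases when one direction is stretched and another one shrunk. -/
lemma IsOrthon.not_isLocalMin_diagonalScalar (hf : IsOrthon (-killingForm ℝ L) f) {p q : ι}
    (hpq : p ≠ q) : ¬ IsLocalMin (diagonalScalar f (Pi.single p 1 - Pi.single q 1)) 0 := by
  set a : ι → ℝ := Pi.single p 1 - Pi.single q 1 with ha
  have h1 : ∑ i, a i = 0 := by simp [ha]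
  refine not_isLocalMin_of_deriv_deriv_neg (hf.deriv_diagonalScalar_zero h1) ?_
    (hasDerivAt_diagonalScalar a 0).continuousAt
  rw [hf.deriv_deriv_diagonalScalar_zero]
  have h2 : 0 < ∑ i, a i ^ 2 := by
    refine Finset.sum_pos' (fun i _ => sq_nonneg _) ⟨p, Finset.mem_univ p, ?_⟩
    simp [ha, hpq]
  have h3 : ∑ i, ∑ j, ∑ k, structConst f i j k ^ 2 * (a i * a j) ≤ 0 := by
    refine Finset.sum_nonpos fun i _ => Finset.sum_nonpos fun j _ => Finset.sum_nonpos fun k _ => ?_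
    rcases eq_or_ne i j with rfl | hij
    · simp [structConst_self]
    · refine mul_nonpos_of_nonneg_of_nonpos (sq_nonneg _) ?_
      simp only [ha, Pi.sub_apply, Pi.single_apply]
      split_ifs <;> simp_all
  linarith

/-- If `a` is constant on ideals, the second variation of the scalar curvature is positive. -/
lemma IsOrthon.not_isLocalMax_diagonalScalar (hf : IsOrthon (-killingForm ℝ L) f) {a : ι → ℝ}
    (h0 : ∑ i, a i = 0) (ha : a ≠ 0) (h : ∀ i j k, structConst f i j k ≠ 0 → a i = a j) :
    ¬ IsLocalMax (diagonalScalar f a) 0 := by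
  refine not_isLocalMax_of_deriv_deriv_pos (hf.deriv_diagonalScalar_zero h0) ?_
    (hasDerivAt_diagonalScalar a 0).continuousAt
  rw [hf.deriv_deriv_diagonalScalar_zero]
  have h2 : 0 < ∑ i, a i ^ 2 := by
    obtain ⟨p, hp⟩ := Function.ne_iff.1 ha
    exact Finset.sum_pos' (fun i _ => sq_nonneg _) ⟨p, Finset.mem_univ p, sq_pos_of_ne_zero hp⟩
  have h3 : ∑ i, ∑ j, ∑ k, structConst f i j k ^ 2 * (a i * a j) = ∑ i, a i ^ 2 := by
    rw [← hf.sum_structConst_left fun i => a i ^ 2]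
    refine Finset.sum_congr rfl fun i _ => Finset.sum_congr rfl fun j _ =>
      Finset.sum_congr rfl fun k _ => ?_
    by_cases hc : structConst f i j k = 0
    · simp [hc]
    · rw [h i j k hc, sq (a j)]
  rw [h3]
  linarith

end Variation
-- Diagonal curves in the set of metrics of fixed volume.
section Metrics

lemma det_gramMatrix_eq {L : Type*} [LieRing L] [LieAlgebra ℝ L] {κ : Type*} [Fintype κ]
    [DecidableEq κ] (Q : LinearMap.BilinForm ℝ L) (b f : Module.Basis κ ℝ L) :
    (gramMatrix Q b).det = (f.toMatrix b).det ^ 2 * (gramMatrix Q f).det := by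
  have h1 : ∀ c : Module.Basis κ ℝ L, gramMatrix Q c = LinearMap.BilinForm.toMatrix c Q :=
    fun c => by ext i j; simp [gramMatrix, LinearMap.BilinForm.toMatrix_apply]
  rw [h1, h1, ← LinearMap.BilinForm.toMatrix_mul_basis_toMatrix f b Q, Matrix.det_mul,
    Matrix.det_mul, Matrix.det_transpose]
  ring

lemma det_toMatrix_ne_zero {V : Type*} [AddCommGroup V] [Module ℝ V] {κ : Type*} [Fintype κ]
    [DecidableEq κ] (f b : Module.Basis κ ℝ V) : (f.toMatrix b).det ≠ 0 := by
  intro h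
  have := congrArg Matrix.det (f.toMatrix_mul_toMatrix_flip b)
  rw [Matrix.det_mul, h, zero_mul, Matrix.det_one] at this
  exact zero_ne_one this

lemma IsOrthon.gramMatrix_eq_one {L : Type*} [LieRing L] [LieAlgebra ℝ L] {κ : Type*} [Fintype κ]
    [DecidableEq κ] {Q : LinearMap.BilinForm ℝ L} {f : Module.Basis κ ℝ L} (hf : IsOrthon Q f) :
    gramMatrix Q f = 1 := by
  ext i j
  simp [gramMatrix, hf i j, Matrix.one_apply]

variable {d : ℕ} {G : Type*} [TopologicalSpace G] [ChartedSpace (EuclideanSpace ℝ (Fin d)) G]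
  [Group G] [LieGroup (𝓡 d) ∞ G]

lemma toForm_standardMetric :
    toForm (standardMetric d G) = -killingForm ℝ (GroupLieAlgebra (𝓡 d) G) := rfl

variable {f : Module.Basis (Fin (Module.finrank ℝ (GroupLieAlgebra (𝓡 d) G))) ℝ
  (GroupLieAlgebra (𝓡 d) G)}

/-- A change of basis multiplies every Gram determinant by the same positive square, so the
constraint can be read in an orthonormal basis. -/
lemma IsOrthon.mem_metricsOfVolume_iff
    (hf : IsOrthon (-killingForm ℝ (GroupLieAlgebra (𝓡 d) G)) f) {Q : BilinearForm d G} :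
    Q ∈ metricsOfVolume (standardMetric d G) ↔
      IsPosSymm (toForm Q) ∧ (gramMatrix (toForm Q) f).det = 1 := by
  refine and_congr Iff.rfl ?_
  have h0 : 0 < (f.toMatrix (frame d G)).det ^ 2 :=
    sq_pos_of_ne_zero (det_toMatrix_ne_zero f (frame d G))
  rw [volume, volume, ← gramMatrix_toForm, ← gramMatrix_toForm, toForm_standardMetric,
    det_gramMatrix_eq _ (frame d G) f, det_gramMatrix_eq _ (frame d G) f, hf.gramMatrix_eq_one,
    Matrix.det_one, mul_one, Real.sqrt_mul h0.le, mul_right_eq_self₀, Real.sqrt_eq_one]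
  simp [(Real.sqrt_pos.2 h0).ne']

/-- The rank one form `f i ⊗ f i` in terms of the basis dual to `f`. -/
def coordForm (f : Module.Basis (Fin (Module.finrank ℝ (GroupLieAlgebra (𝓡 d) G))) ℝ
    (GroupLieAlgebra (𝓡 d) G)) (i : Fin (Module.finrank ℝ (GroupLieAlgebra (𝓡 d) G))) :
    BilinearForm d G :=
  haveI : T2Space (GroupLieAlgebra (𝓡 d) G) :=
    inferInstanceAs (T2Space (EuclideanSpace ℝ (Fin d)))
  (LinearMap.BilinForm.linMulLin (f.coord i) (f.coord i)).toContinuousBilinearMap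

/-- The curve of metrics that are diagonal in the basis `f`, with eigenvalues `exp (a i * t)`. -/
def diagonalCurve (f : Module.Basis (Fin (Module.finrank ℝ (GroupLieAlgebra (𝓡 d) G))) ℝ
    (GroupLieAlgebra (𝓡 d) G)) (a : Fin (Module.finrank ℝ (GroupLieAlgebra (𝓡 d) G)) → ℝ)
    (t : ℝ) : BilinearForm d G := ∑ i, Real.exp (a i * t) • coordForm f i

omit [LieGroup (𝓡 d) ∞ G] in
lemma diagonalCurve_apply (a : Fin (Module.finrank ℝ (GroupLieAlgebra (𝓡 d) G)) → ℝ) (t : ℝ)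
    (v w : GroupLieAlgebra (𝓡 d) G) :
    toForm (diagonalCurve f a t) v w = ∑ i, Real.exp (a i * t) * (f.repr v i * f.repr w i) := by
  simp only [toForm_apply, diagonalCurve, sum_apply,
    smul_apply, smul_eq_mul]
  rfl

omit [LieGroup (𝓡 d) ∞ G] in
lemma toForm_diagonalCurve_basis (a : Fin (Module.finrank ℝ (GroupLieAlgebra (𝓡 d) G)) → ℝ)
    (t : ℝ) (i j) :
    toForm (diagonalCurve f a t) (f i) (f j) = if i = j then Real.exp (a i * t) else 0 := by
  rw [diagonalCurve_apply]
  rcases eq_or_ne i j with rfl | h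
  · simp [Finsupp.single_apply]
  · simp [Finsupp.single_apply, h]

omit [LieGroup (𝓡 d) ∞ G] in
lemma isPosSymm_diagonalCurve (a : Fin (Module.finrank ℝ (GroupLieAlgebra (𝓡 d) G)) → ℝ)
    (t : ℝ) : IsPosSymm (toForm (diagonalCurve f a t)) := by
  refine ⟨fun v w => ?_, fun v hv => ?_⟩
  · simp only [diagonalCurve_apply, mul_comm (f.repr v _)]
  · rw [diagonalCurve_apply]
    have : f.repr v ≠ 0 := by simpa using hv
    obtain ⟨i, hi⟩ := Finsupp.ne_iff.1 this
    refine Finset.sum_pos' (fun i _ => ?_) ⟨i, Finset.mem_univ i, ?_⟩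
    · exact mul_nonneg (Real.exp_pos _).le (mul_self_nonneg _)
    · exact mul_pos (Real.exp_pos _) (mul_self_pos.2 hi)

omit [LieGroup (𝓡 d) ∞ G] in
lemma continuous_diagonalCurve (a : Fin (Module.finrank ℝ (GroupLieAlgebra (𝓡 d) G)) → ℝ) :
    Continuous (diagonalCurve f a) := by
  have h : IsTopologicalAddGroup (BilinearForm d G) := inferInstance
  have := h.toContinuousAdd
  exact continuous_finsetSum _ fun i _ =>
    (Real.continuous_exp.comp (continuous_const.mul continuous_id)).smul continuous_const

section
variable (hf : IsOrthon (-killingForm ℝ (GroupLieAlgebra (𝓡 d) G)) f)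
include hf

lemma IsOrthon.diagonalCurve_zero (a : Fin (Module.finrank ℝ (GroupLieAlgebra (𝓡 d) G)) → ℝ) :
    diagonalCurve f a 0 = standardMetric d G := by
  have h : ∀ v w, toForm (diagonalCurve f a 0) v w = toForm (standardMetric d G) v w := by
    intro v w
    rw [diagonalCurve_apply, toForm_standardMetric, ← hf.sum_mul]
    refine Finset.sum_congr rfl fun i _ => ?_
    rw [mul_zero, Real.exp_zero, one_mul, hf.repr, hf.repr']
  ext v w
  exact h v w

lemma IsOrthon.diagonalCurve_mem {a : Fin (Module.finrank ℝ (GroupLieAlgebra (𝓡 d) G)) → ℝ}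
    (ha : ∑ i, a i = 0) (t : ℝ) :
    diagonalCurve f a t ∈ metricsOfVolume (standardMetric d G) := by
  refine hf.mem_metricsOfVolume_iff.2 ⟨isPosSymm_diagonalCurve a t, ?_⟩
  have : gramMatrix (toForm (diagonalCurve f a t)) f =
      Matrix.diagonal fun i => Real.exp (a i * t) := by
    ext i j
    simp only [gramMatrix, Matrix.of_apply, toForm_diagonalCurve_basis, Matrix.diagonal_apply]
  rw [this, Matrix.det_diagonal, ← Real.exp_sum, ← Finset.sum_mul, ha, zero_mul, Real.exp_zero]

lemma IsOrthon.scalarCurvature_diagonalCurve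
    (a : Fin (Module.finrank ℝ (GroupLieAlgebra (𝓡 d) G)) → ℝ) (t : ℝ) :
    scalarCurvature (diagonalCurve f a t) = diagonalScalar f a t := by
  rw [scalarCurvature_eq, hf.lieScalarCurvature_diagonal (fun i => Real.exp_pos (a i * t))
    (toForm_diagonalCurve_basis a t), diagonalScalar]
  congr 1
  · congr 1
    exact Finset.sum_congr rfl fun i _ => by rw [neg_mul, Real.exp_neg]
  · congr 1
    refine Finset.sum_congr rfl fun i _ => Finset.sum_congr rfl fun j _ =>
      Finset.sum_congr rfl fun k _ => ?_
    rw [← Real.exp_add, ← Real.exp_sub]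
    congr 2
    ring

lemma IsOrthon.tendsto_diagonalCurve
    {a : Fin (Module.finrank ℝ (GroupLieAlgebra (𝓡 d) G)) → ℝ} (ha : ∑ i, a i = 0) :
    Filter.Tendsto (diagonalCurve f a) (𝓝 0)
      (𝓝[metricsOfVolume (standardMetric d G)] (standardMetric d G)) := by
  refine tendsto_nhdsWithin_iff.2 ⟨?_, .of_forall fun t => hf.diagonalCurve_mem ha t⟩
  rw [← hf.diagonalCurve_zero a]
  exact (continuous_diagonalCurve a).tendsto 0

lemma IsOrthon.isLocalMin_diagonalScalar
    {a : Fin (Module.finrank ℝ (GroupLieAlgebra (𝓡 d) G)) → ℝ} (ha : ∑ i, a i = 0)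
    (h : IsLocalMinOn scalarCurvature (metricsOfVolume (standardMetric d G))
      (standardMetric d G)) : IsLocalMin (diagonalScalar f a) 0 := by
  have := (hf.tendsto_diagonalCurve ha).eventually h
  simpa only [IsLocalMin, IsMinFilter, ← hf.scalarCurvature_diagonalCurve,
    hf.diagonalCurve_zero] using this

lemma IsOrthon.isLocalMax_diagonalScalar
    {a : Fin (Module.finrank ℝ (GroupLieAlgebra (𝓡 d) G)) → ℝ} (ha : ∑ i, a i = 0)
    (h : IsLocalMaxOn scalarCurvature (metricsOfVolume (standardMetric d G))
      (standardMetric d G)) : IsLocalMax (diagonalScalar f a) 0 := by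
  have := (hf.tendsto_diagonalCurve ha).eventually h
  simpa only [IsLocalMax, IsMaxFilter, ← hf.scalarCurvature_diagonalCurve,
    hf.diagonalCurve_zero] using this
end

end Metrics
-- The standard metric is critical.
section CriticalPoint

/-- A product of a continuous function with a function that vanishes at the point. -/
lemma HasDerivAt.continuousAt_mul {A h : ℝ → ℝ} {h' : ℝ} {x : ℝ} (hA : ContinuousAt A x)
    (hh : HasDerivAt h h' x) (h0 : h x = 0) :
    HasDerivAt (fun t => A t * h t) (A x * h') x := by
  rw [hasDerivAt_iff_tendsto_slope] at hh ⊢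
  refine ((hA.tendsto.mono_left nhdsWithin_le_nhds).mul hh).congr fun t => ?_
  simp only [slope_def_field, h0]
  ring

lemma sum_one_apply_mul {ι : Type*} [Fintype ι] [DecidableEq ι] (i : ι) (F : ι → ℝ) :
    ∑ j, (1 : Matrix ι ι ℝ) i j * F j = F i := by
  simp [Matrix.one_apply]

/-- With determinant one the inverse is the adjugate, hence continuous. Then `Γ⁻¹ = 1 - Γ⁻¹ (Γ - 1)`
is differentiable at `0`, since `Γ - 1` vanishes there and the other factor need only be continuous.
-/
lemma hasDerivAt_inv_apply {ι : Type*} [Fintype ι] [DecidableEq ι] {Γ : ℝ → Matrix ι ι ℝ}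
    {Γ' : Matrix ι ι ℝ} (h : ∀ i j, HasDerivAt (fun t => Γ t i j) (Γ' i j) 0) (h0 : Γ 0 = 1)
    (hdet : ∀ t, (Γ t).det = 1) (i j : ι) :
    HasDerivAt (fun t => (Γ t)⁻¹ i j) (-Γ' i j) 0 := by
  have hc : ContinuousAt Γ 0 :=
    continuousAt_pi.2 fun i => continuousAt_pi.2 fun j => (h i j).continuousAt
  have hinv : ∀ t, (Γ t)⁻¹ = (Γ t).adjugate := fun t => by
    rw [Matrix.inv_def, hdet, Ring.inverse_one, one_smul]
  have hci : ∀ i j, ContinuousAt (fun t => (Γ t)⁻¹ i j) 0 := fun i j => by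
    simp only [hinv]
    have h1 : Continuous fun M : Matrix ι ι ℝ => M.adjugate i j :=
      (continuous_id.matrix_adjugate).matrix_elem i j
    exact h1.continuousAt.comp hc
  have heq : ∀ t, (Γ t)⁻¹ i j = (1 : Matrix ι ι ℝ) i j -
      ∑ k, (Γ t)⁻¹ i k * (Γ t k j - (1 : Matrix ι ι ℝ) k j) := fun t => by
    have h1 : (Γ t)⁻¹ = 1 - (Γ t)⁻¹ * (Γ t - 1) := by
      rw [mul_sub, Matrix.nonsing_inv_mul _ (by simp [hdet]), mul_one]; abel
    conv_lhs => rw [h1]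
    simp [Matrix.mul_apply]
  have hd : ∀ k, HasDerivAt (fun t => (Γ t)⁻¹ i k * (Γ t k j - (1 : Matrix ι ι ℝ) k j))
      ((Γ 0)⁻¹ i k * Γ' k j) 0 := fun k =>
    HasDerivAt.continuousAt_mul (hci i k) ((h k j).sub_const _) (by rw [h0, sub_self])
  have := (HasDerivAt.fun_sum fun k (_ : k ∈ Finset.univ) => hd k).const_sub
    ((1 : Matrix ι ι ℝ) i j)
  simp only [← heq] at this
  refine this.congr_deriv ?_
  simp only [h0, inv_one, Matrix.one_apply]
  simp

/-- AM-GM for the eigenvalues, obtained by summing `log x ≤ x - 1`. -/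
lemma card_le_trace_of_det_eq_one {ι : Type*} [Fintype ι] [DecidableEq ι] {M : Matrix ι ι ℝ}
    (hM : M.PosDef) (hdet : M.det = 1) : (Fintype.card ι : ℝ) ≤ M.trace := by
  have h1 : ∀ i, 0 < hM.isHermitian.eigenvalues i := hM.eigenvalues_pos
  have h2 : ∏ i, hM.isHermitian.eigenvalues i = 1 := by
    have := hM.isHermitian.det_eq_prod_eigenvalues
    rw [hdet] at this
    exact_mod_cast this.symm
  have h3 : M.trace = ∑ i, hM.isHermitian.eigenvalues i := by
    have := hM.isHermitian.trace_eq_sum_eigenvalues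
    exact_mod_cast this
  have h4 : ∑ i, Real.log (hM.isHermitian.eigenvalues i) = 0 := by
    rw [← Real.log_prod (fun i _ => (h1 i).ne'), h2, Real.log_one]
  have h5 : ∑ i, Real.log (hM.isHermitian.eigenvalues i) ≤
      ∑ i, (hM.isHermitian.eigenvalues i - 1) :=
    Finset.sum_le_sum fun i _ => Real.log_le_sub_one_of_pos (h1 i)
  rw [h4, Finset.sum_sub_distrib] at h5
  simp at h5
  rw [h3]
  linarith

lemma IsPosSymm.posDef_gramMatrix {L : Type*} [LieRing L] [LieAlgebra ℝ L] {ι : Type*} [Fintype ι]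
    [DecidableEq ι] {Q : LinearMap.BilinForm ℝ L} (hQ : IsPosSymm Q) (f : Module.Basis ι ℝ L) :
    (gramMatrix Q f).PosDef := by
  refine Matrix.PosDef.of_dotProduct_mulVec_pos ?_ fun x hx => ?_
  · ext i j
    simp [gramMatrix, hQ.1 (f j)]
  · have h1 : star x ⬝ᵥ (gramMatrix Q f).mulVec x = Q (∑ i, x i • f i) (∑ i, x i • f i) := by
      simp only [dotProduct, Matrix.mulVec, gramMatrix, Matrix.of_apply, map_sum,
        LinearMap.sum_apply, map_smul, LinearMap.smul_apply, smul_eq_mul, Finset.mul_sum]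
      rw [Finset.sum_comm]
      simp
      refine Finset.sum_congr rfl fun i _ => Finset.sum_congr rfl fun j _ => ?_
      ring
    rw [h1]
    refine hQ.2 _ fun h0 => hx ?_
    funext i
    exact Fintype.linearIndependent_iff.1 f.linearIndependent x h0 i

section
variable {L : Type*} [LieRing L] [LieAlgebra ℝ L] {ι : Type*} [Fintype ι] [DecidableEq ι]
  {f : Module.Basis ι ℝ L} (hf : IsOrthon (-killingForm ℝ L) f)
include hf

/-- Expand both brackets in the basis; contracting two pairs of structure constants gives the
identity matrix. With the next two lemmas it turns every term of the first variation into a trace.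
-/
lemma IsOrthon.sum_bilin_lie_lie (P : LinearMap.BilinForm ℝ L) :
    ∑ i, ∑ k, P ⁅f i, f k⁆ ⁅f i, f k⁆ = ∑ i, P (f i) (f i) := by
  have h1 : ∀ i k, P ⁅f i, f k⁆ ⁅f i, f k⁆ = ∑ m, ∑ n, structConst f m i k * structConst f n i k *
      P (f m) (f n) := fun i k => by
    have h2 : ⁅f i, f k⁆ = ∑ m, structConst f m i k • f m := by
      conv_lhs => rw [← hf.sum_smul ⁅f i, f k⁆]
      exact Finset.sum_congr rfl fun m _ => by rw [← structConst_rotate m i k, structConst]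
    rw [h2]
    simp only [map_sum, LinearMap.sum_apply, map_smul, LinearMap.smul_apply, smul_eq_mul,
      Finset.mul_sum]
    rw [Finset.sum_comm]
    exact Finset.sum_congr rfl fun m _ => Finset.sum_congr rfl fun n _ => by ring
  simp only [h1]
  calc _ = ∑ m, ∑ n, (∑ i, ∑ k, structConst f m i k * structConst f n i k) * P (f m) (f n) := by
        simp only [Finset.sum_mul]
        rw [Finset.sum_congr rfl fun i _ => Finset.sum_comm, Finset.sum_comm]
        refine Finset.sum_congr rfl fun m _ => ?_
        rw [Finset.sum_congr rfl fun i _ => Finset.sum_comm, Finset.sum_comm]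
    _ = _ := by
        simp only [hf.sum_structConst_mul]
        simp

lemma IsOrthon.sum_mul_neg_killingForm (P : LinearMap.BilinForm ℝ L) :
    ∑ i, ∑ j, ∑ k, P (f i) (f j) * (-killingForm ℝ L) ⁅f i, f k⁆ ⁅f j, f k⁆ =
      ∑ i, P (f i) (f i) := by
  refine Finset.sum_congr rfl fun i _ => ?_
  have h : ∀ j, (-killingForm ℝ L) (f i) (f j) = if i = j then 1 else 0 := hf i
  simp only [← Finset.mul_sum, hf.sum_lie_lie, h]
  simp

lemma IsOrthon.sum_mul_neg_killingForm' (P : LinearMap.BilinForm ℝ L) :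
    ∑ i, ∑ j, ∑ k, P (f j) (f k) * (-killingForm ℝ L) ⁅f i, f j⁆ ⁅f i, f k⁆ =
      ∑ i, P (f i) (f i) := by
  rw [← hf.sum_mul_neg_killingForm P, Finset.sum_comm]
  refine Finset.sum_congr rfl fun i _ => ?_
  rw [Finset.sum_comm]
  refine Finset.sum_congr rfl fun j _ => Finset.sum_congr rfl fun k _ => ?_
  rw [← lie_skew (f i) (f k), ← lie_skew (f j) (f k), map_neg, map_neg]
  generalize (-killingForm ℝ L) = q
  simp
end

variable {d : ℕ} {G : Type*} [TopologicalSpace G] [ChartedSpace (EuclideanSpace ℝ (Fin d)) G]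
  [Group G] [LieGroup (𝓡 d) ∞ G]

/-- The standard metric is a critical point of the scalar curvature. -/
lemma isCriticalPointOn_standardMetric
    (hK : IsPosSymm (-killingForm ℝ (GroupLieAlgebra (𝓡 d) G))) :
    IsCriticalPointOn scalarCurvature (metricsOfVolume (standardMetric d G))
      (standardMetric d G) := by
  intro γ γ' h0 hmem hd
  obtain ⟨f, -, hf, -⟩ := hK.exists_eigenbasis 0 (by simp)
  have hmem' := fun t => hf.mem_metricsOfVolume_iff.1 (hmem t)
  have hΓ : ∀ i j, HasDerivAt (fun t => gramMatrix (toForm (γ t)) f i j)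
      (gramMatrix (toForm γ') f i j) 0 := fun i j => hd (f i) (f j)
  have hΓ0 : gramMatrix (toForm (γ 0)) f = 1 := by
    rw [h0, toForm_standardMetric, hf.gramMatrix_eq_one]
  have hinv := fun i j => hasDerivAt_inv_apply hΓ hΓ0 (fun t => (hmem' t).2) i j
  -- Under the volume constraint the trace of the Gram matrix is at least the dimension, with
  -- equality at `t = 0`, so its derivative there vanishes.
  have htr : ∑ i, γ' (f i) (f i) = 0 := by
    have h1 : HasDerivAt (fun t => (gramMatrix (toForm (γ t)) f).trace) (∑ i, γ' (f i) (f i)) 0 :=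
      HasDerivAt.fun_sum fun i _ => hd (f i) (f i)
    have h2 : IsLocalMin (fun t => (gramMatrix (toForm (γ t)) f).trace) 0 := by
      refine .of_forall fun t => ?_
      simp only [hΓ0, Matrix.trace_one]
      exact card_le_trace_of_det_eq_one ((hmem' t).1.posDef_gramMatrix f) (hmem' t).2
    exact h2.hasDerivAt_eq_zero h1
  have hS : (fun t => scalarCurvature (γ t)) = fun t =>
      1 / 2 * ∑ i, (gramMatrix (toForm (γ t)) f)⁻¹ i i -
      1 / 4 * ∑ i, ∑ j, ∑ k, ∑ l, (gramMatrix (toForm (γ t)) f)⁻¹ i j *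
        ((gramMatrix (toForm (γ t)) f)⁻¹ k l * γ t ⁅f i, f k⁆ ⁅f j, f l⁆) := funext fun t => by
    rw [scalarCurvature_eq, hf.lieScalarCurvature_gramMatrix (hmem' t).1]
    rfl
  rw [hS]
  have hder := ((HasDerivAt.fun_sum fun i (_ : i ∈ Finset.univ) => hinv i i).const_mul (1 / 2)).sub
    ((HasDerivAt.fun_sum fun i (_ : i ∈ Finset.univ) => HasDerivAt.fun_sum fun j
      (_ : j ∈ Finset.univ) => HasDerivAt.fun_sum fun k (_ : k ∈ Finset.univ) =>
      HasDerivAt.fun_sum fun l (_ : l ∈ Finset.univ) =>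
      (hinv i j).mul ((hinv k l).mul (hd ⁅f i, f k⁆ ⁅f j, f l⁆))).const_mul (1 / 4))
  refine hder.congr_deriv ?_
  have hγ0 : ∀ v w, γ 0 v w = (-killingForm ℝ (GroupLieAlgebra (𝓡 d) G)) v w := fun v w => by
    rw [h0]; rfl
  have e0 := hf.sum_mul_neg_killingForm (toForm γ')
  have e0' := hf.sum_mul_neg_killingForm' (toForm γ')
  have e3 := hf.sum_bilin_lie_lie (toForm γ')
  have htr' : ∑ i, toForm γ' (f i) (f i) = 0 := htr
  rw [htr'] at e0 e0' e3
  have hg : ∀ i j, gramMatrix (toForm γ') f i j = toForm γ' (f i) (f j) := fun _ _ => rfl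
  simp only [Pi.mul_apply, hΓ0, inv_one, hγ0, hg]
  -- The three product-rule terms `e1`, `e2`, `e4` are each, up to sign, the trace of `γ'`.
  have e1 : ∑ i, ∑ j, ∑ k, ∑ l, -toForm γ' (f i) (f j) * ((1 : Matrix _ _ ℝ) k l *
      (-killingForm ℝ (GroupLieAlgebra (𝓡 d) G)) ⁅f i, f k⁆ ⁅f j, f l⁆) = 0 := by
    rw [← neg_zero, ← e0]
    simp only [Matrix.one_apply, ite_mul, one_mul, zero_mul, mul_ite, mul_zero,
      Finset.sum_ite_eq, Finset.mem_univ, if_true, neg_mul, Finset.sum_neg_distrib]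
  have e2 : ∑ i, ∑ j, ∑ k, ∑ l, (1 : Matrix _ _ ℝ) i j * (-toForm γ' (f k) (f l) *
      (-killingForm ℝ (GroupLieAlgebra (𝓡 d) G)) ⁅f i, f k⁆ ⁅f j, f l⁆) = 0 := by
    rw [← neg_zero, ← e0']
    simp only [← Finset.mul_sum, sum_one_apply_mul, neg_mul, Finset.sum_neg_distrib]
  have e4 : ∑ i, ∑ j, ∑ k, ∑ l, (1 : Matrix _ _ ℝ) i j * ((1 : Matrix _ _ ℝ) k l *
      γ' ⁅f i, f k⁆ ⁅f j, f l⁆) = 0 := by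
    refine Eq.trans ?_ e3
    simp only [← Finset.mul_sum, sum_one_apply_mul, toForm_apply]
  simp only [mul_add, Finset.sum_add_distrib]
  rw [e1, e2, e4]
  simp only [Finset.sum_neg_distrib, htr']
  simp

end CriticalPoint
-- Rescaling a proper ideal.
section Ideals

variable {L : Type*} [LieRing L] [LieAlgebra ℝ L]

lemma exists_structConst_ne_zero {ι : Type*} [Fintype ι] [DecidableEq ι] {f : Module.Basis ι ℝ L}
    (hf : IsOrthon (-killingForm ℝ L) f) (i : ι) : ∃ j k, structConst f i j k ≠ 0 := by
  by_contra! h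
  have := hf.sum_structConst_sq i
  simp [h] at this

/-- The nonabelian clause in the definition of simplicity is automatic, because every row of
structure constants has norm one. -/
lemma exists_ideal_of_not_isSimple [FiniteDimensional ℝ L] [Nontrivial L]
    (hK : IsPosSymm (-killingForm ℝ L)) (hs : ¬ LieAlgebra.IsSimple ℝ L) :
    ∃ I : LieIdeal ℝ L, I ≠ ⊥ ∧ I ≠ ⊤ := by
  by_contra! h
  refine hs ⟨fun I => or_iff_not_imp_left.2 (h I), fun hab => ?_⟩
  obtain ⟨f, -, hf, -⟩ := hK.exists_eigenbasis 0 (by simp)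
  obtain ⟨j, k, hc⟩ := exists_structConst_ne_zero hf ⟨0, Module.finrank_pos⟩
  refine hc ?_
  rw [structConst, trivial_lie_zero, map_zero, LinearMap.zero_apply]

/-- The orthogonal projection onto a subspace. -/
lemma IsPosSymm.exists_projection {V : Type*} [AddCommGroup V] [Module ℝ V] [FiniteDimensional ℝ V]
    {Q : LinearMap.BilinForm ℝ V} (hQ : IsPosSymm Q) (I : Submodule ℝ V) :
    ∃ T : V →ₗ[ℝ] V, (∀ v, T v ∈ I) ∧ (∀ v ∈ I, T v = v) ∧ ∀ v, ∀ w ∈ I, Q (v - T v) w = 0 := by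
  have hr : Q.IsRefl := fun v w h => by rw [hQ.1, h]
  have hd : Disjoint I (Q.orthogonal I) := by
    rw [Submodule.disjoint_def]
    intro v hv hv'
    exact hQ.eq_zero (hv' v hv)
  have hc : IsCompl I (Q.orthogonal I) :=
    (LinearMap.BilinForm.isCompl_orthogonal_iff_disjoint hr).2 hd
  refine ⟨I.projection _ hc, fun v => Submodule.projection_apply_mem hc v,
    fun v hv => Submodule.projection_apply_of_mem_left hc hv, fun v w hw => ?_⟩
  rw [hQ.1]
  exact Submodule.sub_projection_mem hc v w hw

/-- If the Lie algebra is not simple, the standard metric can be increased by rescaling an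
ideal. -/
lemma IsPosSymm.exists_not_isLocalMax_of_ideal [FiniteDimensional ℝ L]
    (hK : IsPosSymm (-killingForm ℝ L)) (I : LieIdeal ℝ L) (h0 : I ≠ ⊥) (h1 : I ≠ ⊤) :
    ∃ (f : Module.Basis (Fin (Module.finrank ℝ L)) ℝ L) (a : Fin (Module.finrank ℝ L) → ℝ),
      IsOrthon (-killingForm ℝ L) f ∧ ∑ i, a i = 0 ∧ ¬ IsLocalMax (diagonalScalar f a) 0 := by
  obtain ⟨T, hTI, hT1, hT⟩ := hK.exists_projection I.toSubmodule
  have hsymm : ∀ v w, (-killingForm ℝ L) (T v) w = (-killingForm ℝ L) v (T w) := fun v w => by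
    have e1 := hT v (T w) (hTI w)
    have e2 := hT w (T v) (hTI v)
    rw [map_sub, LinearMap.sub_apply, sub_eq_zero] at e1 e2
    rw [e1, neg_killingForm_comm, e2, neg_killingForm_comm]
  obtain ⟨f, μ, hf, hμ⟩ := hK.exists_eigenbasis T hsymm
  have hcase : ∀ i, μ i = 0 ∨ μ i = 1 := fun i => by
    have h2 : μ i • (μ i - 1) • f i = 0 := by
      have := hT1 _ (hTI (f i))
      rw [hμ, map_smul, hμ] at this
      rw [sub_smul, smul_sub, this, one_smul, sub_self]
    rcases smul_eq_zero.1 h2 with h | h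
    · exact .inl h
    · exact .inr (sub_eq_zero.1 ((smul_eq_zero.1 h).resolve_right (f.ne_zero i)))
  have hmem : ∀ i, μ i = 1 → f i ∈ I := fun i hi => by
    have := hTI (f i)
    rwa [hμ, hi, one_smul] at this
  have horth : ∀ i, μ i = 0 → ∀ w ∈ I, (-killingForm ℝ L) (f i) w = 0 := fun i hi w hw => by
    have := hT (f i) w hw
    rwa [hμ, hi, zero_smul, sub_zero] at this
  -- A basis vector orthogonal to `I` pairs to zero with any bracket involving an element of `I`, so
  -- structure constants that mix the ideal with its complement vanish.
  have hc : ∀ i j k, structConst f i j k ≠ 0 → μ i = μ j := by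
    intro i j k hne
    rcases hcase i with hi | hi <;> rcases hcase j with hj | hj
    · rw [hi, hj]
    · refine absurd ?_ hne
      rw [structConst, neg_killingForm_lie]
      exact horth i hi _ (lie_mem_left ℝ L I _ _ (hmem j hj))
    · refine absurd ?_ hne
      rw [← structConst_rotate, structConst, neg_killingForm_lie]
      exact horth j hj _ (lie_mem_right ℝ L I _ _ (hmem i hi))
    · rw [hi, hj]
  set n : ℝ := ((Module.finrank ℝ L : ℕ) : ℝ) with n_def
  -- The eigenvalues of the projection minus their mean, multiplied by `n` to avoid a division.
  have hn : ∑ i, (n * μ i - ∑ j, μ j) = 0 := by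
    simp only [Finset.sum_sub_distrib, ← Finset.mul_sum, Finset.sum_const, Finset.card_univ,
      Fintype.card_fin, nsmul_eq_mul]
    exact sub_self _
  refine ⟨f, fun i => n * μ i - ∑ j, μ j, hf, hn,
    hf.not_isLocalMax_diagonalScalar hn (fun hz => ?_)
    fun i j k h => by rw [hc i j k h]⟩
  have hn0 : n ≠ 0 := by
    intro h
    have : Subsingleton L := Module.finrank_zero_iff (R := ℝ).1 (Nat.cast_eq_zero.1 h)
    exact h0 (Subsingleton.elim _ _)
  have hconst : ∀ i j, μ i = μ j := fun i j => by
    have e1 := congrFun hz i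
    have e2 := congrFun hz j
    simp only [Pi.zero_apply] at e1 e2
    exact mul_left_cancel₀ hn0 (by linarith)
  have hpos : 0 < Module.finrank ℝ L := Nat.pos_of_ne_zero fun h => hn0 (by simp [n_def, h])
  rcases hcase ⟨0, hpos⟩ with h | h
  · refine h0 ((LieSubmodule.eq_bot_iff I).2 fun v hv => ?_)
    have hT0 : T = 0 := f.ext fun i => by rw [hμ, hconst i ⟨0, hpos⟩, h, zero_smul]; rfl
    rw [← hT1 v hv, hT0, LinearMap.zero_apply]
  · refine h1 (eq_top_iff.2 fun v _ => ?_)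
    have hT0 : T = LinearMap.id := f.ext fun i => by
      rw [hμ, hconst i ⟨0, hpos⟩, h, one_smul]; rfl
    have := hTI v
    rwa [hT0] at this

end Ideals

/-! ### Absence of local minima, and the criterion for saddle points. -/

section Saddle

variable {d : ℕ} {G : Type*} [TopologicalSpace G] [ChartedSpace (EuclideanSpace ℝ (Fin d)) G]
  [Group G] [LieGroup (𝓡 d) ∞ G]

lemma not_isLocalMinOn_standardMetric [Nontrivial (GroupLieAlgebra (𝓡 d) G)]
    (hK : IsPosSymm (-killingForm ℝ (GroupLieAlgebra (𝓡 d) G))) :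
    ¬ IsLocalMinOn scalarCurvature (metricsOfVolume (standardMetric d G))
      (standardMetric d G) := by
  obtain ⟨f, -, hf, -⟩ := hK.exists_eigenbasis 0 (by simp)
  obtain ⟨j, k, hc⟩ := exists_structConst_ne_zero hf ⟨0, Module.finrank_pos⟩
  have hne : (⟨0, Module.finrank_pos⟩ : Fin (Module.finrank ℝ (GroupLieAlgebra (𝓡 d) G))) ≠ j := by
    rintro rfl
    exact hc (structConst_self _ _)
  exact fun h => hf.not_isLocalMin_diagonalScalar hne (hf.isLocalMin_diagonalScalar (by simp) h)

lemma standardMetric_mem (hK : IsPosSymm (-killingForm ℝ (GroupLieAlgebra (𝓡 d) G))) :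
    standardMetric d G ∈ metricsOfVolume (standardMetric d G) := by
  exact ⟨hK, rfl⟩

/-- The standard metric is a saddle point if some diagonal deformation increases the scalar
curvature. -/
lemma isSaddlePointOn_standardMetric [Nontrivial (GroupLieAlgebra (𝓡 d) G)]
    (hK : IsPosSymm (-killingForm ℝ (GroupLieAlgebra (𝓡 d) G)))
    (h : ∃ (f : Module.Basis (Fin (Module.finrank ℝ (GroupLieAlgebra (𝓡 d) G))) ℝ
        (GroupLieAlgebra (𝓡 d) G)) (a : Fin (Module.finrank ℝ (GroupLieAlgebra (𝓡 d) G)) → ℝ),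
      IsOrthon (-killingForm ℝ (GroupLieAlgebra (𝓡 d) G)) f ∧ ∑ i, a i = 0 ∧
        ¬ IsLocalMax (diagonalScalar f a) 0) :
    IsSaddlePointOn scalarCurvature (metricsOfVolume (standardMetric d G))
      (standardMetric d G) := by
  obtain ⟨f, a, hf, ha, hmax⟩ := h
  exact ⟨standardMetric_mem hK, isCriticalPointOn_standardMetric hK,
    not_isLocalMinOn_standardMetric hK, fun h => hmax (hf.isLocalMax_diagonalScalar ha h)⟩

end Saddle
-- Scalar curvature under block rescalings.
section Blocks

variable {L : Type*} [LieRing L] [LieAlgebra ℝ L] {ι : Type*} [Fintype ι] [DecidableEq ι]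
  {f : Module.Basis ι ℝ L} {ℓ : ι → Fin 3}

variable (f ℓ) in
/-- The sum of the squares of the structure constants with indices in given blocks. -/
def blockSum (r s u : Fin 3) : ℝ :=
  ∑ x : ι × ι × ι with (ℓ x.1, ℓ x.2.1, ℓ x.2.2) = (r, s, u), structConst f x.1 x.2.1 x.2.2 ^ 2

omit [DecidableEq ι] in
lemma sum_structConst_blocks (φ : Fin 3 → Fin 3 → Fin 3 → ℝ) :
    ∑ i, ∑ j, ∑ k, structConst f i j k ^ 2 * φ (ℓ i) (ℓ j) (ℓ k) =
      ∑ r, ∑ s, ∑ u, blockSum f ℓ r s u * φ r s u := by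
  have h1 : ∀ F : ι → ι → ι → ℝ, ∑ i, ∑ j, ∑ k, F i j k =
      ∑ x : ι × ι × ι, F x.1 x.2.1 x.2.2 := fun F => by simp only [Fintype.sum_prod_type]
  have h2 : ∀ F : Fin 3 → Fin 3 → Fin 3 → ℝ, ∑ i, ∑ j, ∑ k, F i j k =
      ∑ x : Fin 3 × Fin 3 × Fin 3, F x.1 x.2.1 x.2.2 := fun F => by
    simp only [Fintype.sum_prod_type]
  rw [h1, h2, ← Finset.sum_fiberwise Finset.univ
    fun x : ι × ι × ι => (ℓ x.1, ℓ x.2.1, ℓ x.2.2)]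
  refine Finset.sum_congr rfl fun y _ => ?_
  rw [blockSum, Finset.sum_mul]
  refine Finset.sum_congr rfl fun x hx => ?_
  simp only [Finset.mem_filter, Prod.mk.injEq] at hx
  rw [hx.2.1, hx.2.2.1, hx.2.2.2]

omit [DecidableEq ι] in
lemma blockSum_swap (r s u : Fin 3) : blockSum f ℓ s r u = blockSum f ℓ r s u := by
  refine Finset.sum_nbij' (fun x => (x.2.1, x.1, x.2.2)) (fun x => (x.2.1, x.1, x.2.2))
    ?_ ?_ ?_ ?_ ?_ <;> simp +contextual
  intro i j k _ _ _
  rw [structConst_swap, neg_sq]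

omit [DecidableEq ι] in
lemma blockSum_rotate (r s u : Fin 3) : blockSum f ℓ s u r = blockSum f ℓ r s u := by
  refine Finset.sum_nbij' (fun x => (x.2.2, x.1, x.2.1)) (fun x => (x.2.1, x.2.2, x.1))
    ?_ ?_ ?_ ?_ ?_ <;> simp +contextual
  intro i j k _ _ _
  rw [structConst_rotate]

omit [DecidableEq ι] in
lemma blockSum_eq_zero {r s u : Fin 3}
    (h : ∀ i j k, ℓ i = r → ℓ j = s → ℓ k = u → structConst f i j k = 0) :
    blockSum f ℓ r s u = 0 := by
  refine Finset.sum_eq_zero fun x hx => ?_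
  simp only [Finset.mem_filter, Prod.mk.injEq] at hx
  rw [h _ _ _ hx.2.1 hx.2.2.1 hx.2.2.2]
  simp

/-- The hypotheses leave four block sums up to permutation: `C 0 0 0`, `C 1 1 1`, `C 0 2 2`, `C 1 2
2`. Normalization gives `D 0 = C 0 0 0 + C 0 2 2`, `D 1 = C 1 1 1 + C 1 2 2` and `D 2 = 2 (C 0 2 2 +
C 1 2 2)`. With `A = C 1 1 1` all four are determined. -/
lemma IsOrthon.diagonalScalar_blocks (hf : IsOrthon (-killingForm ℝ L) f)
    (h01 : ∀ i j k, ℓ i = 0 → ℓ j = 1 → structConst f i j k = 0)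
    (h00 : ∀ i j k, ℓ i = 0 → ℓ j = 0 → ℓ k = 2 → structConst f i j k = 0)
    (h11 : ∀ i j k, ℓ i = 1 → ℓ j = 1 → ℓ k = 2 → structConst f i j k = 0)
    (h22 : ∀ i j k, ℓ i = 2 → ℓ j = 2 → ℓ k = 2 → structConst f i j k = 0)
    {D : Fin 3 → ℝ} (hD : ∀ r, ∑ i, (if ℓ i = r then (1 : ℝ) else 0) = D r) {A : ℝ}
    (hA : ∑ i, ∑ j, (if ℓ i = 1 ∧ ℓ j = 1 then (-killingForm ℝ L) ⁅f i, f j⁆ ⁅f i, f j⁆ else 0) = A)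
    (α : Fin 3 → ℝ) (t : ℝ) :
    4 * diagonalScalar f (fun i => α (ℓ i)) t =
      (D 0 - D 2 / 2 + (D 1 - A)) * Real.exp (-α 0 * t) + A * Real.exp (-α 1 * t)
      + 2 * D 2 * Real.exp (-α 2 * t)
      - (D 2 / 2 - (D 1 - A)) * Real.exp ((α 0 - α 2 - α 2) * t)
      - (D 1 - A) * Real.exp ((α 1 - α 2 - α 2) * t) := by
  set C := blockSum f ℓ with hC
  have perm : ∀ r s u x, C r s u = x → C s u r = x ∧ C u r s = x ∧ C s r u = x ∧ C r u s = x ∧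
      C u s r = x := fun r s u x h => by
    refine ⟨?_, ?_, ?_, ?_, ?_⟩
    · rw [hC, blockSum_rotate, ← h]
    · rw [hC, blockSum_rotate, blockSum_rotate, ← h]
    · rw [hC, blockSum_swap, ← h]
    · rw [hC, blockSum_swap, blockSum_rotate, blockSum_rotate, ← h]
    · rw [hC, blockSum_swap, blockSum_rotate, ← h]
  have z010 : C 0 1 0 = 0 := blockSum_eq_zero fun i j k hi hj _ => h01 i j k hi hj
  have z011 : C 0 1 1 = 0 := blockSum_eq_zero fun i j k hi hj _ => h01 i j k hi hj
  have z012 : C 0 1 2 = 0 := blockSum_eq_zero fun i j k hi hj _ => h01 i j k hi hj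
  have z002 : C 0 0 2 = 0 := blockSum_eq_zero h00
  have z112 : C 1 1 2 = 0 := blockSum_eq_zero h11
  have z222 : C 2 2 2 = 0 := blockSum_eq_zero h22
  have p010 := perm _ _ _ _ z010
  have p011 := perm _ _ _ _ z011
  have p012 := perm _ _ _ _ z012
  have p002 := perm _ _ _ _ z002
  have p112 := perm _ _ _ _ z112
  have p022 := perm 0 2 2 _ rfl
  have p122 := perm 1 2 2 _ rfl
  have key : ∀ φ : Fin 3 → Fin 3 → Fin 3 → ℝ,
      ∑ i, ∑ j, ∑ k, structConst f i j k ^ 2 * φ (ℓ i) (ℓ j) (ℓ k) =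
      C 0 0 0 * φ 0 0 0 + C 1 1 1 * φ 1 1 1 + C 0 2 2 * (φ 0 2 2 + φ 2 0 2 + φ 2 2 0) +
        C 1 2 2 * (φ 1 2 2 + φ 2 1 2 + φ 2 2 1) := fun φ => by
    rw [sum_structConst_blocks, ← hC]
    simp only [Fin.sum_univ_three]
    rw [z010, z011, z012, z002, z112, z222, p010.1, p010.2.1, p011.1, p011.2.1, p012.1, p012.2.1,
      p012.2.2.1, p012.2.2.2.1, p012.2.2.2.2, p002.1, p002.2.1, p112.1, p112.2.1, p022.1, p022.2.1,
      p122.1, p122.2.1]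
    ring
  have hD' : ∀ r, D r = ∑ i, ∑ j, ∑ k, structConst f i j k ^ 2 * (if ℓ i = r then 1 else 0) :=
    fun r => by rw [hf.sum_structConst_left fun i => if ℓ i = r then 1 else 0, hD]
  have e0 : D 0 = C 0 0 0 + C 0 2 2 := by
    rw [hD', key fun r _ _ => if r = 0 then 1 else 0]; simp
  have e1 : D 1 = C 1 1 1 + C 1 2 2 := by
    rw [hD', key fun r _ _ => if r = 1 then 1 else 0]; simp
  have e2 : D 2 = 2 * (C 0 2 2 + C 1 2 2) := by
    rw [hD', key fun r _ _ => if r = 2 then 1 else 0]; simp; ring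
  have eA : A = C 1 1 1 := by
    rw [← hA]
    have := key fun r s _ => if r = 1 ∧ s = 1 then 1 else 0
    simp only [Fin.isValue, and_self, ite_true] at this
    refine Eq.trans ?_ (this.trans (by simp))
    refine Finset.sum_congr rfl fun i _ => Finset.sum_congr rfl fun j _ => ?_
    split_ifs
    · rw [← hf.sum_mul]
      refine Finset.sum_congr rfl fun k _ => ?_
      rw [neg_killingForm_comm (f k), mul_one, sq]
      rfl
    · simp
  have h4 : 4 * diagonalScalar f (fun i => α (ℓ i)) t = ∑ i, ∑ j, ∑ k, structConst f i j k ^ 2 *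
      (2 * Real.exp (-α (ℓ i) * t) - Real.exp ((α (ℓ k) - α (ℓ i) - α (ℓ j)) * t)) := by
    rw [diagonalScalar, ← hf.sum_structConst_left fun i => Real.exp (-α (ℓ i) * t), mul_sub,
      ← mul_assoc, ← mul_assoc]
    simp only [Finset.mul_sum, ← Finset.sum_sub_distrib]
    refine Finset.sum_congr rfl fun i _ => Finset.sum_congr rfl fun j _ =>
      Finset.sum_congr rfl fun k _ => ?_
    ring
  rw [h4, key fun r s u => 2 * Real.exp (-α r * t) - Real.exp ((α u - α r - α s) * t), e0, e1, e2, eA]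
  have s1 : ∀ x y : ℝ, x - x - y = - y := fun x y => by ring
  have s2 : ∀ x y : ℝ, x - y - x = - y := fun x y => by ring
  simp only [s1, s2]
  ring

/-- An orthonormal basis adapted to the eigenspaces of a self-adjoint operator. -/
lemma IsPosSymm.exists_block_basis {V : Type*} [AddCommGroup V] [Module ℝ V]
    [FiniteDimensional ℝ V] {Q : LinearMap.BilinForm ℝ V} (hQ : IsPosSymm Q) (T : V →ₗ[ℝ] V)
    (hT : ∀ v w, Q (T v) w = Q v (T w)) {κ : Type*} [Fintype κ] [DecidableEq κ] (μ : κ → ℝ)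
    (hμ : Function.Injective μ) (W : κ → Submodule ℝ V) (hW : ∀ r, ∀ v ∈ W r, T v = μ r • v)
    (hsup : ∀ v, ∃ w : κ → V, (∀ r, w r ∈ W r) ∧ v = ∑ r, w r) :
    ∃ (f : Module.Basis (Fin (Module.finrank ℝ V)) ℝ V) (ℓ : Fin (Module.finrank ℝ V) → κ),
      IsOrthon Q f ∧ (∀ i, f i ∈ W (ℓ i)) ∧
      ∀ r, ∑ i, (if ℓ i = r then (1 : ℝ) else 0) = Module.finrank ℝ (W r) := by
  obtain ⟨f, ν, hf, hν⟩ := hQ.exists_eigenbasis T hT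
  have horth : ∀ r s, r ≠ s → ∀ v ∈ W r, ∀ w ∈ W s, Q v w = 0 := fun r s hrs v hv w hw => by
    have h := hT v w
    rw [hW r v hv, hW s w hw, map_smul, map_smul, LinearMap.smul_apply, smul_eq_mul, smul_eq_mul,
      ← sub_eq_zero, ← sub_mul] at h
    exact (mul_eq_zero.1 h).resolve_left (sub_ne_zero.2 fun h' => hrs (hμ h'))
  -- The components of an eigenvector in the `W r` are mutually orthogonal and must share its
  -- eigenvalue. The `μ r` are distinct, so only one component is nonzero.
  have hlab : ∀ i, ∃ r, f i ∈ W r := fun i => by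
    obtain ⟨w, hw, hfw⟩ := hsup (f i)
    have h1 : ∀ r, (ν i - μ r) * Q (w r) (w r) = 0 := fun r => by
      have h2 : ∑ s, (ν i - μ s) • w s = 0 := by
        have := hν i
        rw [hfw, map_sum, Finset.sum_congr rfl fun s _ => hW s _ (hw s), Finset.smul_sum] at this
        simp only [sub_smul, Finset.sum_sub_distrib, this, sub_self]
      have h3 : Q (∑ s, (ν i - μ s) • w s) (w r) = 0 := by rw [h2, map_zero, LinearMap.zero_apply]
      rw [map_sum, LinearMap.sum_apply, Finset.sum_eq_single r] at h3
      · simpa using h3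
      · intro s _ hsr
        rw [map_smul, LinearMap.smul_apply, horth s r hsr _ (hw s) _ (hw r), smul_zero]
      · simp
    have h4 : ∃ r, w r ≠ 0 := by
      by_contra! h
      exact f.ne_zero i (by rw [hfw]; simp [h])
    obtain ⟨r, hr⟩ := h4
    have h5 : ν i = μ r := sub_eq_zero.1 ((mul_eq_zero.1 (h1 r)).resolve_right (hQ.2 _ hr).ne')
    refine ⟨r, ?_⟩
    rw [hfw, Finset.sum_eq_single r]
    · exact hw r
    · intro s _ hsr
      refine hQ.eq_zero ((mul_eq_zero.1 (h1 s)).resolve_left ?_)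
      rw [h5]
      exact sub_ne_zero.2 fun h => hsr (hμ h.symm)
    · simp
  choose ℓ hℓ using hlab
  refine ⟨f, ℓ, hf, hℓ, fun r => ?_⟩
  have hspan : W r = Submodule.span ℝ (Set.range fun i : {i // ℓ i = r} => f i) := by
    refine le_antisymm (fun v hv => ?_) (Submodule.span_le.2 ?_)
    · rw [← hf.sum_smul v]
      refine Submodule.sum_mem _ fun i _ => ?_
      by_cases hi : ℓ i = r
      · exact Submodule.smul_mem _ _ (Submodule.subset_span ⟨⟨i, hi⟩, rfl⟩)
      · rw [horth r (ℓ i) (Ne.symm hi) v hv _ (hℓ i), zero_smul]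
        exact Submodule.zero_mem _
    · rintro _ ⟨i, rfl⟩
      have := hℓ i
      rwa [i.2] at this
  have hcard := finrank_span_eq_card (f.linearIndependent.comp _
    (Subtype.val_injective (p := fun i => ℓ i = r)))
  rw [Fintype.card_subtype] at hcard
  rw [hspan]
  refine Eq.trans ?_ (congrArg Nat.cast hcard).symm
  simp

/-- The scalar curvature under block-diagonal deformations, if the Lie algebra is the sum of two
commuting subalgebras and a subspace whose brackets lie in these subalgebras. -/
lemma IsPosSymm.exists_diagonalScalar_blocks [FiniteDimensional ℝ L]
    (hK : IsPosSymm (-killingForm ℝ L)) (T : L →ₗ[ℝ] L)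
    (hT : ∀ v w, (-killingForm ℝ L) (T v) w = (-killingForm ℝ L) v (T w)) (μ : Fin 3 → ℝ)
    (hμ : Function.Injective μ) (W : Fin 3 → Submodule ℝ L) (hW : ∀ r, ∀ v ∈ W r, T v = μ r • v)
    (hsup : ∀ v, ∃ w : Fin 3 → L, (∀ r, w r ∈ W r) ∧ v = ∑ r, w r)
    (h01 : ∀ v ∈ W 0, ∀ w ∈ W 1, ⁅v, w⁆ = 0) (h00 : ∀ v ∈ W 0, ∀ w ∈ W 0, ⁅v, w⁆ ∈ W 0)
    (h11 : ∀ v ∈ W 1, ∀ w ∈ W 1, ⁅v, w⁆ ∈ W 1) (h22 : ∀ v ∈ W 2, ∀ w ∈ W 2, ⁅v, w⁆ ∈ W 0 ⊔ W 1) :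
    ∃ (f : Module.Basis (Fin (Module.finrank ℝ L)) ℝ L) (ℓ : Fin (Module.finrank ℝ L) → Fin 3),
      IsOrthon (-killingForm ℝ L) f ∧ (∀ i, f i ∈ W (ℓ i)) ∧
      (∀ r, ∑ i, (if ℓ i = r then (1 : ℝ) else 0) = Module.finrank ℝ (W r)) ∧
      ∀ A : ℝ, ∑ i, ∑ j, (if ℓ i = 1 ∧ ℓ j = 1 then
        (-killingForm ℝ L) ⁅f i, f j⁆ ⁅f i, f j⁆ else 0) = A → ∀ (α : Fin 3 → ℝ) (t : ℝ),
      4 * diagonalScalar f (fun i => α (ℓ i)) t =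
        (Module.finrank ℝ (W 0) - Module.finrank ℝ (W 2) / 2 + (Module.finrank ℝ (W 1) - A)) *
          Real.exp (-α 0 * t) + A * Real.exp (-α 1 * t)
        + 2 * Module.finrank ℝ (W 2) * Real.exp (-α 2 * t)
        - (Module.finrank ℝ (W 2) / 2 - (Module.finrank ℝ (W 1) - A)) *
          Real.exp ((α 0 - α 2 - α 2) * t)
        - (Module.finrank ℝ (W 1) - A) * Real.exp ((α 1 - α 2 - α 2) * t) := by
  obtain ⟨f, ℓ, hf, hℓ, hcard⟩ := hK.exists_block_basis T hT μ hμ W hW hsup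
  have horth : ∀ r s, r ≠ s → ∀ v ∈ W r, ∀ w ∈ W s, (-killingForm ℝ L) v w = 0 :=
    fun r s hrs v hv w hw => by
    have h := hT v w
    rw [hW r v hv, hW s w hw, map_smul, map_smul, LinearMap.smul_apply, smul_eq_mul, smul_eq_mul,
      ← sub_eq_zero, ← sub_mul] at h
    exact (mul_eq_zero.1 h).resolve_left (sub_ne_zero.2 fun h' => hrs (hμ h'))
  refine ⟨f, ℓ, hf, hℓ, hcard, fun A hA α t => ?_⟩
  have hm : ∀ i r, ℓ i = r → f i ∈ W r := fun i r h => h ▸ hℓ i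
  refine hf.diagonalScalar_blocks (D := fun r => Module.finrank ℝ (W r)) (fun i j k hi hj => ?_)
    (fun i j k hi hj hk => ?_) (fun i j k hi hj hk => ?_) (fun i j k hi hj hk => ?_) hcard hA α t
  · rw [structConst, h01 _ (hm i 0 hi) _ (hm j 1 hj), map_zero, LinearMap.zero_apply]
  · exact horth 0 2 (by decide) _ (h00 _ (hm i 0 hi) _ (hm j 0 hj)) _ (hm k 2 hk)
  · exact horth 1 2 (by decide) _ (h11 _ (hm i 1 hi) _ (hm j 1 hj)) _ (hm k 2 hk)
  · obtain ⟨x, hx, y, hy, hxy⟩ := Submodule.mem_sup.1 (h22 _ (hm i 2 hi) _ (hm j 2 hj))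
    rw [structConst, ← hxy, map_add, LinearMap.add_apply, horth 0 2 (by decide) _ hx _ (hm k 2 hk),
      horth 1 2 (by decide) _ hy _ (hm k 2 hk), add_zero]

end Blocks

/-! ### One-variable profiles with no local maximum at zero. -/

lemma not_isLocalMax_of_deriv_neg {F : ℝ → ℝ} (hF : Differentiable ℝ F)
    (h : ∀ t < 0, deriv F t < 0) : ¬ IsLocalMax F 0 := by
  have hanti : StrictAntiOn F (Set.Iic 0) := by
    refine strictAntiOn_of_deriv_neg (convex_Iic 0) hF.continuous.continuousOn fun t ht => h t ?_
    simpa using ht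
  intro hmax
  have h1 : ∀ᶠ t in 𝓝[<] (0 : ℝ), F t ≤ F 0 := hmax.filter_mono nhdsWithin_le_nhds
  obtain ⟨t, ht, ht0⟩ := (h1.and self_mem_nhdsWithin).exists
  exact ht.not_gt (hanti (Set.mem_Iic.2 (le_of_lt ht0)) (Set.mem_Iic.2 le_rfl) ht0)

lemma hasDerivAt_mul_exp (a c t : ℝ) :
    HasDerivAt (fun t => a * Real.exp (c * t)) (a * (c * Real.exp (c * t))) t := by
  have := ((hasDerivAt_id t).const_mul c).exp
  exact HasDerivAt.const_mul a (by simpa [mul_comm] using this)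

/-- The derivative is `-(p (p - 1) / 2) (exp (p t) - exp (-t))²`. It has a double zero at `0`, so
the second derivative test is silent and strict monotonicity on the left takes its place. -/
lemma not_isLocalMax_unitary_profile {F : ℝ → ℝ} {p : ℝ} (hp : 1 < p)
    (hF : ∀ t, 4 * F t = p * (p - 1) * Real.exp (-2 * t) + 4 * p * Real.exp ((p - 1) * t)
      - (p - 1) * Real.exp (2 * p * t) - 1) : ¬ IsLocalMax F 0 := by
  have hd : ∀ t, HasDerivAt F (-(p * (p - 1) / 2) *
      (Real.exp (p * t) - Real.exp (-1 * t)) ^ 2) t := fun t => by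
    have h1 : F = fun t => 1 / 4 * (p * (p - 1) * Real.exp (-2 * t)
        + 4 * p * Real.exp ((p - 1) * t) - (p - 1) * Real.exp (2 * p * t) - 1) := by
      funext t; rw [← hF]; ring
    rw [h1]
    refine (((((hasDerivAt_mul_exp _ _ t).add (hasDerivAt_mul_exp _ _ t)).sub
      (hasDerivAt_mul_exp _ _ t)).sub_const 1).const_mul (1 / 4)).congr_deriv ?_
    have e1 : Real.exp (-2 * t) = Real.exp (-1 * t) ^ 2 := by
      rw [← Real.exp_nat_mul]; congr 1; push_cast; ring
    have e2 : Real.exp (2 * p * t) = Real.exp (p * t) ^ 2 := by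
      rw [← Real.exp_nat_mul]; congr 1; push_cast; ring
    have e3 : Real.exp ((p - 1) * t) = Real.exp (p * t) * Real.exp (-1 * t) := by
      rw [← Real.exp_add]; congr 1; ring
    rw [e1, e2, e3]
    ring
  refine not_isLocalMax_of_deriv_neg (fun t => (hd t).differentiableAt) fun t ht => ?_
  rw [(hd t).deriv]
  have h1 : Real.exp (p * t) < Real.exp (-1 * t) := Real.exp_lt_exp.2 (by nlinarith)
  have h2 : 0 < (Real.exp (p * t) - Real.exp (-1 * t)) ^ 2 :=
    sq_pos_of_ne_zero (sub_ne_zero.2 h1.ne)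
  have h3 : 0 < p * (p - 1) / 2 := by nlinarith
  nlinarith

lemma not_isLocalMax_symplectic_profile {F : ℝ → ℝ} {q : ℝ} (hq : 1 ≤ q)
    (hF : ∀ t, 4 * F t = q * (2 * q - 1) * Real.exp (-2 * t) + 8 * q * Real.exp ((q - 1) * t)
      - (2 * q - 3) * Real.exp (2 * q * t)) : ¬ IsLocalMax F 0 := by
  have hd : ∀ t, HasDerivAt F (-(q / 2) * ((Real.exp (-1 * t) - Real.exp (q * t)) *
      ((2 * q - 1) * Real.exp (-1 * t) - (2 * q - 3) * Real.exp (q * t)))) t := fun t => by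
    have h1 : F = fun t => 1 / 4 * (q * (2 * q - 1) * Real.exp (-2 * t)
        + 8 * q * Real.exp ((q - 1) * t) - (2 * q - 3) * Real.exp (2 * q * t)) := by
      funext t; rw [← hF]; ring
    rw [h1]
    refine ((((hasDerivAt_mul_exp _ _ t).add (hasDerivAt_mul_exp _ _ t)).sub
      (hasDerivAt_mul_exp _ _ t)).const_mul (1 / 4)).congr_deriv ?_
    have e1 : Real.exp (-2 * t) = Real.exp (-1 * t) ^ 2 := by
      rw [← Real.exp_nat_mul]; congr 1; push_cast; ring
    have e2 : Real.exp (2 * q * t) = Real.exp (q * t) ^ 2 := by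
      rw [← Real.exp_nat_mul]; congr 1; push_cast; ring
    have e3 : Real.exp ((q - 1) * t) = Real.exp (q * t) * Real.exp (-1 * t) := by
      rw [← Real.exp_add]; congr 1; ring
    rw [e1, e2, e3]
    ring
  refine not_isLocalMax_of_deriv_neg (fun t => (hd t).differentiableAt) fun t ht => ?_
  rw [(hd t).deriv]
  have h1 : Real.exp (q * t) < Real.exp (-1 * t) := Real.exp_lt_exp.2 (by nlinarith)
  have h0 := Real.exp_pos (q * t)
  -- With `x = exp (-t)` and `y = exp (q t)`, this is `(2 q - 1) (x - y) + 2 y`, positive because `x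
  -- > y > 0`.
  have h2 : 0 < (2 * q - 1) * Real.exp (-1 * t) - (2 * q - 3) * Real.exp (q * t) := by
    nlinarith
  have h3 := mul_pos (sub_pos.2 h1) h2
  nlinarith

/-! ### Block decompositions of unitary and symplectic type. -/

section Abstract

variable {L : Type*} [LieRing L] [LieAlgebra ℝ L] [FiniteDimensional ℝ L]

omit [FiniteDimensional ℝ L] in
lemma neg_killingForm_ad_swap (z v w : L) :
    (-killingForm ℝ L) ⁅z, v⁆ w = -(-killingForm ℝ L) v ⁅z, w⁆ := by
  rw [← neg_killingForm_lie v z w, ← lie_skew v z, map_neg]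
  generalize (-killingForm ℝ L) = q
  simp

omit [FiniteDimensional ℝ L] in
lemma sum_card_blocks {ι κ : Type*} [Fintype ι] [Fintype κ] [DecidableEq κ] (ℓ : ι → κ)
    (α : κ → ℝ) : ∑ i, α (ℓ i) = ∑ r, α r * ∑ i, (if ℓ i = r then (1 : ℝ) else 0) := by
  simp only [Finset.mul_sum]
  rw [Finset.sum_comm]
  simp

omit [FiniteDimensional ℝ L] in
/-- On the brackets of vectors in the `-1`-eigenspace of `(ad z)²`, the operator `(ad z)²` has the
eigenvalues `0` and `-4`. -/
lemma lie_lie_lie_lie_of_sq {z v w : L} (hv : ⁅z, ⁅z, v⁆⁆ = -v) (hw : ⁅z, ⁅z, w⁆⁆ = -w) :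
    ⁅z, ⁅z, ⁅z, ⁅z, ⁅v, w⁆⁆⁆⁆⁆ = -(4 : ℝ) • ⁅z, ⁅z, ⁅v, w⁆⁆⁆ := by
  have h : ∀ x y : L, ⁅z, ⁅x, y⁆⁆ = ⁅⁅z, x⁆, y⁆ + ⁅x, ⁅z, y⁆⁆ := fun x y => leibniz_lie z x y
  have h1 : ⁅z, ⁅z, ⁅v, w⁆⁆⁆ = -(2 : ℝ) • ⁅v, w⁆ + (2 : ℝ) • ⁅⁅z, v⁆, ⁅z, w⁆⁆ := by
    rw [h v w, lie_add, h ⁅z, v⁆ w, h v ⁅z, w⁆, hv, hw, neg_lie, lie_neg]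
    module
  have h2 : ⁅z, ⁅z, ⁅⁅z, v⁆, ⁅z, w⁆⁆⁆⁆ = (2 : ℝ) • ⁅v, w⁆ - (2 : ℝ) • ⁅⁅z, v⁆, ⁅z, w⁆⁆ := by
    rw [h ⁅z, v⁆, hv, hw, lie_add, neg_lie, lie_neg, lie_neg, lie_neg, h v ⁅z, w⁆, h ⁅z, v⁆ w, hv, hw,
      neg_lie, lie_neg]
    module
  rw [h1, lie_add, lie_add, lie_smul, lie_smul, lie_smul, lie_smul, h1, h2]
  module

-- On such a bracket `(ad z)⁴` equals both `-4 (ad z)²` and, by `hD`, `-(ad z)²`. Hence `(ad z)²`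
-- kills it, and so does `ad z = -(ad z)³`.
omit [FiniteDimensional ℝ L] in
lemma lie_lie_eq_zero_of_sq {z v w : L} (hD : ∀ v : L, ⁅z, ⁅z, ⁅z, v⁆⁆⁆ = -⁅z, v⁆)
    (hv : ⁅z, ⁅z, v⁆⁆ = -v) (hw : ⁅z, ⁅z, w⁆⁆ = -w) : ⁅z, ⁅v, w⁆⁆ = 0 := by
  have h := lie_lie_lie_lie_of_sq hv hw
  rw [hD] at h
  have h3 : (3 : ℝ) • ⁅z, ⁅z, ⁅v, w⁆⁆⁆ = 0 := by
    have : (3 : ℝ) • ⁅z, ⁅z, ⁅v, w⁆⁆⁆ = -⁅z, ⁅z, ⁅v, w⁆⁆⁆ - -(4 : ℝ) • ⁅z, ⁅z, ⁅v, w⁆⁆⁆ := by module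
    rw [this, h, sub_self]
  rw [← neg_eq_zero, ← hD, (smul_eq_zero.1 h3).resolve_left (by norm_num), lie_zero]

/-- If an element `z` satisfies `(ad z)³ = - ad z`, its centralizer and the image of `ad z` give a
block decomposition; for the dimensions of `su(p + 1)` the scalar curvature is not maximal. -/
lemma IsPosSymm.exists_not_isLocalMax_of_unitary_type (hK : IsPosSymm (-killingForm ℝ L)) {z : L}
    (hz : z ≠ 0) (hD : ∀ v : L, ⁅z, ⁅z, ⁅z, v⁆⁆⁆ = -⁅z, v⁆) {p : ℕ} (hp : 2 ≤ p)
    (hL : Module.finrank ℝ L = p ^ 2 + 2 * p) {W : Submodule ℝ L}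
    (hW : ∀ v : L, v ∈ W ↔ ⁅z, ⁅z, v⁆⁆ = -v) (hWd : Module.finrank ℝ W = 2 * p) :
    ∃ (f : Module.Basis (Fin (Module.finrank ℝ L)) ℝ L) (a : Fin (Module.finrank ℝ L) → ℝ),
      IsOrthon (-killingForm ℝ L) f ∧ ∑ i, a i = 0 ∧ ¬ IsLocalMax (diagonalScalar f a) 0 := by
  have hsw : ∀ v w : L, (-killingForm ℝ L) ⁅z, v⁆ w = -(-killingForm ℝ L) v ⁅z, w⁆ :=
    neg_killingForm_ad_swap z
  set Q := -killingForm ℝ L with hQ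
  have hcomm : ∀ v w : L, Q v w = Q w v := hK.1
  have hzz : 0 < Q z z := hK.2 z hz
  have hzv : ∀ v : L, Q z ⁅z, v⁆ = 0 := fun v => by
    rw [hcomm, hsw, lie_self, map_zero, neg_zero]
  -- The operator has eigenvalues `0`, `2`, `1` on `W₀`, the line of `z`, and `W`. The rank one term
  -- separates `z` from the rest of its centralizer.
  let T : L →ₗ[ℝ] L := -(LieAlgebra.ad ℝ L z ∘ₗ LieAlgebra.ad ℝ L z) +
    (2 / Q z z) • (Q z).smulRight z
  have hTv : ∀ v : L, T v = -⁅z, ⁅z, v⁆⁆ + (2 / Q z z) • Q z v • z := fun v => rfl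
  let W₀ : Submodule ℝ L := LinearMap.ker (LieAlgebra.ad ℝ L z) ⊓ LinearMap.ker (Q z)
  have hW₀ : ∀ v : L, v ∈ W₀ ↔ ⁅z, v⁆ = 0 ∧ Q z v = 0 := fun v => Iff.rfl
  have hWz : ∀ v ∈ W, Q z v = 0 := fun v hv => by
    rw [← neg_neg v, ← (hW v).1 hv, map_neg, hzv, neg_zero]
  have hsplit : ∀ v : L, ⁅z, v⁆ = 0 → v - (Q z v / Q z z) • z ∈ W₀ := fun v hv => by
    refine (hW₀ _).2 ⟨?_, ?_⟩
    · rw [lie_sub, lie_smul, lie_self, smul_zero, sub_zero, hv]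
    · rw [map_sub, map_smul, smul_eq_mul, div_mul_cancel₀ _ hzz.ne', sub_self]
  obtain ⟨B, hB0, hB1, hB2⟩ : ∃ B : Fin 3 → Submodule ℝ L,
      B 0 = W₀ ∧ B 1 = Submodule.span ℝ {z} ∧ B 2 = W :=
    ⟨![W₀, Submodule.span ℝ {z}, W], rfl, rfl, rfl⟩
  refine Exists.elim (hK.exists_diagonalScalar_blocks T ?_ ![0, 2, 1] ?_
    B ?_ ?_ ?_ ?_ ?_ ?_) ?main
  case main =>
    rintro f ⟨ℓ, hf, hfℓ, hcard, hform⟩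
    have hfW : ∀ i, ℓ i = 1 → f i ∈ Submodule.span ℝ {z} := fun i hi => by
      have := hfℓ i
      rwa [hi, hB1] at this
    have hA : ∑ i, ∑ j, (if ℓ i = 1 ∧ ℓ j = 1 then Q ⁅f i, f j⁆ ⁅f i, f j⁆ else 0) = 0 := by
      refine Finset.sum_eq_zero fun i _ => Finset.sum_eq_zero fun j _ => ?_
      split_ifs with h
      · obtain ⟨a, ha⟩ := Submodule.mem_span_singleton.1 (hfW i h.1)
        obtain ⟨b, hb⟩ := Submodule.mem_span_singleton.1 (hfW j h.2)
        rw [← ha, ← hb, smul_lie, lie_smul, lie_self, smul_zero, smul_zero, map_zero]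
      · rfl
    have hd1 : (Module.finrank ℝ (B 1) : ℝ) = 1 := by
      rw [hB1, finrank_span_singleton hz, Nat.cast_one]
    have hd2 : (Module.finrank ℝ (B 2) : ℝ) = 2 * p := by rw [hB2, hWd]; push_cast; ring
    have htot := sum_card_blocks ℓ fun _ => 1
    simp only [hcard, Fin.sum_univ_three, Finset.sum_const, Finset.card_univ, Fintype.card_fin,
      hL, hd1, hd2, nsmul_eq_mul] at htot
    push_cast at htot
    have hd0 : (Module.finrank ℝ (B 0) : ℝ) = p ^ 2 - 1 := by linarith
    -- `A = 0` because the middle block is abelian. The weights are traceless for the dimensions `p²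
    -- - 1`, `1`, `2p`, and `α 1 - 2 α 2 = 0` makes one exponential constant.
    have hform := hform 0 hA ![2, 2 - 2 * p, 1 - p]
    refine ⟨f, fun i => ![2, 2 - 2 * (p : ℝ), 1 - p] (ℓ i), hf, ?_, ?_⟩
    · rw [sum_card_blocks]
      simp only [hcard, Fin.sum_univ_three, Matrix.cons_val, hd0, hd1, hd2]
      ring
    · refine not_isLocalMax_unitary_profile (p := p) (by exact_mod_cast hp) fun t => ?_
      rw [hform t]
      simp only [Matrix.cons_val, hd0, hd1, hd2]
      have e1 : (2 - (1 - (p : ℝ)) - (1 - p)) * t = 2 * p * t := by ring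
      have e2 : (2 - 2 * (p : ℝ) - (1 - p) - (1 - p)) * t = 0 := by ring
      have e3 : -(1 - (p : ℝ)) * t = (p - 1) * t := by ring
      rw [e1, e2, e3, Real.exp_zero]
      ring
  · intro v w
    change Q (T v) w = Q v (T w)
    have h1 : Q ⁅z, ⁅z, v⁆⁆ w = Q v ⁅z, ⁅z, w⁆⁆ := by rw [hsw, hsw, neg_neg]
    simp only [hTv, map_add, map_neg, map_smul, LinearMap.add_apply, LinearMap.neg_apply,
      LinearMap.smul_apply, smul_eq_mul, h1, hcomm v z]
    ring
  · intro r s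
    fin_cases r <;> fin_cases s <;> simp
  · intro r v hv
    rw [hTv]
    match r with
    | 0 =>
      obtain ⟨h1, h2⟩ := (hW₀ v).1 (hB0 ▸ hv)
      simp [h1, h2]
    | 1 =>
      obtain ⟨a, rfl⟩ := Submodule.mem_span_singleton.1 (hB1 ▸ hv)
      simp [smul_smul]
      congr 1
      field_simp
    | 2 =>
      rw [hB2] at hv
      simp [(hW v).1 hv, hWz v hv]
  · intro v
    -- By `hD`, `-(ad z)²` projects onto `W`; what remains commutes with `z` and is split along `z`.
    refine ⟨![v + ⁅z, ⁅z, v⁆⁆ - (Q z v / Q z z) • z, (Q z v / Q z z) • z, -⁅z, ⁅z, v⁆⁆], ?_, ?_⟩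
    · intro r
      match r with
      | 0 =>
        have := hsplit (v + ⁅z, ⁅z, v⁆⁆) (by rw [lie_add, hD, add_neg_cancel])
        rw [map_add, hzv, add_zero] at this
        exact hB0 ▸ this
      | 1 =>
        exact hB1 ▸ Submodule.smul_mem _ _ (Submodule.mem_span_singleton_self z)
      | 2 =>
        rw [hB2]
        refine (hW _).2 ?_
        simp only [Matrix.cons_val, lie_neg, hD]
    · simp only [Fin.sum_univ_three, Matrix.cons_val]
      abel
  · intro v hv w hw
    rw [hB0] at hv
    rw [hB1] at hw
    obtain ⟨a, rfl⟩ := Submodule.mem_span_singleton.1 hw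
    rw [lie_smul, ← lie_skew, ((hW₀ v).1 hv).1, neg_zero, smul_zero]
  · intro v hv w hw
    rw [hB0] at hv hw ⊢
    refine (hW₀ _).2 ⟨?_, ?_⟩
    · rw [leibniz_lie, ((hW₀ v).1 hv).1, ((hW₀ w).1 hw).1, zero_lie, lie_zero, add_zero]
    · rw [hQ, ← neg_killingForm_lie, ((hW₀ v).1 hv).1, map_zero, LinearMap.zero_apply]
  · intro v hv w hw
    rw [hB1] at hv hw ⊢
    obtain ⟨a, rfl⟩ := Submodule.mem_span_singleton.1 hv
    obtain ⟨b, rfl⟩ := Submodule.mem_span_singleton.1 hw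
    rw [smul_lie, lie_smul, lie_self, smul_zero, smul_zero]
    exact Submodule.zero_mem _
  · intro v hv w hw
    rw [hB2] at hv hw
    rw [hB0, hB1]
    have h := lie_lie_eq_zero_of_sq hD ((hW v).1 hv) ((hW w).1 hw)
    exact Submodule.mem_sup.2 ⟨_, hsplit _ h, _,
      Submodule.smul_mem _ _ (Submodule.mem_span_singleton_self z), sub_add_cancel _ _⟩

/-- If `L` decomposes under a quaternionic triple `z` into trivial, adjoint and fundamental
representations, the adjoint one occurring once, this gives a block decomposition; for the
dimensions of `sp(q + 1)` the scalar curvature is not maximal. -/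
lemma IsPosSymm.exists_not_isLocalMax_of_symplectic_type (hK : IsPosSymm (-killingForm ℝ L))
    {z : Fin 3 → L} (hz : LinearIndependent ℝ z) (h01 : ⁅z 0, z 1⁆ = (2 : ℝ) • z 2)
    (h12 : ⁅z 1, z 2⁆ = (2 : ℝ) • z 0) (h20 : ⁅z 2, z 0⁆ = (2 : ℝ) • z 1) {q : ℕ} (hq : 1 ≤ q)
    (hL : Module.finrank ℝ L = (q + 1) * (2 * q + 3)) {W : Submodule ℝ L}
    (hW : ∀ v : L, v ∈ W ↔ ∀ a, ⁅z a, ⁅z a, v⁆⁆ = -v) (hWd : Module.finrank ℝ W = 4 * q)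
    (hsup : ∀ v : L, ∃ x y w : L, (∀ a, ⁅z a, x⁆ = 0) ∧ y ∈ Submodule.span ℝ (Set.range z) ∧ w ∈ W ∧
      v = x + y + w) :
    ∃ (f : Module.Basis (Fin (Module.finrank ℝ L)) ℝ L) (a : Fin (Module.finrank ℝ L) → ℝ),
      IsOrthon (-killingForm ℝ L) f ∧ ∑ i, a i = 0 ∧ ¬ IsLocalMax (diagonalScalar f a) 0 := by
  have h10 : ⁅z 1, z 0⁆ = -(2 : ℝ) • z 2 := by rw [← lie_skew, h01, neg_smul]
  have h21 : ⁅z 2, z 1⁆ = -(2 : ℝ) • z 0 := by rw [← lie_skew, h12, neg_smul]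
  have h02 : ⁅z 0, z 2⁆ = -(2 : ℝ) • z 1 := by rw [← lie_skew, h20, neg_smul]
  have hsw : ∀ a, ∀ v w : L, (-killingForm ℝ L) ⁅z a, v⁆ w = -(-killingForm ℝ L) v ⁅z a, w⁆ :=
    fun a => neg_killingForm_ad_swap (z a)
  -- The Casimir operator of the triple: `0` on the centralizer, `8` on the span of `z`, `3` on `W`.
  let T : L →ₗ[ℝ] L := -∑ a, (LieAlgebra.ad ℝ L (z a) ∘ₗ LieAlgebra.ad ℝ L (z a))
  have hTv : ∀ v : L, T v = -∑ a, ⁅z a, ⁅z a, v⁆⁆ := fun v => by simp [T, LinearMap.sum_apply]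
  let W₀ : Submodule ℝ L := ⨅ a, LinearMap.ker (LieAlgebra.ad ℝ L (z a))
  have hW₀ : ∀ v : L, v ∈ W₀ ↔ ∀ a, ⁅z a, v⁆ = 0 := fun v => by simp [W₀, Submodule.mem_iInf]
  have hspan : ∀ y ∈ Submodule.span ℝ (Set.range z), ∃ a b c : ℝ,
      y = a • z 0 + b • z 1 + c • z 2 := fun y hy => by
    obtain ⟨c, rfl⟩ := (Submodule.mem_span_range_iff_exists_fun ℝ).1 hy
    exact ⟨c 0, c 1, c 2, Fin.sum_univ_three _⟩
  have hmem : ∀ a b c : ℝ, a • z 0 + b • z 1 + c • z 2 ∈ Submodule.span ℝ (Set.range z) :=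
    fun a b c => by
    have h : ∀ i, z i ∈ Submodule.span ℝ (Set.range z) := fun i => Submodule.subset_span ⟨i, rfl⟩
    exact Submodule.add_mem _ (Submodule.add_mem _ (Submodule.smul_mem _ _ (h 0))
      (Submodule.smul_mem _ _ (h 1))) (Submodule.smul_mem _ _ (h 2))
  obtain ⟨B, hB0, hB1, hB2⟩ : ∃ B : Fin 3 → Submodule ℝ L,
      B 0 = W₀ ∧ B 1 = Submodule.span ℝ (Set.range z) ∧ B 2 = W :=
    ⟨![W₀, Submodule.span ℝ (Set.range z), W], rfl, rfl, rfl⟩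
  refine Exists.elim (hK.exists_diagonalScalar_blocks T ?_ ![0, 8, 3] ?_
    B ?_ ?_ ?_ ?_ ?_ ?_) ?main
  case main =>
    rintro f ⟨ℓ, hf, hfℓ, hcard, hform⟩
    have hd1 : (Module.finrank ℝ (B 1) : ℝ) = 3 := by
      rw [hB1, finrank_span_eq_card hz, Fintype.card_fin]; norm_num
    have hd2 : (Module.finrank ℝ (B 2) : ℝ) = 4 * q := by rw [hB2, hWd]; push_cast; ring
    have htot := sum_card_blocks ℓ fun _ => 1
    simp only [hcard, Fin.sum_univ_three, Finset.sum_const, Finset.card_univ, Fintype.card_fin,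
      hL, hd1, hd2, nsmul_eq_mul] at htot
    push_cast at htot
    have hd0 : (Module.finrank ℝ (B 0) : ℝ) = q * (2 * q + 1) := by linarith
    -- These weights are traceless, and `-α 0 = α 1 - 2 α 2`, `-α 1 = α 0 - 2 α 2`. The exponentials
    -- pair up so that `A` cancels and need not be computed.
    have hform := hform _ rfl ![2, -2 * q, 1 - q]
    refine ⟨f, fun i => ![2, -2 * (q : ℝ), 1 - q] (ℓ i), hf, ?_, ?_⟩
    · rw [sum_card_blocks]
      simp only [hcard, Fin.sum_univ_three, Matrix.cons_val, hd0, hd1, hd2]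
      ring
    · refine not_isLocalMax_symplectic_profile (q := q) (by exact_mod_cast hq) fun t => ?_
      rw [hform t]
      simp only [Matrix.cons_val, hd0, hd1, hd2]
      have e1 : (2 - (1 - (q : ℝ)) - (1 - q)) * t = 2 * q * t := by ring
      have e2 : (-2 * (q : ℝ) - (1 - q) - (1 - q)) * t = -2 * t := by ring
      have e3 : -(1 - (q : ℝ)) * t = (q - 1) * t := by ring
      have e4 : -(-2 * (q : ℝ)) * t = 2 * q * t := by ring
      rw [e1, e2, e3, e4]
      ring
  · intro v w
    have h1 : ∀ a, (-killingForm ℝ L) ⁅z a, ⁅z a, v⁆⁆ w = (-killingForm ℝ L) v ⁅z a, ⁅z a, w⁆⁆ :=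
      fun a => by rw [hsw, hsw, neg_neg]
    generalize (-killingForm ℝ L) = Q at h1 ⊢
    simp only [hTv, map_neg, map_sum, LinearMap.neg_apply, LinearMap.sum_apply, h1]
  · intro r s
    fin_cases r <;> fin_cases s <;> simp
  · intro r v hv
    rw [hTv]
    match r with
    | 0 =>
      have h := (hW₀ v).1 (hB0 ▸ hv)
      simp [h]
    | 1 =>
      obtain ⟨a, b, c, rfl⟩ := hspan _ (hB1 ▸ hv)
      simp only [Fin.sum_univ_three, lie_add, lie_smul, h01, h12, h20, h10, h21, h02, lie_self, lie_zero, smul_zero,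
        Matrix.cons_val]
      module
    | 2 =>
      rw [hB2] at hv
      have h := (hW v).1 hv
      simp only [h, Fin.sum_univ_three, Matrix.cons_val]
      module
  · intro v
    obtain ⟨x, y, w, hx, hy, hw, rfl⟩ := hsup v
    refine ⟨![x, y, w], ?_, by simp only [Fin.sum_univ_three, Matrix.cons_val]⟩
    intro r
    match r with
    | 0 => exact hB0 ▸ (hW₀ x).2 hx
    | 1 => exact hB1 ▸ hy
    | 2 => exact hB2 ▸ hw
  · intro v hv w hw
    rw [hB0] at hv
    obtain ⟨a, b, c, rfl⟩ := hspan _ (hB1 ▸ hw)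
    have h : ∀ i, ⁅v, z i⁆ = 0 := fun i => by rw [← lie_skew, (hW₀ v).1 hv, neg_zero]
    simp only [lie_add, lie_smul, h, smul_zero, add_zero]
  · intro v hv w hw
    rw [hB0] at hv hw ⊢
    refine (hW₀ _).2 fun a => ?_
    rw [leibniz_lie, (hW₀ v).1 hv, (hW₀ w).1 hw, zero_lie, lie_zero, add_zero]
  · intro v hv w hw
    obtain ⟨a, b, c, rfl⟩ := hspan _ (hB1 ▸ hv)
    obtain ⟨a', b', c', rfl⟩ := hspan _ (hB1 ▸ hw)
    rw [hB1]
    convert hmem (2 * (b * c' - c * b')) (2 * (c * a' - a * c')) (2 * (a * b' - b * a')) using 1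
    simp only [lie_add, add_lie, smul_lie, lie_smul, h01, h12, h20, h10, h21, h02, lie_self]
    module
  · intro v hv w hw
    rw [hB2] at hv hw
    rw [hB0, hB1]
    obtain ⟨x, y, u, hx, hy, hu, he⟩ := hsup ⁅v, w⁆
    -- On such brackets `(ad z 0)⁴ + 4 (ad z 0)²` is zero. It also kills `x` and the combination of
    -- the `z i`, and is `-3` on `u`, so `u = 0`.
    have h := lie_lie_lie_lie_of_sq ((hW v).1 hv 0) ((hW w).1 hw 0)
    have hu0 := (hW u).1 hu 0
    obtain ⟨a, b, c, rfl⟩ := hspan _ hy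
    rw [he] at h ⊢
    simp only [lie_add, lie_smul, h01, h02, lie_self, hx, hu0, lie_neg, lie_zero] at h
    have h3 : (3 : ℝ) • u = 0 := by
      rw [← sub_eq_zero] at h
      rw [← neg_eq_zero, ← h]
      module
    rw [(smul_eq_zero.1 h3).resolve_left (by norm_num), add_zero]
    exact Submodule.add_mem_sup ((hW₀ x).2 hx) hy

end Abstract
-- Skew-adjoint matrices and their dimensions.
section SkewMatrices

open Matrix

variable {𝔽 : Type*} [Ring 𝔽] [StarRing 𝔽] [Algebra ℝ 𝔽]
  {V : Type*} [AddCommGroup V] [Module ℝ V]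

/-- The matrix with given entries below and on the diagonal that is skew-adjoint off it. -/
def skewOfLower {n : ℕ} (u : (Σ i : Fin n, Fin i) → 𝔽) (d : Fin n → 𝔽) :
    Matrix (Fin n) (Fin n) 𝔽 :=
  Matrix.of fun i j => if h : j < i then u ⟨i, ⟨j, h⟩⟩ else
    if h : i < j then -star (u ⟨j, ⟨i, h⟩⟩) else d i

omit [Algebra ℝ 𝔽] in
lemma conjTranspose_skewOfLower {n : ℕ} (u : (Σ i : Fin n, Fin i) → 𝔽) {d : Fin n → 𝔽}
    (hd : ∀ i, star (d i) = -d i) : (skewOfLower u d)ᴴ = -skewOfLower u d := by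
  ext i j
  simp only [skewOfLower, conjTranspose_apply, Matrix.of_apply, Matrix.neg_apply]
  rcases lt_trichotomy i j with h | rfl | h
  · simp [h, h.not_gt]
  · simp [hd]
  · simp [h, h.not_gt]

lemma card_sigma_fin (n : ℕ) : 2 * Fintype.card (Σ i : Fin n, Fin i) = n * (n - 1) := by
  rw [Fintype.card_sigma]
  simp only [Fintype.card_fin]
  rw [Fin.sum_univ_eq_sum_range (fun i => i), mul_comm, Finset.sum_range_id_mul_two]

/-- The dimension of a space of skew-adjoint matrices. -/
lemma finrank_of_skewAdjoint [FiniteDimensional ℝ 𝔽] {n : ℕ} {ψ : V →ₗ[ℝ] Matrix (Fin n) (Fin n) 𝔽}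
    (hψ : Function.Injective ψ) (hskew : ∀ v, (ψ v)ᴴ = -ψ v) {E : Type*} [AddCommGroup E]
    [Module ℝ E] [FiniteDimensional ℝ E] (δ : V →ₗ[ℝ] E) (hδ : ∀ v, δ v = 0 → ∀ i, ψ v i i = 0)
    (hsurj : ∀ e : E, ∃ d : Fin n → 𝔽, (∀ i, star (d i) = -d i) ∧
      ∀ X : Matrix (Fin n) (Fin n) 𝔽, Xᴴ = -X → (∀ i, X i i = d i) → ∃ v, ψ v = X ∧ δ v = e) :
    2 * Module.finrank ℝ V = n * (n - 1) * Module.finrank ℝ 𝔽 + 2 * Module.finrank ℝ E := by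
  let low : V →ₗ[ℝ] ((Σ i : Fin n, Fin i) → 𝔽) :=
    { toFun := fun v q => ψ v q.1 ⟨q.2, q.2.2.trans q.1.2⟩
      map_add' := fun v w => by ext; simp
      map_smul' := fun c v => by ext; simp }
  -- A skew-adjoint matrix is determined by its free entries below the diagonal and the coordinates
  -- `δ` of its diagonal.
  have hbij : Function.Bijective (low.prod δ) := by
    refine ⟨(injective_iff_map_eq_zero _).2 fun v hv => ?_, fun ⟨u, e⟩ => ?_⟩
    · obtain ⟨h1, h2⟩ := Prod.mk_eq_zero.1 hv
      have h3 : ∀ i j, j < i → ψ v i j = 0 := fun i j h => congrFun h1 ⟨i, ⟨j, h⟩⟩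
      refine hψ ?_
      rw [map_zero]
      ext i j
      rcases lt_trichotomy i j with h | rfl | h
      · have h4 := congrFun (congrFun (hskew v) i) j
        rw [conjTranspose_apply, h3 j i h, star_zero, Matrix.neg_apply] at h4
        exact neg_eq_zero.1 h4.symm
      · exact hδ v h2 i
      · exact h3 i j h
    · obtain ⟨d, hd, h⟩ := hsurj e
      obtain ⟨v, hv, hve⟩ := h (skewOfLower u d) (conjTranspose_skewOfLower u hd)
        fun i => by simp [skewOfLower]
      refine ⟨v, Prod.ext (funext fun q => ?_) hve⟩
      have h4 : (⟨(q.2 : ℕ), q.2.2.trans q.1.2⟩ : Fin n) < q.1 := q.2.2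
      change ψ v q.1 ⟨q.2, _⟩ = u q
      rw [hv, skewOfLower, Matrix.of_apply, dif_pos h4]
  have h := (LinearEquiv.ofBijective _ hbij).finrank_eq
  rw [h, Module.finrank_prod, Module.finrank_pi_fintype, Finset.sum_const, Finset.card_univ,
    smul_eq_mul, mul_add, ← mul_assoc, card_sigma_fin]

/-- The skew-adjoint matrix with a given first row, and zeros in the remaining block. -/
def skewOfRow {p : ℕ} (r : Fin p → 𝔽) : Matrix (Fin (p + 1)) (Fin (p + 1)) 𝔽 :=
  Matrix.of (Fin.cons (Fin.cons 0 r) fun i => Fin.cons (-star (r i)) 0)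

omit [Algebra ℝ 𝔽] in
lemma conjTranspose_skewOfRow {p : ℕ} (r : Fin p → 𝔽) : (skewOfRow r)ᴴ = -skewOfRow r := by
  ext i j
  refine Fin.cases ?_ (fun i => ?_) i <;> refine Fin.cases ?_ (fun j => ?_) j <;>
    simp [skewOfRow]

/-- The dimension of a space of skew-adjoint matrices supported in the first row and column. -/
lemma finrank_of_row [FiniteDimensional ℝ 𝔽] {p : ℕ}
    {ψ : V →ₗ[ℝ] Matrix (Fin (p + 1)) (Fin (p + 1)) 𝔽}
    (hψ : Function.Injective ψ) (hskew : ∀ v, (ψ v)ᴴ = -ψ v) {W : Submodule ℝ V}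
    (hW : ∀ v, v ∈ W ↔ ψ v 0 0 = 0 ∧ ∀ i j : Fin p, ψ v i.succ j.succ = 0)
    (hsurj : ∀ r : Fin p → 𝔽, ∃ v, ψ v = skewOfRow r) :
    Module.finrank ℝ W = p * Module.finrank ℝ 𝔽 := by
  let row : W →ₗ[ℝ] (Fin p → 𝔽) :=
    { toFun := fun v i => ψ v 0 i.succ
      map_add' := fun v w => by ext; simp
      map_smul' := fun c v => by ext; simp }
  have hbij : Function.Bijective row := by
    refine ⟨(injective_iff_map_eq_zero _).2 fun v hv => ?_, fun r => ?_⟩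
    · have h1 : ∀ i : Fin p, ψ v 0 i.succ = 0 := fun i => congrFun hv i
      obtain ⟨h2, h3⟩ := (hW v).1 v.2
      refine Subtype.ext (hψ ?_)
      rw [ZeroMemClass.coe_zero, map_zero]
      ext i j
      refine Fin.cases ?_ (fun i => ?_) i <;> refine Fin.cases ?_ (fun j => ?_) j
      · exact h2
      · exact h1 j
      · have h4 := congrFun (congrFun (hskew v) i.succ) 0
        rw [conjTranspose_apply, h1 i, star_zero, Matrix.neg_apply] at h4
        exact neg_eq_zero.1 h4.symm
      · exact h3 i j
    · obtain ⟨v, hv⟩ := hsurj r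
      refine ⟨⟨v, (hW v).2 ?_⟩, funext fun i => ?_⟩
      · rw [hv]
        simp [skewOfRow]
      · change ψ v 0 i.succ = r i
        rw [hv]
        simp [skewOfRow]
  have h := (LinearEquiv.ofBijective _ hbij).finrank_eq
  rw [h, Module.finrank_pi_fintype, Finset.sum_const, Finset.card_univ, smul_eq_mul,
    Fintype.card_fin]

-- A corner matrix acts by commutators only on the first row and column; from this all the `ad z`
-- formulas below are read off.
omit [StarRing 𝔽] [Algebra ℝ 𝔽] in
lemma single_commutator_apply {p : ℕ} (u : 𝔽) (X : Matrix (Fin (p + 1)) (Fin (p + 1)) 𝔽)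
    (i j : Fin (p + 1)) : (Matrix.single 0 0 u * X - X * Matrix.single 0 0 u :
      Matrix (Fin (p + 1)) (Fin (p + 1)) 𝔽) i j =
      (if i = 0 then u * X 0 j else 0) - (if j = 0 then X i 0 * u else 0) := by
  rw [Matrix.sub_apply]
  congr 1
  · split_ifs with h
    · rw [h, Matrix.single_mul_apply_same]
    · rw [Matrix.single_mul_apply_of_ne _ _ _ _ _ h]
  · split_ifs with h
    · rw [h, Matrix.mul_single_apply_same]
    · rw [Matrix.mul_single_apply_of_ne _ _ _ _ _ h]

omit [Algebra ℝ 𝔽] in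
lemma skew_apply {n : ℕ} {X : Matrix (Fin n) (Fin n) 𝔽} (hX : Xᴴ = -X) (i j : Fin n) :
    star (X j i) = -X i j := by
  rw [← conjTranspose_apply, hX, Matrix.neg_apply]

/-! ### Special unitary matrices. -/

section Unitary

variable {L : Type*} [LieRing L] [LieAlgebra ℝ L] [FiniteDimensional ℝ L] {p : ℕ}
  {ψ : L →ₗ[ℝ] Matrix (Fin (p + 1)) (Fin (p + 1)) ℂ}

omit [FiniteDimensional ℝ L] in
lemma finrank_of_specialUnitary (hψ : Function.Injective ψ) (hskew : ∀ v, (ψ v)ᴴ = -ψ v)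
    (htr : ∀ v, (ψ v).trace = 0)
    (hsurj : ∀ X : Matrix (Fin (p + 1)) (Fin (p + 1)) ℂ, Xᴴ = -X → X.trace = 0 → ∃ v, ψ v = X) :
    Module.finrank ℝ L = p ^ 2 + 2 * p := by
  -- The first diagonal entry is omitted, since the trace condition determines it.
  let δ : L →ₗ[ℝ] (Fin p → ℝ) :=
    { toFun := fun v i => (ψ v i.succ i.succ).im
      map_add' := fun v w => by ext; simp
      map_smul' := fun c v => by ext; simp }
  have hre : ∀ v i, (ψ v i i).re = 0 := fun v i => by
    have h := congrArg Complex.re (skew_apply (hskew v) i i)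
    simp at h
    linarith
  have h := finrank_of_skewAdjoint hψ hskew δ (fun v hv => ?_) (fun e => ?_)
  · rw [Complex.finrank_real_complex, Module.finrank_fin_fun] at h
    simp only [Nat.add_sub_cancel] at h
    nlinarith
  · have h1 : ∀ i : Fin p, ψ v i.succ i.succ = 0 := fun i =>
      Complex.ext (hre v i.succ) (congrFun hv i)
    have h2 := htr v
    rw [Matrix.trace, Fin.sum_univ_succ] at h2
    simp only [Matrix.diag_apply, h1, Finset.sum_const_zero, add_zero] at h2
    exact Fin.cases h2 h1
  · refine ⟨Fin.cons (-∑ i, (e i : ℂ) * Complex.I) fun i => (e i : ℂ) * Complex.I, ?_, ?_⟩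
    · refine Fin.cases ?_ fun i => ?_
      · simp
      · simp
    · intro X hX hd
      obtain ⟨v, hv⟩ := hsurj X hX (by
        rw [Matrix.trace, Fin.sum_univ_succ]
        simp [hd])
      refine ⟨v, hv, funext fun i => ?_⟩
      change (ψ v i.succ i.succ).im = e i
      rw [hv, hd]
      simp

/-- The scalar curvature is not maximal at the standard metric if the Lie algebra is `su(n)` with
`n` at least `3`. -/
lemma IsPosSymm.exists_not_isLocalMax_of_specialUnitary (hK : IsPosSymm (-killingForm ℝ L))
    (hp : 2 ≤ p) (hψ : Function.Injective ψ)
    (hlie : ∀ v w : L, ψ ⁅v, w⁆ = ψ v * ψ w - ψ w * ψ v) (hskew : ∀ v, (ψ v)ᴴ = -ψ v)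
    (htr : ∀ v, (ψ v).trace = 0)
    (hsurj : ∀ X : Matrix (Fin (p + 1)) (Fin (p + 1)) ℂ, Xᴴ = -X → X.trace = 0 → ∃ v, ψ v = X) :
    ∃ (f : Module.Basis (Fin (Module.finrank ℝ L)) ℝ L) (a : Fin (Module.finrank ℝ L) → ℝ),
      IsOrthon (-killingForm ℝ L) f ∧ ∑ i, a i = 0 ∧ ¬ IsLocalMax (diagonalScalar f a) 0 := by
  have hp0 : ((p : ℂ) + 1) ≠ 0 := by exact_mod_cast (Nat.succ_ne_zero p)
  -- The scalar part makes `z` traceless and is invisible to commutators, so `ad z` acts as the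
  -- commutator with the corner matrix.
  obtain ⟨z, hz⟩ := hsurj (Matrix.single 0 0 Complex.I - (Complex.I / (p + 1)) • 1) (by
      rw [conjTranspose_sub, conjTranspose_smul, conjTranspose_single, conjTranspose_one]
      ext i j
      simp [Matrix.single_apply, Complex.conj_I]
      split_ifs <;> ring) (by
      simp [Matrix.trace_sub, Matrix.trace_smul]
      field_simp
      simp)
  have hzc : ∀ v i j, ψ ⁅z, v⁆ i j =
      (if i = 0 then Complex.I * ψ v 0 j else 0) - (if j = 0 then ψ v i 0 * Complex.I else 0) := by
    intro v i j
    rw [← single_commutator_apply, hlie, hz]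
    simp [sub_mul, mul_sub]
  have h00 : ∀ v, ψ ⁅z, v⁆ 0 0 = 0 := fun v => by simp [hzc, mul_comm]
  have h01 : ∀ v (j : Fin p), ψ ⁅z, v⁆ 0 j.succ = Complex.I * ψ v 0 j.succ := fun v j => by
    simp [hzc]
  have h10 : ∀ v (i : Fin p), ψ ⁅z, v⁆ i.succ 0 = -(ψ v i.succ 0 * Complex.I) := fun v i => by
    simp [hzc]
  have h11 : ∀ v (i j : Fin p), ψ ⁅z, v⁆ i.succ j.succ = 0 := fun v i j => by simp [hzc]
  have hext : ∀ v w : L, (ψ v 0 0 = ψ w 0 0) → (∀ j : Fin p, ψ v 0 j.succ = ψ w 0 j.succ) →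
      (∀ i : Fin p, ψ v i.succ 0 = ψ w i.succ 0) →
      (∀ i j : Fin p, ψ v i.succ j.succ = ψ w i.succ j.succ) → v = w := by
    intro v w e00 e01 e10 e11
    refine hψ (Matrix.ext (Fin.cases (Fin.cases e00 e01) fun i => Fin.cases (e10 i) (e11 i)))
  have hI : ∀ x : ℂ, Complex.I * (Complex.I * x) = -x := fun x => by
    rw [← mul_assoc, Complex.I_mul_I, neg_one_mul]
  have hI' : ∀ x : ℂ, x * Complex.I * Complex.I = -x := fun x => by
    rw [mul_assoc, Complex.I_mul_I, mul_neg_one]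
  let W : Submodule ℝ L := LinearMap.ker
    (LieAlgebra.ad ℝ L z ∘ₗ LieAlgebra.ad ℝ L z + LinearMap.id)
  have hW : ∀ v : L, v ∈ W ↔ ⁅z, ⁅z, v⁆⁆ = -v := fun v => eq_neg_iff_add_eq_zero.symm
  have hW' : ∀ v : L, v ∈ W ↔ ψ v 0 0 = 0 ∧ ∀ i j : Fin p, ψ v i.succ j.succ = 0 := fun v => by
    rw [hW]
    refine ⟨fun h => ?_, fun h => hext _ _ ?_ ?_ ?_ ?_⟩
    · have h' : ∀ i j, ψ ⁅z, ⁅z, v⁆⁆ i j = -ψ v i j := fun i j => by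
        rw [h, map_neg, Matrix.neg_apply]
      refine ⟨?_, fun i j => ?_⟩
      · rw [← neg_eq_zero, ← h', h00]
      · rw [← neg_eq_zero, ← h', h11]
    · rw [h00, map_neg, Matrix.neg_apply, h.1, neg_zero]
    · intro j
      rw [h01, h01, map_neg, Matrix.neg_apply, hI]
    · intro i
      rw [h10, h10, map_neg, Matrix.neg_apply, neg_mul, hI', neg_neg]
    · intro i j
      rw [h11, map_neg, Matrix.neg_apply, h.2, neg_zero]
  refine hK.exists_not_isLocalMax_of_unitary_type (z := z) ?_ (fun v => hext _ _ ?_ ?_ ?_ ?_) hp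
    (finrank_of_specialUnitary hψ hskew htr hsurj) hW ?_
  · rintro rfl
    have h2 := congrFun (congrFun hz (Fin.succ ⟨0, by omega⟩)) (Fin.succ ⟨0, by omega⟩)
    simp [hp0] at h2
  · rw [h00, map_neg, Matrix.neg_apply, h00, neg_zero]
  · intro j
    rw [h01, h01, hI, map_neg, Matrix.neg_apply]
  · intro i
    rw [h10, h10, neg_mul, hI', neg_neg, map_neg, Matrix.neg_apply]
  · intro i j
    rw [h11, map_neg, Matrix.neg_apply, h11, neg_zero]
  · rw [finrank_of_row hψ hskew hW' (fun r => hsurj _ (conjTranspose_skewOfRow r) ?_),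
      Complex.finrank_real_complex, mul_comm]
    rw [Matrix.trace, Fin.sum_univ_succ]
    simp [skewOfRow]

end Unitary

/-! ### Symplectic matrices. -/

section Symplectic

open scoped Quaternion

/-- The purely imaginary quaternion with given coefficients. -/
def imQuaternion (a b c : ℝ) : ℍ[ℝ] := ⟨0, a, b, c⟩

section
variable (a b c : ℝ)
@[simp] lemma re_imQuaternion : (imQuaternion a b c).re = 0 := rfl
@[simp] lemma imI_imQuaternion : (imQuaternion a b c).imI = a := rfl
@[simp] lemma imJ_imQuaternion : (imQuaternion a b c).imJ = b := rfl
@[simp] lemma imK_imQuaternion : (imQuaternion a b c).imK = c := rfl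
end

lemma star_imQuaternion (a b c : ℝ) : star (imQuaternion a b c) = -imQuaternion a b c := by
  ext <;> simp

/-- The quaternion units. -/
def quaternionUnit : Fin 3 → ℍ[ℝ] :=
  ![imQuaternion 1 0 0, imQuaternion 0 1 0, imQuaternion 0 0 1]

lemma quaternionUnit_mul_self (a : Fin 3) : quaternionUnit a * quaternionUnit a = -1 := by
  fin_cases a <;> ext <;> simp [quaternionUnit]

lemma star_quaternionUnit (a : Fin 3) : star (quaternionUnit a) = -quaternionUnit a := by
  fin_cases a <;> simp [quaternionUnit, star_imQuaternion]

variable {L : Type*} [LieRing L] [LieAlgebra ℝ L] [FiniteDimensional ℝ L] {p : ℕ}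
  {ψ : L →ₗ[ℝ] Matrix (Fin (p + 1)) (Fin (p + 1)) ℍ[ℝ]}

lemma quaternion_re_eq_zero {x : ℍ[ℝ]} (h : star x = -x) : x.re = 0 := by
  have := congrArg QuaternionAlgebra.re h
  simp at this
  linarith

omit [FiniteDimensional ℝ L] in
lemma finrank_of_symplectic (hψ : Function.Injective ψ) (hskew : ∀ v, (ψ v)ᴴ = -ψ v)
    (hsurj : ∀ X : Matrix (Fin (p + 1)) (Fin (p + 1)) ℍ[ℝ], Xᴴ = -X → ∃ v, ψ v = X) :
    Module.finrank ℝ L = (p + 1) * (2 * p + 3) := by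
  let δ : L →ₗ[ℝ] (Fin (p + 1) → Fin 3 → ℝ) :=
    { toFun := fun v i => ![(ψ v i i).imI, (ψ v i i).imJ, (ψ v i i).imK]
      map_add' := fun v w => by ext i a; fin_cases a <;> simp
      map_smul' := fun c v => by ext i a; fin_cases a <;> simp }
  have h := finrank_of_skewAdjoint hψ hskew δ (fun v hv i => ?_) (fun e => ?_)
  · have hd : Module.finrank ℝ (Fin (p + 1) → Fin 3 → ℝ) = (p + 1) * 3 := by
      rw [Module.finrank_pi_fintype]
      simp
    rw [Quaternion.finrank_eq_four, hd] at h
    simp only [Nat.add_sub_cancel] at h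
    nlinarith
  · have h1 := congrFun (congrFun hv i)
    exact QuaternionAlgebra.ext (quaternion_re_eq_zero (skew_apply (hskew v) i i))
      (h1 0) (h1 1) (h1 2)
  · refine ⟨fun i => imQuaternion (e i 0) (e i 1) (e i 2), fun i => star_imQuaternion _ _ _, fun X hX hd => ?_⟩
    obtain ⟨v, hv⟩ := hsurj X hX
    refine ⟨v, hv, ?_⟩
    ext i a
    change ![(ψ v i i).imI, (ψ v i i).imJ, (ψ v i i).imK] a = e i a
    rw [hv, hd]
    fin_cases a <;> rfl

/-- The scalar curvature is not maximal at the standard metric if the Lie algebra is `sp(n)` with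
`n` at least `2`. -/
lemma IsPosSymm.exists_not_isLocalMax_of_symplectic (hK : IsPosSymm (-killingForm ℝ L))
    (hp : 1 ≤ p) (hψ : Function.Injective ψ)
    (hlie : ∀ v w : L, ψ ⁅v, w⁆ = ψ v * ψ w - ψ w * ψ v) (hskew : ∀ v, (ψ v)ᴴ = -ψ v)
    (hsurj : ∀ X : Matrix (Fin (p + 1)) (Fin (p + 1)) ℍ[ℝ], Xᴴ = -X → ∃ v, ψ v = X) :
    ∃ (f : Module.Basis (Fin (Module.finrank ℝ L)) ℝ L) (a : Fin (Module.finrank ℝ L) → ℝ),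
      IsOrthon (-killingForm ℝ L) f ∧ ∑ i, a i = 0 ∧ ¬ IsLocalMax (diagonalScalar f a) 0 := by
  have hz : ∀ a, ∃ z, ψ z = Matrix.single 0 0 (quaternionUnit a) := fun a => hsurj _ (by
    rw [conjTranspose_single, star_quaternionUnit]
    refine Matrix.ext fun i j => ?_
    simp only [Matrix.single_apply, Matrix.neg_apply]
    split_ifs <;> simp)
  choose z hz using hz
  have hz00 : ∀ a, ψ (z a) 0 0 = quaternionUnit a := fun a => by
    rw [hz, Matrix.single_apply_same]
  have hz01 : ∀ a (j : Fin p), ψ (z a) 0 j.succ = 0 := fun a j => by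
    rw [hz, Matrix.single_apply_of_ne _ _ _ _ _ (by simp [(Fin.succ_ne_zero j).symm])]
  have hz10 : ∀ a (j : Fin p), ψ (z a) j.succ 0 = 0 := fun a j => by
    rw [hz, Matrix.single_apply_of_ne _ _ _ _ _ (by simp [(Fin.succ_ne_zero j).symm])]
  have hzc : ∀ a v i j, ψ ⁅z a, v⁆ i j = (if i = 0 then quaternionUnit a * ψ v 0 j else 0) -
      (if j = 0 then ψ v i 0 * quaternionUnit a else 0) := by
    intro a v i j
    rw [← single_commutator_apply, hlie, hz]
  have h00 : ∀ a v, ψ ⁅z a, v⁆ 0 0 = quaternionUnit a * ψ v 0 0 - ψ v 0 0 * quaternionUnit a :=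
    fun a v => by simp [hzc]
  have h01 : ∀ a v (j : Fin p), ψ ⁅z a, v⁆ 0 j.succ = quaternionUnit a * ψ v 0 j.succ :=
    fun a v j => by simp [hzc]
  have h10 : ∀ a v (i : Fin p), ψ ⁅z a, v⁆ i.succ 0 = -(ψ v i.succ 0 * quaternionUnit a) :=
    fun a v i => by simp [hzc]
  have h11 : ∀ a v (i j : Fin p), ψ ⁅z a, v⁆ i.succ j.succ = 0 := fun a v i j => by simp [hzc]
  have hext : ∀ v w : L, (ψ v 0 0 = ψ w 0 0) → (∀ j : Fin p, ψ v 0 j.succ = ψ w 0 j.succ) →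
      (∀ i : Fin p, ψ v i.succ 0 = ψ w i.succ 0) →
      (∀ i j : Fin p, ψ v i.succ j.succ = ψ w i.succ j.succ) → v = w := by
    intro v w e00 e01 e10 e11
    refine hψ (Matrix.ext (Fin.cases (Fin.cases e00 e01) fun i => Fin.cases (e10 i) (e11 i)))
  have hu : ∀ a x, quaternionUnit a * (quaternionUnit a * x) = -x := fun a x => by
    rw [← mul_assoc, quaternionUnit_mul_self, neg_one_mul]
  have hu' : ∀ a x, x * quaternionUnit a * quaternionUnit a = -x := fun a x => by
    rw [mul_assoc, quaternionUnit_mul_self, mul_neg_one]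
  let W : Submodule ℝ L := ⨅ a, LinearMap.ker
    (LieAlgebra.ad ℝ L (z a) ∘ₗ LieAlgebra.ad ℝ L (z a) + LinearMap.id)
  have hW : ∀ v : L, v ∈ W ↔ ∀ a, ⁅z a, ⁅z a, v⁆⁆ = -v := fun v => by
    simp [W, Submodule.mem_iInf, eq_neg_iff_add_eq_zero]
  have hW' : ∀ v : L, v ∈ W ↔ ψ v 0 0 = 0 ∧ ∀ i j : Fin p, ψ v i.succ j.succ = 0 := fun v => by
    rw [hW]
    refine ⟨fun h => ?_, fun h a => hext _ _ ?_ ?_ ?_ ?_⟩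
    · have h' : ∀ i j, ψ ⁅z 0, ⁅z 0, v⁆⁆ i j = -ψ v i j := fun i j => by
        rw [h, map_neg, Matrix.neg_apply]
      refine ⟨?_, fun i j => ?_⟩
      -- On quaternions the square of the commutator with the first unit has eigenvalues `0` and
      -- `-4`, never `-1`, so the corner entry vanishes; one unit suffices.
      · have h1 := h' 0 0
        rw [h00, h00] at h1
        generalize ψ v 0 0 = x at h1 ⊢
        have e0 := congrArg QuaternionAlgebra.re h1
        have e1 := congrArg QuaternionAlgebra.imI h1
        have e2 := congrArg QuaternionAlgebra.imJ h1
        have e3 := congrArg QuaternionAlgebra.imK h1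
        simp [quaternionUnit] at e0 e1 e2 e3
        ext <;> simp <;> linarith
      · rw [← neg_eq_zero, ← h', h11]
    · rw [h00, h00, map_neg, Matrix.neg_apply, h.1]; simp
    · intro j
      rw [h01, h01, map_neg, Matrix.neg_apply, hu]
    · intro i
      rw [h10, h10, map_neg, Matrix.neg_apply, neg_mul, hu', neg_neg]
    · intro i j
      rw [h11, map_neg, Matrix.neg_apply, h.2, neg_zero]
  have hrel : ∀ a b c, quaternionUnit a * quaternionUnit b - quaternionUnit b * quaternionUnit a =
      (2 : ℝ) • quaternionUnit c → ⁅z a, z b⁆ = (2 : ℝ) • z c := fun a b c h => by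
    refine hψ ?_
    rw [hlie, map_smul, hz, hz, hz, Matrix.single_mul_single_same, Matrix.single_mul_single_same,
      Matrix.smul_single, ← h]
    refine Matrix.ext fun i j => ?_
    simp only [Matrix.single_apply, Matrix.sub_apply]
    split_ifs <;> simp
  refine hK.exists_not_isLocalMax_of_symplectic_type (z := z) ?_ (hrel _ _ _ ?_) (hrel _ _ _ ?_)
    (hrel _ _ _ ?_) hp (finrank_of_symplectic hψ hskew hsurj) hW ?_ ?_
  · refine Fintype.linearIndependent_iff.2 fun g hg => ?_
    have h := congrArg (fun v => ψ v 0 0) hg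
    simp only [Fin.sum_univ_three, map_add, map_smul, map_zero, Matrix.add_apply,
      Matrix.smul_apply, hz00, Matrix.zero_apply] at h
    have e1 := congrArg QuaternionAlgebra.imI h
    have e2 := congrArg QuaternionAlgebra.imJ h
    have e3 := congrArg QuaternionAlgebra.imK h
    simp [quaternionUnit] at e1 e2 e3
    intro i
    fin_cases i
    exacts [e1, e2, e3]
  · ext <;> simp [quaternionUnit] <;> norm_num
  · ext <;> simp [quaternionUnit] <;> norm_num
  · ext <;> simp [quaternionUnit] <;> norm_num
  · rw [finrank_of_row hψ hskew hW' (fun r => hsurj _ (conjTranspose_skewOfRow r)),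
      Quaternion.finrank_eq_four, mul_comm]
  · intro v
    obtain ⟨y, hy, hy00, hy01, hy10⟩ : ∃ y ∈ Submodule.span ℝ (Set.range z), ψ y 0 0 = ψ v 0 0 ∧
        (∀ j : Fin p, ψ y 0 j.succ = 0) ∧ (∀ j : Fin p, ψ y j.succ 0 = 0) := by
      refine ⟨(ψ v 0 0).imI • z 0 + (ψ v 0 0).imJ • z 1 + (ψ v 0 0).imK • z 2, ?_, ?_, ?_, ?_⟩
      · have h : ∀ i, z i ∈ Submodule.span ℝ (Set.range z) := fun i => Submodule.subset_span ⟨i, rfl⟩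
        exact Submodule.add_mem _ (Submodule.add_mem _ (Submodule.smul_mem _ _ (h 0))
          (Submodule.smul_mem _ _ (h 1))) (Submodule.smul_mem _ _ (h 2))
      · have h := quaternion_re_eq_zero (skew_apply (hskew v) 0 0)
        ext <;> simp [hz00, quaternionUnit, h]
      · intro j
        simp [hz01]
      · intro j
        simp [hz10]
    -- With the corner entry removed, `-(ad z 0)²` is the projection of `v'` to the first row and
    -- column.
    set v' := v - y with hv'
    have e00 : ψ v' 0 0 = 0 := by rw [hv', map_sub, Matrix.sub_apply, hy00, sub_self]
    refine ⟨v' + ⁅z 0, ⁅z 0, v'⁆⁆, y, -⁅z 0, ⁅z 0, v'⁆⁆, fun a => hext _ _ ?_ ?_ ?_ ?_, hy,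
      (hW' _).2 ⟨?_, fun i j => ?_⟩, by rw [hv']; abel⟩
    · rw [h00, map_add, Matrix.add_apply, h00, h00, e00]; simp
    · intro j
      rw [h01, map_add, Matrix.add_apply, h01, h01, hu]; simp
    · intro j
      rw [h10, map_add, Matrix.add_apply, h10, h10, neg_mul, hu']; simp
    · intro i j
      rw [h11, map_zero, Matrix.zero_apply]
    · rw [map_neg, Matrix.neg_apply, h00, h00, e00]; simp
    · rw [map_neg, Matrix.neg_apply, h11, neg_zero]

end Symplectic

end SkewMatrices
-- The differential of a local isomorphism to a matrix group.
section LocalIsomorphism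

/-- The second derivative of the multiplicativity relation `F (m (x, y)) = F x * F y`. -/
lemma fderiv_fderiv_of_multiplicative {E A : Type*} [NormedAddCommGroup E] [NormedSpace ℝ E]
    [NormedRing A] [NormedAlgebra ℝ A] {F : E → A} {m : E × E → E} {p : E}
    (hF : ContDiffAt ℝ ∞ F p) (hm : ContDiffAt ℝ ∞ m (p, p)) (hmp : ∀ᶠ x in 𝓝 p, m (x, p) = x)
    (hmul : ∀ᶠ q in 𝓝 (p, p), F (m q) = F q.1 * F q.2)
    (hl : ∀ w, fderiv ℝ m (p, p) (0, w) = w) (v w : E) :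
    fderiv ℝ (fderiv ℝ F) p v w + fderiv ℝ F p (fderiv ℝ (fderiv ℝ m) (p, p) (v, 0) (0, w)) =
      fderiv ℝ F p v * fderiv ℝ F p w := by
  have hF1 : ∀ᶠ x in 𝓝 p, DifferentiableAt ℝ F x :=
    ((hF.of_le (m := 1) (by simp)).eventually (by simp)).mono
      fun x hx => hx.differentiableAt (by simp)
  have hm1 : ∀ᶠ q in 𝓝 (p, p), DifferentiableAt ℝ m q :=
    ((hm.of_le (m := 1) (by simp)).eventually (by simp)).mono
      fun x hx => hx.differentiableAt (by simp)
  have hc : ContinuousAt (fun x : E => (x, p)) p := by fun_prop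
  have h1 : ∀ᶠ x in 𝓝 p, fderiv ℝ F x (fderiv ℝ m (x, p) (0, w)) = F x * fderiv ℝ F p w := by
    filter_upwards [hF1, hc.eventually hm1, hmp, hc.eventually hmul.eventually_nhds]
      with x e1 e2 e3 e4
    have d1 : HasFDerivAt (fun y => m (x, y))
        ((fderiv ℝ m (x, p)).comp (ContinuousLinearMap.inr ℝ E E)) p :=
      HasFDerivAt.comp p e2.hasFDerivAt (hasFDerivAt_prodMk_right x p)
    have e1' : HasFDerivAt F (fderiv ℝ F x) (m (x, p)) := by rw [e3]; exact e1.hasFDerivAt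
    have d2 := HasFDerivAt.comp p e1' d1
    have d3 := ((ContinuousLinearMap.mul ℝ A (F x)).hasFDerivAt).comp p
      hF1.self_of_nhds.hasFDerivAt
    have hc' : ContinuousAt (fun y : E => (x, y)) p := by fun_prop
    have d4 := d2.congr_of_eventuallyEq
      (f₁ := fun y => F x * F y) ((hc'.eventually e4).mono fun y hy => hy.symm)
    have := congrArg (fun T => T w) (d4.unique d3)
    simpa using this
  have hF2 : HasFDerivAt (fderiv ℝ F) (fderiv ℝ (fderiv ℝ F) p) p :=
    ((hF.fderiv_right (m := ∞) (by simp)).differentiableAt (by simp)).hasFDerivAt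
  have hm2 : HasFDerivAt (fderiv ℝ m) (fderiv ℝ (fderiv ℝ m) (p, p)) (p, p) :=
    ((hm.fderiv_right (m := ∞) (by simp)).differentiableAt (by simp)).hasFDerivAt
  have d1 : HasFDerivAt (fun x => fderiv ℝ m (x, p) (0, w))
      (((fderiv ℝ (fderiv ℝ m) (p, p)).flip (0, w)).comp (ContinuousLinearMap.inl ℝ E E)) p := by
    have := (HasFDerivAt.comp (f := fun x => (x, p)) p hm2 (hasFDerivAt_prodMk_left p p)).clm_apply
      (hasFDerivAt_const ((0 : E), w) p)
    refine this.congr_fderiv ?_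
    ext u
    simp
  have d2 := hF2.clm_apply d1
  have d3 := (((ContinuousLinearMap.mul ℝ A).flip (fderiv ℝ F p w)).hasFDerivAt).comp p
    hF1.self_of_nhds.hasFDerivAt
  have d4 := d2.congr_of_eventuallyEq (f₁ := fun x => F x * fderiv ℝ F p w)
    (h1.mono fun x hx => hx.symm)
  have := congrArg (fun T => T v) (d4.unique d3)
  simp [hl] at this
  rw [← this, add_comm]

/-- The derivative of a local homomorphism to the units of an algebra preserves brackets. -/
lemma bracket_of_multiplicative {d : ℕ} {G : Type*} [TopologicalSpace G]
    [ChartedSpace (EuclideanSpace ℝ (Fin d)) G] [Group G] [LieGroup (𝓡 d) ∞ G]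
    {A : Type*} [NormedRing A] [NormedAlgebra ℝ A] {F : EuclideanSpace ℝ (Fin d) → A}
    (hF : ContDiffAt ℝ ∞ F (chartOne d G))
    (hmul : ∀ᶠ q in 𝓝 (chartOne d G, chartOne d G), F (chartMul d G q) = F q.1 * F q.2)
    (v w : GroupLieAlgebra (𝓡 d) G) :
    fderiv ℝ F (chartOne d G) (⁅v, w⁆ : GroupLieAlgebra (𝓡 d) G) =
      fderiv ℝ F (chartOne d G) v * fderiv ℝ F (chartOne d G) w -
      fderiv ℝ F (chartOne d G) w * fderiv ℝ F (chartOne d G) v := by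
  have h := fderiv_fderiv_of_multiplicative hF (contDiffAt_chartMul_one_right d G
    (mem_of_mem_nhds (target_mem_nhds d G)))
    (Filter.eventually_of_mem (target_mem_nhds d G) fun x hx => chartMul_one_right d G hx) hmul
    (fderiv_chartMul_one_inr d G)
  -- Antisymmetrizing the second-order relation cancels the Hessian of `F` and leaves the bracket.
  have hsymm : ∀ v w, fderiv ℝ (fderiv ℝ F) (chartOne d G) v w =
      fderiv ℝ (fderiv ℝ F) (chartOne d G) w v := by
    have := (hF.of_le (m := 2) ENat.LEInfty.out).isSymmSndFDerivAt (by simp)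
    exact fun v w => this v w
  have h1 := congrArg (fderiv ℝ F (chartOne d G)) (bracket_eq_chart d G v w)
  refine h1.trans ?_
  refine (map_sub (fderiv ℝ F (chartOne d G)) _ _).trans ?_
  rw [← h v w, ← h w v, hsymm v w]
  abel

variable {d : ℕ} {G : Type*} [TopologicalSpace G] [ChartedSpace (EuclideanSpace ℝ (Fin d)) G]
  [Group G] [LieGroup (𝓡 d) ∞ G]

/-- The differential of a local isomorphism to a matrix group: a faithful representation of the
Lie algebra by the velocities of the curves in the matrix group. -/
lemma IsLocallyIsomorphicTo.exists_linearMap {A : Type*} [NormedRing A] [NormedAlgebra ℝ A]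
    [CompleteSpace A] {K : Submonoid A} (hK : ∀ x ∈ K, IsUnit x)
    (hG : IsLocallyIsomorphicTo d G K) :
    ∃ ψ : GroupLieAlgebra (𝓡 d) G →ₗ[ℝ] A, Function.Injective ψ ∧
      (∀ v w : GroupLieAlgebra (𝓡 d) G, ψ ⁅v, w⁆ = ψ v * ψ w - ψ w * ψ v) ∧
      (∀ v, ∃ c : ℝ → A, (∀ᶠ t in 𝓝 0, c t ∈ K) ∧ c 0 = 1 ∧ HasDerivAt c (ψ v) 0) ∧
      ∀ X : A, (∀ t : ℝ, NormedSpace.exp (t • X) ∈ K) → ∃ v, ψ v = X := by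
  obtain ⟨f, h, U, W, hU, h1U, hW, h1W, hf, hh, hfU, hhf, hmul⟩ := hG
  have := topologicalGroup_of_lieGroup (𝓡 d) ∞ (G := G)
  set φ := extChartAt (𝓡 d) (1 : G) with hφ
  set p := chartOne d G with hp
  have hsymm1 : φ.symm p = 1 := chartSymm_one d G
  have hφ1 : φ 1 = p := rfl
  -- `f 1` is an idempotent unit.
  have hf1 : f 1 = 1 := by
    have hu : IsUnit (f 1) := hK _ (hfU.le ⟨1, h1U, rfl⟩).2
    have := hmul 1 h1U 1 h1U (by rwa [one_mul])
    rw [one_mul] at this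
    exact (hu.mul_eq_left.1 this.symm)
  have hh1 : h 1 = 1 := by rw [← hf1, hhf 1 h1U]
  have hsc : ContMDiffAt 𝓘(ℝ, EuclideanSpace ℝ (Fin d)) (𝓡 d) ∞ φ.symm p :=
    contMDiffAt_chartSymm d G (mem_of_mem_nhds (target_mem_nhds d G))
  have hU' : ∀ᶠ x in 𝓝 p, φ.symm x ∈ U :=
    hsc.continuousAt.eventually (by rw [hsymm1]; exact hU.mem_nhds h1U)
  let F : EuclideanSpace ℝ (Fin d) → A := f ∘ φ.symm
  have hF : ContDiffAt ℝ ∞ F p := by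
    rw [← contMDiffAt_iff_contDiffAt]
    refine ContMDiffAt.comp p ?_ hsc
    rw [hsymm1]
    exact hf.contMDiffAt (hU.mem_nhds h1U)
  have hFp : F p = 1 := by simp only [F, Function.comp_apply, hsymm1, hf1]
  have hFmul : ∀ᶠ q in 𝓝 (p, p), F (chartMul d G q) = F q.1 * F q.2 := by
    have hst : Filter.Tendsto φ.symm (𝓝 p) (𝓝 1) := by
      rw [← hsymm1]; exact hsc.continuousAt
    have c1 := hst.comp (continuous_fst.tendsto (p, p))
    have c2 := hst.comp (continuous_snd.tendsto (p, p))
    have c3 := c1.mul c2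
    rw [one_mul] at c3
    have hN : φ.source ∩ U ∈ 𝓝 (1 : G) :=
      Filter.inter_mem (source_mem_nhds d G) (hU.mem_nhds h1U)
    filter_upwards [c1.eventually (hU.mem_nhds h1U), c2.eventually (hU.mem_nhds h1U),
      c3.eventually hN] with q e1 e2 e3
    refine (congrArg f (φ.left_inv e3.1)).trans ?_
    exact hmul _ e1 _ e2 e3.2
  have hFd : HasFDerivAt F (fderiv ℝ F p) p := (hF.differentiableAt (by simp)).hasFDerivAt
  let H : A → EuclideanSpace ℝ (Fin d) := φ ∘ h
  have hH : ContDiffAt ℝ ∞ H 1 := by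
    rw [← contMDiffAt_iff_contDiffAt]
    refine ContMDiffAt.comp 1 ?_ (hh.contMDiffAt (hW.mem_nhds h1W))
    rw [hh1]
    exact contMDiffAt_extChartAt
  have hHd : HasFDerivAt H (fderiv ℝ H 1) 1 := (hH.differentiableAt (by simp)).hasFDerivAt
  have hHp : H 1 = p := by simp only [H, Function.comp_apply, hh1, hφ1]
  refine ⟨(fderiv ℝ F p).toLinearMap, ?_, bracket_of_multiplicative hF hFmul, fun v => ?_,
    fun X hX => ?_⟩
  · have e1 : HasFDerivAt (H ∘ F) ((fderiv ℝ H 1).comp (fderiv ℝ F p)) p :=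
      HasFDerivAt.comp p (by rw [hFp]; exact hHd) hFd
    have e2 : HasFDerivAt (H ∘ F) (ContinuousLinearMap.id ℝ _) p := by
      refine (hasFDerivAt_id p).congr_of_eventuallyEq ?_
      filter_upwards [hU', target_mem_nhds d G] with x hx hx'
      change φ (h (f (φ.symm x))) = x
      rw [hhf _ hx, φ.right_inv hx']
    have e3 := e1.unique e2
    exact Function.LeftInverse.injective (g := fderiv ℝ H 1) fun v =>
      congrArg (fun T : EuclideanSpace ℝ (Fin d) →L[ℝ] EuclideanSpace ℝ (Fin d) => T v) e3
  · have key : ∀ v : EuclideanSpace ℝ (Fin d), ∃ c : ℝ → A, (∀ᶠ t in 𝓝 0, c t ∈ K) ∧ c 0 = 1 ∧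
        HasDerivAt c (fderiv ℝ F p v) 0 := fun v => by
      have hl : HasDerivAt (fun t : ℝ => p + t • v) v 0 := by
        have := ((hasDerivAt_id (0 : ℝ)).smul_const v).const_add p
        simpa using this
      have hl0 : p + (0 : ℝ) • v = p := by rw [zero_smul, add_zero]
      refine ⟨fun t => F (p + t • v), ?_, ?_, ?_⟩
      · have : ∀ᶠ x in 𝓝 p, F x ∈ K := hU'.mono fun x hx => (hfU.le ⟨_, hx, rfl⟩).2
        have hlt : Filter.Tendsto (fun t : ℝ => p + t • v) (𝓝 0) (𝓝 p) := by
          have := hl.continuousAt.tendsto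
          rwa [hl0] at this
        exact hlt.eventually this
      · change F (p + (0 : ℝ) • v) = 1
        rw [hl0, hFp]
      · exact HasFDerivAt.comp_hasDerivAt (0 : ℝ) (by rw [hl0]; exact hFd) hl
    exact key v
  -- For small `t`, `exp (t X)` lies in `W ∩ K`, where `F ∘ H` is the identity. Differentiating
  -- along this curve shows that `X` is the image of `fderiv ℝ H 1 X`.
  · have he : HasDerivAt (fun t : ℝ => NormedSpace.exp (t • X)) X 0 := by
      have := hasDerivAt_exp_smul_const (𝕂 := ℝ) X (0 : ℝ)
      simpa using this
    have he0 : NormedSpace.exp ((0 : ℝ) • X) = 1 := by simp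
    have het : Filter.Tendsto (fun t : ℝ => NormedSpace.exp (t • X)) (𝓝 0) (𝓝 1) := by
      have := he.continuousAt.tendsto
      rwa [he0] at this
    have hev : ∀ᶠ t : ℝ in 𝓝 0, NormedSpace.exp (t • X) ∈ W := het.eventually (hW.mem_nhds h1W)
    have e1 : HasDerivAt (fun t : ℝ => H (NormedSpace.exp (t • X))) (fderiv ℝ H 1 X) 0 :=
      HasFDerivAt.comp_hasDerivAt (0 : ℝ) (by rw [he0]; exact hHd) he
    have e2 : HasDerivAt (fun t : ℝ => F (H (NormedSpace.exp (t • X))))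
        (fderiv ℝ F p (fderiv ℝ H 1 X)) 0 :=
      HasFDerivAt.comp_hasDerivAt (0 : ℝ) (by rw [he0, hHp]; exact hFd) e1
    refine ⟨fderiv ℝ H 1 X, e2.unique (he.congr_of_eventuallyEq ?_)⟩
    have hhs : ∀ᶠ t : ℝ in 𝓝 0, h (NormedSpace.exp (t • X)) ∈ φ.source := by
      have hc : Filter.Tendsto h (𝓝 1) (𝓝 1) := by
        have := (hh.contMDiffAt (hW.mem_nhds h1W)).continuousAt.tendsto
        rwa [hh1] at this
      exact (hc.comp het).eventually (source_mem_nhds d G)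
    filter_upwards [hev, hhs] with t ht ht'
    obtain ⟨u, hu, hut⟩ := hfU.ge ⟨ht, hX t⟩
    change f (φ.symm (φ (h (NormedSpace.exp (t • X))))) = _
    rw [φ.left_inv ht', ← hut, hhf u hu]

end LocalIsomorphism

/-! ### The Lie algebras of the unitary and symplectic groups. -/

/-- Velocities at the identity of curves of unitary elements are skew-adjoint. -/
lemma star_eq_neg_of_unitary_curve {A : Type*} [NormedRing A] [NormedAlgebra ℝ A] [StarRing A]
    (hs : Continuous (star : A → A)) (hsm : ∀ (t : ℝ) (x : A), star (t • x) = t • star x) {c : ℝ → A} {X : A}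
    (hc : ∀ᶠ t in 𝓝 0, c t ∈ unitary A) (h0 : c 0 = 1) (hX : HasDerivAt c X 0) : star X = -X := by
  have : ContinuousStar A := ⟨hs⟩
  have : StarModule ℝ A := ⟨hsm⟩
  have h1 := hX.star.mul hX
  have h2 : HasDerivAt (fun _ : ℝ => (1 : A)) 0 0 := hasDerivAt_const _ _
  have h3 := h1.unique (h2.congr_of_eventuallyEq (hc.mono fun t ht => (Unitary.mem_iff.1 ht).1))
  simp only [h0, star_one, mul_one, one_mul] at h3
  exact eq_neg_of_add_eq_zero_left h3

lemma exp_smul_mem_unitary {A : Type*} [NormedRing A] [NormedAlgebra ℝ A] [StarRing A]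
    [CompleteSpace A] (hs : Continuous (star : A → A))
    (hsm : ∀ (t : ℝ) (x : A), star (t • x) = t • star x) {X : A} (hX : star X = -X) (t : ℝ) :
    NormedSpace.exp (t • X) ∈ unitary A := by
  have : ContinuousStar A := ⟨hs⟩
  let _ : NormedAlgebra ℚ A := NormedAlgebra.restrictScalars ℚ ℝ A
  refine NormedSpace.exp_mem_unitary_of_mem_skewAdjoint ?_
  rw [skewAdjoint.mem_iff, hsm, hX, smul_neg]

open Matrix in
/-- The exponential of a traceless skew-Hermitian matrix has determinant one. -/
lemma det_exp_of_skew {n : ℕ} {X : Matrix (Fin n) (Fin n) ℂ} (hX : Xᴴ = -X) (htr : X.trace = 0) :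
    (NormedSpace.exp X).det = 1 := by
  have hH : (Complex.I • X).IsHermitian := by
    rw [Matrix.IsHermitian, conjTranspose_smul, hX]
    simp
  set U : Matrix (Fin n) (Fin n) ℂ := hH.eigenvectorUnitary.1 with hU
  set D : Fin n → ℂ := fun i => -Complex.I * hH.eigenvalues i with hD
  have hUs : star U * U = 1 := (Unitary.mem_iff.1 hH.eigenvectorUnitary.2).1
  have hUs' : U * star U = 1 := (Unitary.mem_iff.1 hH.eigenvectorUnitary.2).2
  have hUi : U⁻¹ = star U := Matrix.inv_eq_left_inv hUs
  have h1 : X = U * diagonal D * U⁻¹ := by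
    have h2 := hH.spectral_theorem
    rw [Unitary.conjStarAlgAut_apply] at h2
    have h3 : X = -Complex.I • (Complex.I • X) := by
      rw [smul_smul, neg_mul, Complex.I_mul_I, neg_neg, one_smul]
    rw [h3, h2, hUi]
    have h4 : diagonal D = -Complex.I • diagonal (RCLike.ofReal ∘ hH.eigenvalues) := by
      rw [← diagonal_smul]
      rfl
    rw [h4, mul_smul_comm, smul_mul_assoc]
  have hu : IsUnit U := ⟨⟨U, star U, hUs', hUs⟩, rfl⟩
  have h5 : ∑ i, D i = 0 := by
    rw [h1, trace_mul_comm, ← mul_assoc, hUi, hUs, one_mul, trace_diagonal] at htr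
    exact htr
  rw [h1, Matrix.exp_conj _ _ hu, Matrix.det_conj hu, Matrix.exp_diagonal, det_diagonal]
  simp only [Pi.coe_exp, ← Complex.exp_eq_exp_ℂ]
  rw [← Complex.exp_sum, h5, Complex.exp_zero]

section
variable {L : Type*} [LieRing L] [LieAlgebra ℝ L]

/-- Minus the Casimir operator of the adjoint representation is the identity. -/
lemma IsOrthon.sum_lie_lie_eq {ι : Type*} [Fintype ι] [DecidableEq ι] {f : Module.Basis ι ℝ L}
    (hf : IsOrthon (-killingForm ℝ L) f) (v : L) : ∑ j, ⁅⁅f j, v⁆, f j⁆ = v := by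
  have h : ∀ w, (-killingForm ℝ L) (∑ j, ⁅⁅f j, v⁆, f j⁆) w = (-killingForm ℝ L) v w := fun w => by
    rw [← hf.sum_lie_lie v w, map_sum, LinearMap.sum_apply]
    refine Finset.sum_congr rfl fun j _ => ?_
    rw [neg_killingForm_lie, ← lie_skew v, ← lie_skew w, map_neg, map_neg]
    generalize (-killingForm ℝ L) = q
    simp only [LinearMap.neg_apply, neg_neg]
  rw [← hf.sum_smul (∑ j, ⁅⁅f j, v⁆, f j⁆)]
  simp only [h]
  exact hf.sum_smul v
end

section
open scoped Matrix.Norms.Operator Quaternion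
open Matrix

variable {d : ℕ} {G : Type*} [TopologicalSpace G] [ChartedSpace (EuclideanSpace ℝ (Fin d)) G]
  [Group G] [LieGroup (𝓡 d) ∞ G] {n : ℕ}

lemma isUnit_of_mem_unitary {A : Type*} [Ring A] [StarRing A] {x : A} (hx : x ∈ unitary A) :
    IsUnit x :=
  ⟨⟨x, star x, (Unitary.mem_iff.1 hx).2, (Unitary.mem_iff.1 hx).1⟩, rfl⟩

lemma IsLocallySp.exists_linearMap (hG : IsLocallySp d G n) :
    ∃ ψ : GroupLieAlgebra (𝓡 d) G →ₗ[ℝ] Matrix (Fin n) (Fin n) ℍ[ℝ], Function.Injective ψ ∧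
      (∀ v w : GroupLieAlgebra (𝓡 d) G, ψ ⁅v, w⁆ = ψ v * ψ w - ψ w * ψ v) ∧
      (∀ v, (ψ v)ᴴ = -ψ v) ∧ ∀ X, Xᴴ = -X → ∃ v, ψ v = X := by
  have : CompleteSpace (Matrix (Fin n) (Fin n) ℍ[ℝ]) := FiniteDimensional.complete ℝ _
  have hs : Continuous fun X : Matrix (Fin n) (Fin n) ℍ[ℝ] => Xᴴ := continuous_id.matrix_conjTranspose
  have hsm : ∀ (t : ℝ) (X : Matrix (Fin n) (Fin n) ℍ[ℝ]), (t • X)ᴴ = t • Xᴴ := fun t X => by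
    refine Matrix.ext fun i j => ?_
    simp [conjTranspose_apply, Quaternion.star_smul]
  obtain ⟨ψ, h1, h2, h3, h4⟩ :=
    IsLocallyIsomorphicTo.exists_linearMap (fun x hx => isUnit_of_mem_unitary hx) hG
  refine ⟨ψ, h1, h2, fun v => ?_, fun X hX => h4 X fun t => exp_smul_mem_unitary hs hsm hX t⟩
  obtain ⟨c, hc, hc0, hcv⟩ := h3 v
  exact star_eq_neg_of_unitary_curve hs hsm hc hc0 hcv

lemma IsLocallySU.exists_linearMap (hK : IsPosSymm (-killingForm ℝ (GroupLieAlgebra (𝓡 d) G)))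
    (hG : IsLocallySU d G n) :
    ∃ ψ : GroupLieAlgebra (𝓡 d) G →ₗ[ℝ] Matrix (Fin n) (Fin n) ℂ, Function.Injective ψ ∧
      (∀ v w : GroupLieAlgebra (𝓡 d) G, ψ ⁅v, w⁆ = ψ v * ψ w - ψ w * ψ v) ∧
      (∀ v, (ψ v)ᴴ = -ψ v) ∧ (∀ v, (ψ v).trace = 0) ∧
      ∀ X, Xᴴ = -X → X.trace = 0 → ∃ v, ψ v = X := by
  have : CompleteSpace (Matrix (Fin n) (Fin n) ℂ) := FiniteDimensional.complete ℝ _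
  have hs : Continuous fun X : Matrix (Fin n) (Fin n) ℂ => Xᴴ := continuous_id.matrix_conjTranspose
  have hsm : ∀ (t : ℝ) (X : Matrix (Fin n) (Fin n) ℂ), (t • X)ᴴ = t • Xᴴ := fun t X => by
    rw [conjTranspose_smul, star_trivial]
  obtain ⟨ψ, h1, h2, h3, h4⟩ := IsLocallyIsomorphicTo.exists_linearMap
    (K := Matrix.specialUnitaryGroup (Fin n) ℂ) (fun x hx => isUnit_of_mem_unitary
      (mem_specialUnitaryGroup_iff.1 hx).1) hG
  refine ⟨ψ, h1, h2, fun v => ?_, fun v => ?_, fun X hX htr => h4 X fun t => ?_⟩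
  · obtain ⟨c, hc, hc0, hcv⟩ := h3 v
    exact star_eq_neg_of_unitary_curve hs hsm (hc.mono fun t ht => (mem_specialUnitaryGroup_iff.1 ht).1)
      hc0 hcv
  -- The Casimir identity writes `v` as a sum of brackets, whose images are commutators; no
  -- derivative of the determinant is needed.
  · obtain ⟨f, -, hf, -⟩ := hK.exists_eigenbasis 0 (by simp)
    rw [← hf.sum_lie_lie_eq v, map_sum, trace_sum]
    refine Finset.sum_eq_zero fun j _ => ?_
    rw [h2, trace_sub, trace_mul_comm, sub_self]
  · refine mem_specialUnitaryGroup_iff.2 ⟨exp_smul_mem_unitary hs hsm hX t, det_exp_of_skew ?_ ?_⟩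
    · rw [conjTranspose_smul, hX, star_trivial, smul_neg]
    · rw [trace_smul, htr, smul_zero]

end

/-! ### The inequality for the three-sphere. -/

/-- Schur's inequality of degree three. -/
lemma schur_inequality {x y z : ℝ} (hx : 0 < x) (hy : 0 < y) (hz : 0 < z) :
    x * y * (x + y) + y * z * (y + z) + z * x * (z + x) ≤ x ^ 3 + y ^ 3 + z ^ 3 + 3 * x * y * z := by
  have key : ∀ a b c : ℝ, 0 < c → c ≤ b → b ≤ a →
      a * b * (a + b) + b * c * (b + c) + c * a * (c + a) ≤
        a ^ 3 + b ^ 3 + c ^ 3 + 3 * a * b * c := fun a b c h0 h1 h2 => by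
    have e1 : 0 ≤ (a - b) ^ 2 * (a + b - c) := mul_nonneg (sq_nonneg _) (by linarith)
    have e2 : 0 ≤ c * ((a - c) * (b - c)) :=
      mul_nonneg h0.le (mul_nonneg (by linarith) (by linarith))
    linarith
  rcases le_total x y with h1 | h1 <;> rcases le_total y z with h2 | h2 <;>
    rcases le_total x z with h3 | h3
  · linarith [key z y x hx h1 h2]
  · linarith [key z y x hx h1 h2]
  · linarith [key y z x hx h3 h2]
  · linarith [key y x z hz h3 h1]
  · linarith [key z x y hy h1 h3]
  · linarith [key x z y hy h2 h3]
  · linarith [key x y z hz h2 h1]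
  · linarith [key x y z hz h2 h1]

lemma exists_pos_cube_eq {x : ℝ} (hx : 0 < x) : ∃ a : ℝ, 0 < a ∧ a ^ 3 = x := by
  refine ⟨Real.exp (Real.log x / 3), Real.exp_pos _, ?_⟩
  rw [← Real.exp_nat_mul]
  push_cast
  rw [mul_div_cancel₀ _ (by norm_num), Real.exp_log hx]

/-- The inequality behind the maximality of the round metric on the three-sphere. -/
lemma two_mul_sum_mul_sub_sum_sq_lt {x y z : ℝ} (hx : 0 < x) (hy : 0 < y) (hz : 0 < z)
    (h : x * y * z = 1) (hne : ¬ (x = 1 ∧ y = 1 ∧ z = 1)) :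
    2 * (x * y + y * z + z * x) - (x ^ 2 + y ^ 2 + z ^ 2) < 3 := by
  obtain ⟨a, ha, rfl⟩ := exists_pos_cube_eq hx
  obtain ⟨b, hb, rfl⟩ := exists_pos_cube_eq hy
  obtain ⟨c, hc, rfl⟩ := exists_pos_cube_eq hz
  have habc : a * b * c = 1 := by
    have h1 : (a * b * c) ^ 3 = 1 := by rw [← h]; ring
    exact (pow_eq_one_iff_of_nonneg (by positivity) (by norm_num)).1 h1
  -- Schur for the squares, where `a²b²c² = 1`, combines with `2a³b³ ≤ a²b²(a² + b²)`. If the bound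
  -- failed to be strict, all defects `(ab)²(a - b)²` would vanish.
  have hs := schur_inequality (pow_pos ha 2) (pow_pos hb 2) (pow_pos hc 2)
  have h2 : a ^ 2 * b ^ 2 * c ^ 2 = 1 := by
    rw [← mul_pow, ← mul_pow, habc, one_pow]
  have hp : ∀ u v : ℝ, u ^ 2 * v ^ 2 * (u ^ 2 + v ^ 2) - 2 * (u ^ 3 * v ^ 3) =
      (u * v) ^ 2 * (u - v) ^ 2 := fun u v => by ring
  have hnn : ∀ u v : ℝ, 0 ≤ (u * v) ^ 2 * (u - v) ^ 2 := fun u v => by positivity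
  by_contra! hcon
  have hzero : (a * b) ^ 2 * (a - b) ^ 2 + (b * c) ^ 2 * (b - c) ^ 2 +
      (c * a) ^ 2 * (c - a) ^ 2 ≤ 0 := by
    rw [← hp, ← hp, ← hp]
    nlinarith
  have hab : a = b := by
    have e1 : (a * b) ^ 2 * (a - b) ^ 2 = 0 := by linarith [hnn a b, hnn b c, hnn c a]
    have e2 := (mul_eq_zero.1 e1).resolve_left (by positivity)
    exact sub_eq_zero.1 (pow_eq_zero_iff (by norm_num) |>.1 e2)
  have hbc : b = c := by
    have e1 : (b * c) ^ 2 * (b - c) ^ 2 = 0 := by linarith [hnn a b, hnn b c, hnn c a]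
    have e2 := (mul_eq_zero.1 e1).resolve_left (by positivity)
    exact sub_eq_zero.1 (pow_eq_zero_iff (by norm_num) |>.1 e2)
  subst hab hbc
  have h3 : a ^ 3 = 1 := by rw [← habc]; ring
  exact hne ⟨h3, h3, h3⟩

/-! ### Scalar curvature in dimension three. -/

section ThreeDim

variable {L : Type*} [LieRing L] [LieAlgebra ℝ L] {κ : Type*} [Fintype κ] [DecidableEq κ]
  {b : Module.Basis κ ℝ L} {f : Module.Basis (Fin 3) ℝ L}

/-- Antisymmetry leaves one structure constant up to sign, with square `1/2` by normalization.
Determinant one turns `1 / l 0` into `l 1 * l 2` and `l 0 / (l 1 * l 2)` into `l 0 ^ 2`. -/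
lemma IsOrthon.lieScalarCurvature_diagonal_three (hf : IsOrthon (-killingForm ℝ L) f)
    {q : LinearMap.BilinForm ℝ L} {l : Fin 3 → ℝ} (hl : ∀ i, 0 < l i)
    (hq : ∀ i j, q (f i) (f j) = if i = j then l i else 0) (hdet : ∏ i, l i = 1) :
    lieScalarCurvature q b = 1 / 4 * (2 * (l 0 * l 1 + l 1 * l 2 + l 2 * l 0) -
      (l 0 ^ 2 + l 1 ^ 2 + l 2 ^ 2)) := by
  rw [hf.lieScalarCurvature_diagonal hl hq]
  have h0 := fun i k => structConst_self (f := f) i k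
  have h1 : ∀ i j, structConst f j i i = 0 := fun i j =>
    (structConst_rotate j i i).symm.trans (h0 i j)
  have h2 : ∀ i j, structConst f i j i = 0 := fun i j => by rw [structConst_swap, h1, neg_zero]
  have hsq := hf.sum_structConst_sq 0
  have e1 : structConst f 1 2 0 ^ 2 = structConst f 0 1 2 ^ 2 := by rw [structConst_rotate]
  have e2 : structConst f 2 0 1 ^ 2 = structConst f 0 1 2 ^ 2 := by
    rw [structConst_rotate, structConst_rotate]
  have e3 : structConst f 1 0 2 ^ 2 = structConst f 0 1 2 ^ 2 := by rw [structConst_swap, neg_sq]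
  have e4 : structConst f 0 2 1 ^ 2 = structConst f 0 1 2 ^ 2 := by rw [structConst_swap, neg_sq, e2]
  have e5 : structConst f 2 1 0 ^ 2 = structConst f 0 1 2 ^ 2 := by rw [structConst_swap, neg_sq, e1]
  simp only [Fin.sum_univ_three, h0, h1, h2, e4, zero_pow two_ne_zero, zero_add, add_zero] at hsq
  have hs : structConst f 0 1 2 ^ 2 = 1 / 2 := by linarith
  simp only [Fin.sum_univ_three, h0, h1, h2, e1, e2, e3, e4, e5, hs, zero_pow two_ne_zero, zero_add,
    add_zero, zero_mul]
  rw [Fin.prod_univ_three] at hdet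
  have n0 := (hl 0).ne'
  have n1 := (hl 1).ne'
  have n2 := (hl 2).ne'
  have i0 : (l 0)⁻¹ = l 1 * l 2 := by field_simp; linarith
  have i1 : (l 1)⁻¹ = l 2 * l 0 := by field_simp; linarith
  have i2 : (l 2)⁻¹ = l 0 * l 1 := by field_simp; linarith
  have j0 : l 0 / (l 1 * l 2) = l 0 ^ 2 := by field_simp; linarith
  have j0' : l 0 / (l 2 * l 1) = l 0 ^ 2 := by rw [mul_comm, j0]
  have j1 : l 1 / (l 2 * l 0) = l 1 ^ 2 := by field_simp; linarith
  have j1' : l 1 / (l 0 * l 2) = l 1 ^ 2 := by rw [mul_comm, j1]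
  have j2 : l 2 / (l 0 * l 1) = l 2 ^ 2 := by field_simp; linarith
  have j2' : l 2 / (l 1 * l 0) = l 2 ^ 2 := by rw [mul_comm, j2]
  rw [i0, i1, i2, j0, j0', j1, j1', j2, j2']
  ring

/-- Simultaneous diagonalization of two inner products. -/
lemma IsPosSymm.exists_diagonalizing_basis {V : Type*} [AddCommGroup V] [Module ℝ V]
    [FiniteDimensional ℝ V] {Q q : LinearMap.BilinForm ℝ V} (hQ : IsPosSymm Q) (hq : IsPosSymm q) :
    ∃ (f : Module.Basis (Fin (Module.finrank ℝ V)) ℝ V) (l : Fin (Module.finrank ℝ V) → ℝ),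
      IsOrthon Q f ∧ (∀ i, 0 < l i) ∧ ∀ i j, q (f i) (f j) = if i = j then l i else 0 := by
  obtain ⟨e, -, he, -⟩ := hQ.exists_eigenbasis 0 (by simp)
  -- `T` represents `q` through `Q`; it is self-adjoint for `Q`, and its eigenbasis diagonalizes
  -- both forms.
  let T : V →ₗ[ℝ] V := ∑ i, (q (e i)).smulRight (e i)
  have hT : ∀ v w, Q (T v) w = q v w := fun v w => by
    have h1 : q v w = q v (∑ i, Q w (e i) • e i) := by rw [he.sum_smul]
    rw [h1]
    simp [T, LinearMap.sum_apply, hq.1 v, hQ.1 w, mul_comm]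
  obtain ⟨f, l, hf, hfl⟩ := hQ.exists_eigenbasis T fun v w => by
    rw [hT, hQ.1, hT, hq.1]
  have hqf : ∀ i j, q (f i) (f j) = if i = j then l i else 0 := fun i j => by
    have : Q (f i) (f j) = if i = j then 1 else 0 := hf i j
    rw [← hT, hfl, map_smul, LinearMap.smul_apply, this]
    simp
  refine ⟨f, l, hf, fun i => ?_, hqf⟩
  have := hq.2 _ (f.ne_zero i)
  rwa [hqf, if_pos rfl] at this

end ThreeDim

/-! ### The strict maximum in dimension three. -/

section Sphere

variable {d : ℕ} {G : Type*} [TopologicalSpace G] [ChartedSpace (EuclideanSpace ℝ (Fin d)) G]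
  [Group G] [LieGroup (𝓡 d) ∞ G]

/-- In dimension three, the standard metric is the strict maximum of the scalar curvature. -/
lemma isStrictLocalMaxOn_standardMetric
    (hK : IsPosSymm (-killingForm ℝ (GroupLieAlgebra (𝓡 d) G)))
    (h3 : Module.finrank ℝ (GroupLieAlgebra (𝓡 d) G) = 3) :
    IsStrictLocalMaxOn scalarCurvature (metricsOfVolume (standardMetric d G))
      (standardMetric d G) := by
  have key : ∀ Q ∈ metricsOfVolume (standardMetric d G), ∃ l : Fin 3 → ℝ, (∀ i, 0 < l i) ∧
      ∏ i, l i = 1 ∧ ((∀ i, l i = 1) → Q = standardMetric d G) ∧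
      scalarCurvature Q = 1 / 4 * (2 * (l 0 * l 1 + l 1 * l 2 + l 2 * l 0) -
        (l 0 ^ 2 + l 1 ^ 2 + l 2 ^ 2)) := by
    intro Q hQ
    obtain ⟨f, l, hf, hl, hq⟩ := hK.exists_diagonalizing_basis (q := toForm Q) hQ.1
    have hdet := (hf.mem_metricsOfVolume_iff.1 hQ).2
    have hdiag : gramMatrix (toForm Q) f = Matrix.diagonal l := by
      ext i j
      rw [Matrix.diagonal_apply]
      exact hq i j
    rw [hdiag, Matrix.det_diagonal] at hdet
    set e := finCongr h3
    refine ⟨fun i => l (e.symm i), fun i => hl _, ?_, fun h1 => ?_, ?_⟩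
    · rw [Equiv.prod_comp e.symm, hdet]
    · have h : toForm Q = toForm (standardMetric d G) := by
        refine LinearMap.BilinForm.ext_basis f fun i j => ?_
        rw [toForm_standardMetric, hq, hf i j]
        have : l i = 1 := by simpa using h1 (e i)
        rw [this]
      ext v w
      exact LinearMap.congr_fun (LinearMap.congr_fun h v) w
    · rw [scalarCurvature_eq]
      refine IsOrthon.lieScalarCurvature_diagonal_three (f := f.reindex e) (fun i j => ?_)
        (fun i => hl _) (fun i j => ?_) (by rw [Equiv.prod_comp e.symm, hdet])
      · simpa using hf (e.symm i) (e.symm j)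
      · simpa using hq (e.symm i) (e.symm j)
  have hmem := standardMetric_mem hK
  have hS : scalarCurvature (standardMetric d G) = 3 / 4 := by
    obtain ⟨f, -, hf, -⟩ := hK.exists_eigenbasis 0 (by simp)
    have hf3 : IsOrthon (-killingForm ℝ (GroupLieAlgebra (𝓡 d) G)) (f.reindex (finCongr h3)) :=
      fun i j => by simpa using hf ((finCongr h3).symm i) ((finCongr h3).symm j)
    rw [scalarCurvature_eq, toForm_standardMetric, hf3.lieScalarCurvature_diagonal_three (l := fun _ => 1)
      (fun _ => one_pos) (fun i j => hf3 i j) (by simp)]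
    norm_num
  -- The inequality is global on the metrics of the given volume, so no neighbourhood has to be
  -- chosen.
  refine ⟨hmem, Filter.eventually_of_mem self_mem_nhdsWithin fun Q hQ => ?_⟩
  obtain ⟨l, hl, hdet, h1, hQS⟩ := key Q hQ.1
  rw [hS, hQS]
  rw [Fin.prod_univ_three] at hdet
  have := two_mul_sum_mul_sub_sum_sq_lt (hl 0) (hl 1) (hl 2) hdet fun h => hQ.2 (h1 fun i => by
    match i with
    | 0 => exact h.1
    | 1 => exact h.2.1
    | 2 => exact h.2.2)
  linarith

end Sphere
end LeftInvariant

end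

theorem theorem3 {d : ℕ} (hd : 0 < d) {G : Type*} [TopologicalSpace G]
    [ChartedSpace (EuclideanSpace ℝ (Fin d)) G] [Group G] [LieGroup (𝓡 d) ∞ G]
    [CompactSpace G] [T2Space G] [LieAlgebra.IsSemisimple ℝ (GroupLieAlgebra (𝓡 d) G)] :
    LeftInvariant.IsInnerProduct (LeftInvariant.standardMetric d G) ∧
    (LeftInvariant.IsLocallySU d G 2 →
      LeftInvariant.IsStrictLocalMaxOn LeftInvariant.scalarCurvature
        (LeftInvariant.metricsOfVolume (LeftInvariant.standardMetric d G))
        (LeftInvariant.standardMetric d G)) ∧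
    ¬ IsLocalMinOn LeftInvariant.scalarCurvature
        (LeftInvariant.metricsOfVolume (LeftInvariant.standardMetric d G))
        (LeftInvariant.standardMetric d G) ∧
    (¬ LieAlgebra.IsSimple ℝ (GroupLieAlgebra (𝓡 d) G) →
      LeftInvariant.IsSaddlePointOn LeftInvariant.scalarCurvature
        (LeftInvariant.metricsOfVolume (LeftInvariant.standardMetric d G))
        (LeftInvariant.standardMetric d G)) ∧
    (∀ n : ℕ, 2 ≤ n → LeftInvariant.IsLocallySp d G n →
      LeftInvariant.IsSaddlePointOn LeftInvariant.scalarCurvature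
        (LeftInvariant.metricsOfVolume (LeftInvariant.standardMetric d G))
        (LeftInvariant.standardMetric d G)) ∧
    (∀ n : ℕ, 3 ≤ n → LeftInvariant.IsLocallySU d G n →
      LeftInvariant.IsSaddlePointOn LeftInvariant.scalarCurvature
        (LeftInvariant.metricsOfVolume (LeftInvariant.standardMetric d G))
        (LeftInvariant.standardMetric d G)) := by
  have hK := LeftInvariant.isPosSymm_neg_killingForm d G
  have hfin : Module.finrank ℝ (GroupLieAlgebra (𝓡 d) G) = d :=
    finrank_euclideanSpace_fin (𝕜 := ℝ) (n := d)
  have : Nontrivial (GroupLieAlgebra (𝓡 d) G) :=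
    Module.nontrivial_of_finrank_pos (R := ℝ) (hfin.symm ▸ hd)
  have : FiniteDimensional ℝ (GroupLieAlgebra (𝓡 d) G) :=
    Module.finite_of_finrank_pos (hfin.symm ▸ hd)
  refine ⟨hK, fun hG => ?_, LeftInvariant.not_isLocalMinOn_standardMetric hK, fun hs => ?_,
    fun n hn hG => ?_, fun n hn hG => ?_⟩
  · obtain ⟨ψ, hψ, -, hskew, htr, hsurj⟩ := LeftInvariant.IsLocallySU.exists_linearMap hK hG
    -- With `p = 1` the dimension `1 ^ 2 + 2 * 1` reduces to `3`.
    exact LeftInvariant.isStrictLocalMaxOn_standardMetric hK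
      (LeftInvariant.finrank_of_specialUnitary (p := 1) hψ hskew htr hsurj)
  · obtain ⟨I, h0, h1⟩ := LeftInvariant.exists_ideal_of_not_isSimple hK hs
    exact LeftInvariant.isSaddlePointOn_standardMetric hK
      (hK.exists_not_isLocalMax_of_ideal I h0 h1)
  · obtain ⟨p, rfl⟩ : ∃ p, n = p + 1 := ⟨n - 1, by omega⟩
    obtain ⟨ψ, hψ, hlie, hskew, hsurj⟩ := LeftInvariant.IsLocallySp.exists_linearMap hG
    exact LeftInvariant.isSaddlePointOn_standardMetric hK
      (hK.exists_not_isLocalMax_of_symplectic (by omega) hψ hlie hskew hsurj)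
  · obtain ⟨p, rfl⟩ : ∃ p, n = p + 1 := ⟨n - 1, by omega⟩
    obtain ⟨ψ, hψ, hlie, hskew, htr, hsurj⟩ := LeftInvariant.IsLocallySU.exists_linearMap hK hG
    exact LeftInvariant.isSaddlePointOn_standardMetric hK
      (hK.exists_not_isLocalMax_of_specialUnitary (by omega) hψ hlie hskew htr hsurj)
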